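/- Let $V=\{v_1,\dots,v_n\}$, $n\ge 1$, be a set of $n$ points (customers) in the Euclidean plane in general position: no three are collinear and no two share an $x$- or a $y$-coordinate. Let $w(v_i)>0$ be their weights and let $R\ge 0$. For a point $x$ of the plane define its weight loss $$W^*(x)=\max_{y\in\mathbb{R}^2,\ d(y,x)\ge R}\ \sum\{w(v): v\in V,\ d(v,y)<d(v,x)\}.$$ A local optimal point on a line $L$ is a point $x^*_L\in L$ with $W^*(x^*_L)\le W^*(x)$ for all $x\in L$. On a real RAM (unit-cost exact real arithmetic $+,-,\times,/,\sqrt{\cdot}$, comparisons, index arithmetic and indirectly addressed arrays) there are two fixed programs, a preprocessing program and a query program, and an absolute constant $C$ such that for all $n$, $V$, $w$, $R$ as above: (1) given $V$, $w$ and $R$, the preprocessing program halts after at most $C\,n^2\log(n+1)$ steps, i.e. in $O(n^2\log n)$ time; (2) afterwards, given the coefficients of an arbitrary line $L$, the query program halts after at most $C\,n\log^2(n+1)$ steps, i.e. in $O(n\log^2 n)$ time, and outputs a local optimal point on $L$. One preprocessing serves any finite sequence of such queries. -/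

import Mathlib

/-! ## The location problem -/

/-- The Euclidean plane. -/
abbrev Plane : Type := EuclideanSpace ℝ (Fin 2)

/-- General position: no two customers share an x- or a y-coordinate (in particular the customers
are pairwise distinct), and no three customers are collinear. -/
structure GeneralPosition {n : ℕ} (v : Fin n → Plane) : Prop where
  x_ne : ∀ i j, i ≠ j → v i 0 ≠ v j 0
  y_ne : ∀ i j, i ≠ j → v i 1 ≠ v j 1
  not_collinear : ∀ i j k, i ≠ j → i ≠ k → j ≠ k → ¬ Collinear ℝ {v i, v j, v k}

open Classical in
/-- `W(y|x)`: the total weight of the customers strictly closer to the follower's point `y` than to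
the leader's point `x` (ties are broken in favour of the leader). -/
noncomputable def capturedWeight {n : ℕ} (v : Fin n → Plane) (w : Fin n → ℝ) (x y : Plane) : ℝ :=
  ∑ i with dist (v i) y < dist (v i) x, w i

/-- The weight loss `W*(x)`: the maximum of `W(y|x)` over the feasible points `y` of the follower,
that is, those with `d(y,x) ≥ R`. By `isGreatest_weightLoss` the supremum is a maximum. -/
noncomputable def weightLoss {n : ℕ} (v : Fin n → Plane) (w : Fin n → ℝ) (R : ℝ) (x : Plane) : ℝ :=
  sSup (capturedWeight v w x '' {y | R ≤ dist y x})

theorem isGreatest_weightLoss {n : ℕ} (v : Fin n → Plane) (w : Fin n → ℝ) (R : ℝ) (x : Plane) :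
    IsGreatest (capturedWeight v w x '' {y | R ≤ dist y x}) (weightLoss v w R x) := by
  classical
  have hfin : (capturedWeight v w x '' {y | R ≤ dist y x}).Finite := by
    refine (Set.finite_range (fun S : Finset (Fin n) => ∑ i ∈ S, w i)).subset ?_
    rintro _ ⟨y, -, rfl⟩
    refine ⟨Finset.univ.filter (fun i => dist (v i) y < dist (v i) x), ?_⟩
    unfold capturedWeight
    congr!
  have hne : (capturedWeight v w x '' {y | R ≤ dist y x}).Nonempty := by
    refine Set.Nonempty.image _ ⟨x + EuclideanSpace.single 0 R, ?_⟩
    simp [le_abs_self]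
  exact ⟨hne.csSup_mem hfin, fun _ h => le_csSup hfin.bddAbove h⟩

/-- A line of the plane, given by an equation `a x + b y = c` with `(a, b) ≠ (0, 0)`. -/
structure Line where
  a : ℝ
  b : ℝ
  c : ℝ
  nondegenerate : a ≠ 0 ∨ b ≠ 0

/-- The set of points of a line. -/
def Line.points (L : Line) : Set Plane := {p | L.a * p 0 + L.b * p 1 = L.c}

/-- A local optimal point on `L`: a point of `L` whose weight loss is least among the points
of `L`. -/
def IsLocalOptimal {n : ℕ} (v : Fin n → Plane) (w : Fin n → ℝ) (R : ℝ) (L : Line) (x : Plane) :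
    Prop :=
  x ∈ L.points ∧ ∀ x' ∈ L.points, weightLoss v w R x ≤ weightLoss v w R x'

/-! ## The real RAM

Real registers and arrays hold exact real numbers; natural-number registers and arrays hold
indices. Arrays are addressed indirectly, through index expressions. The unit-cost operations are
`+, -, *, /, √` and comparison on reals, and `+`, truncated `-`, halving and comparison on
indices; no real number can be converted into an index. A program is a fixed finite text, so it
uses finitely many registers and arrays and finitely many rational constants. -/

namespace RealRAM

/-- A memory configuration: `natReg r` and `realReg r` are the contents of the registers number `r`,
and `natMem m i`, `realMem m i` the contents of cell `i` of the array number `m`. -/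
structure State where
  natReg : ℕ → ℕ
  realReg : ℕ → ℝ
  natMem : ℕ → ℕ → ℕ
  realMem : ℕ → ℕ → ℝ

/-- Index expressions. -/
inductive NatExpr : Type
  | const (k : ℕ)
  | reg (r : ℕ)
  | read (m : ℕ) (i : NatExpr)
  | add (e f : NatExpr)
  | sub (e f : NatExpr)
  | half (e : NatExpr)

/-- The value of an index expression. -/
def NatExpr.eval (s : State) : NatExpr → ℕ
  | .const k => k
  | .reg r => s.natReg r
  | .read m i => s.natMem m (i.eval s)
  | .add e f => e.eval s + f.eval s
  | .sub e f => e.eval s - f.eval s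
  | .half e => e.eval s / 2

/-- The cost of evaluating an index expression: one unit for every constant, register access, array
access and operation. -/
def NatExpr.cost : NatExpr → ℕ
  | .const _ => 1
  | .reg _ => 1
  | .read _ i => i.cost + 1
  | .add e f => e.cost + f.cost + 1
  | .sub e f => e.cost + f.cost + 1
  | .half e => e.cost + 1

/-- Real expressions. -/
inductive RealExpr : Type
  | const (q : ℚ)
  | reg (r : ℕ)
  | read (m : ℕ) (i : NatExpr)
  | add (e f : RealExpr)
  | sub (e f : RealExpr)
  | mul (e f : RealExpr)
  | div (e f : RealExpr)
  | sqrt (e : RealExpr)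

/-- The value of a real expression. Division by zero and square roots of negative numbers return
zero; as programs can test signs, this convention gives no additional power. -/
noncomputable def RealExpr.eval (s : State) : RealExpr → ℝ
  | .const q => (q : ℝ)
  | .reg r => s.realReg r
  | .read m i => s.realMem m (i.eval s)
  | .add e f => e.eval s + f.eval s
  | .sub e f => e.eval s - f.eval s
  | .mul e f => e.eval s * f.eval s
  | .div e f => e.eval s / f.eval s
  | .sqrt e => Real.sqrt (e.eval s)

/-- The cost of evaluating a real expression. -/
def RealExpr.cost : RealExpr → ℕ
  | .const _ => 1
  | .reg _ => 1
  | .read _ i => i.cost + 1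
  | .add e f => e.cost + f.cost + 1
  | .sub e f => e.cost + f.cost + 1
  | .mul e f => e.cost + f.cost + 1
  | .div e f => e.cost + f.cost + 1
  | .sqrt e => e.cost + 1

/-- Tests. -/
inductive Test : Type
  | natLt (e f : NatExpr)
  | natLe (e f : NatExpr)
  | realLt (e f : RealExpr)
  | realLe (e f : RealExpr)
  | not (b : Test)
  | and (b c : Test)
  | or (b c : Test)

/-- The truth value of a test. -/
def Test.Holds (s : State) : Test → Prop
  | .natLt e f => e.eval s < f.eval s
  | .natLe e f => e.eval s ≤ f.eval s
  | .realLt e f => e.eval s < f.eval s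
  | .realLe e f => e.eval s ≤ f.eval s
  | .not b => ¬ b.Holds s
  | .and b c => b.Holds s ∧ c.Holds s
  | .or b c => b.Holds s ∨ c.Holds s

/-- The cost of evaluating a test. -/
def Test.cost : Test → ℕ
  | .natLt e f => e.cost + f.cost + 1
  | .natLe e f => e.cost + f.cost + 1
  | .realLt e f => e.cost + f.cost + 1
  | .realLe e f => e.cost + f.cost + 1
  | .not b => b.cost + 1
  | .and b c => b.cost + c.cost + 1
  | .or b c => b.cost + c.cost + 1

/-- Programs. -/
inductive Program : Type
  | skip
  | setNat (r : ℕ) (e : NatExpr)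
  | setReal (r : ℕ) (e : RealExpr)
  | writeNat (m : ℕ) (i : NatExpr) (e : NatExpr)
  | writeReal (m : ℕ) (i : NatExpr) (e : RealExpr)
  | seq (p q : Program)
  | ite (b : Test) (p q : Program)
  | while (b : Test) (p : Program)

/-- `Exec p s t s'`: started in the configuration `s`, the program `p` halts after exactly `t` steps
in the configuration `s'`. -/
inductive Exec : Program → State → ℕ → State → Prop
  | skip (s : State) : Exec .skip s 1 s
  | setNat (s : State) (r : ℕ) (e : NatExpr) :
      Exec (.setNat r e) s (e.cost + 1)
        { s with natReg := Function.update s.natReg r (e.eval s) }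
  | setReal (s : State) (r : ℕ) (e : RealExpr) :
      Exec (.setReal r e) s (e.cost + 1)
        { s with realReg := Function.update s.realReg r (e.eval s) }
  | writeNat (s : State) (m : ℕ) (i e : NatExpr) :
      Exec (.writeNat m i e) s (i.cost + e.cost + 1)
        { s with natMem :=
            Function.update s.natMem m (Function.update (s.natMem m) (i.eval s) (e.eval s)) }
  | writeReal (s : State) (m : ℕ) (i : NatExpr) (e : RealExpr) :
      Exec (.writeReal m i e) s (i.cost + e.cost + 1)
        { s with realMem :=
            Function.update s.realMem m (Function.update (s.realMem m) (i.eval s) (e.eval s)) }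
  | seq {p q : Program} {s s' s'' : State} {t t' : ℕ} :
      Exec p s t s' → Exec q s' t' s'' → Exec (.seq p q) s (t + t') s''
  | iteTrue {b : Test} {p q : Program} {s s' : State} {t : ℕ} :
      b.Holds s → Exec p s t s' → Exec (.ite b p q) s (b.cost + t) s'
  | iteFalse {b : Test} {p q : Program} {s s' : State} {t : ℕ} :
      ¬ b.Holds s → Exec q s t s' → Exec (.ite b p q) s (b.cost + t) s'
  | whileFalse {b : Test} {p : Program} {s : State} :
      ¬ b.Holds s → Exec (.while b p) s b.cost s
  | whileTrue {b : Test} {p : Program} {s s' s'' : State} {t t' : ℕ} :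
      b.Holds s → Exec p s t s' → Exec (.while b p) s' t' s'' →
        Exec (.while b p) s (b.cost + t + t') s''

/-- Execution is deterministic: the number of steps and the final configuration are unique. -/
theorem Exec.unique {p : Program} {s s₁ s₂ : State} {t₁ t₂ : ℕ}
    (h₁ : Exec p s t₁ s₁) (h₂ : Exec p s t₂ s₂) : t₁ = t₂ ∧ s₁ = s₂ := by
  induction h₁ generalizing t₂ s₂ with
  | skip => cases h₂; exact ⟨rfl, rfl⟩
  | setNat => cases h₂; exact ⟨rfl, rfl⟩
  | setReal => cases h₂; exact ⟨rfl, rfl⟩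
  | writeNat => cases h₂; exact ⟨rfl, rfl⟩
  | writeReal => cases h₂; exact ⟨rfl, rfl⟩
  | seq _ _ ih₁ ih₂ =>
    cases h₂ with
    | seq g₁ g₂ =>
      obtain ⟨rfl, rfl⟩ := ih₁ g₁
      obtain ⟨rfl, rfl⟩ := ih₂ g₂
      exact ⟨rfl, rfl⟩
  | iteTrue hb _ ih =>
    cases h₂ with
    | iteTrue _ g =>
      obtain ⟨rfl, rfl⟩ := ih g
      exact ⟨rfl, rfl⟩
    | iteFalse hb' _ => exact absurd hb hb'
  | iteFalse hb _ ih =>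
    cases h₂ with
    | iteTrue hb' _ => exact absurd hb' hb
    | iteFalse _ g =>
      obtain ⟨rfl, rfl⟩ := ih g
      exact ⟨rfl, rfl⟩
  | whileFalse hb =>
    cases h₂ with
    | whileFalse _ => exact ⟨rfl, rfl⟩
    | whileTrue hb' _ _ => exact absurd hb' hb
  | whileTrue hb _ _ ih₁ ih₂ =>
    cases h₂ with
    | whileFalse hb' => exact absurd hb hb'
    | whileTrue _ g₁ g₂ =>
      obtain ⟨rfl, rfl⟩ := ih₁ g₁
      obtain ⟨rfl, rfl⟩ := ih₂ g₂
      exact ⟨rfl, rfl⟩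

end RealRAM

/-! ## Input and output conventions -/

/-- The initial configuration: `n` in index register 0, the minimal distance `R` in real register 0,
the coordinates and the weights of the customers in the first `n` cells of the real arrays 0, 1
and 2, and zero everywhere else. -/
noncomputable def inputState {n : ℕ} (v : Fin n → Plane) (w : Fin n → ℝ) (R : ℝ) :
    RealRAM.State where
  natReg r := if r = 0 then n else 0
  realReg r := if r = 0 then R else 0
  natMem _ _ := 0
  realMem m i :=
    if h : i < n then
      if m = 0 then v ⟨i, h⟩ 0 else if m = 1 then v ⟨i, h⟩ 1 else if m = 2 then w ⟨i, h⟩ else 0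
    else 0

/-- Posing a query: the coefficients of the line are put into the real registers 1, 2 and 3, and all
the rest of the memory is kept. -/
def loadLine (L : Line) (s : RealRAM.State) : RealRAM.State :=
  { s with realReg := fun r =>
      if r = 1 then L.a else if r = 2 then L.b else if r = 3 then L.c else s.realReg r }

/-- The answer to a query: the point whose coordinates are in the real registers 4 and 5. -/
def outputPoint (s : RealRAM.State) : Plane := !₂[s.realReg 4, s.realReg 5]

/-- The configurations that can be reached from `s₁` by running the program `query` on finitely many
(possibly no) lines, one after the other. -/
inductive AfterQueries (query : RealRAM.Program) (s₁ : RealRAM.State) : RealRAM.State → Prop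
  | none : AfterQueries query s₁ s₁
  | step {s s' : RealRAM.State} {t : ℕ} (L : Line) :
      AfterQueries query s₁ s → RealRAM.Exec query (loadLine L s) t s' → AfterQueries query s₁ s'

/-!
Why the problem can be solved within these bounds.

*Reduction to one dimension.* A follower who attacks the leader's point in the direction of a unit
vector `u` does best at distance just above `R`, and wins the customers in an open half-plane with
normal `u`. With the coordinates `ξ` along and `h` over the line, and with the tangent `t` of half
the angle between `u` and the normal of the line, customer `(ξ, h)` is lost by the point `s` of the
line iff `(r + h) t² - 2 (s - ξ) t + (r - h) < 0`, where `r = R / 2` (`Captures`). As `t > 0`, this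
condition is monotone in `s`. Hence the loss is the maximum (`lineLoss`) of a function that increases
along the line and one that decreases, each of them being the `depth` of the line or of its mirror
image (`LineCoordinates.weightLoss_eq_lineLoss`). After comparing the two at a point, one knows on
which side of it all better points are (`lineLoss_le_of_le`, `lineLoss_le_of_ge`). Both functions
are found by sorting, for every customer, the ends of the interval of those `t` that capture it and
sweeping over them, in `O(n log n)` steps (`eq_depth_of_events`, `RealRAM.runs_lossProgram`).

*Candidates.* A jump of the depth occurs where a set of customers can only just be captured, so that
the boundary of the half-plane is pinned by two customers, or by one at which the position is
stationary in `t`. This yields `O(n²)` numbers, computed from pairs of customers, among which there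
is a minimizer unless the first point tried is one already (`candidate`,
`exists_candidate_lineLoss_le`).

*Search.* For a fixed customer `i`, the candidate of `i` and `j` is monotone in the slope of the line
through both, as long as this slope does not pass that of the query line, provided that the decreasing
part of the underlying function is cut off (`envelope_mono`, `RealRAM.candidate_le_candidate`).
So the preprocessing sorts, for every `i`, the other customers by slope, in `O(n² log n)` steps. A
query cuts each of these lists where the slope passes that of the line, by bisection, and then holds
the candidates implicitly in `4 n` sorted lists. Every round of the search evaluates the loss at the
weighted median of the middle elements of the lists; half of the lists, counted by their sizes, are
then halved, so that `O(log n)` rounds of `O(n log n)` steps suffice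
(`RealRAM.runs_searchRound`, `RealRAM.total_size_le`).

Programs are verified in a Hoare logic with step counts (`RealRAM.Runs`), in which the part of the
memory that a program leaves unchanged is read off from its text (`RealRAM.Frame`). Memory is laid
out as follows. Real arrays: 0 to 2 input, 3 and 4 the coordinates `ξ` and `h`, 5 the weights of the
sweep events, 10 the keys for sorting, 11 the middle candidates. Index arrays: 0 the sorted rows, 2 to
4 the customer, beginning and end of every list, 5 the middles of the lists, 20 the sorted indices.
Real registers: 0 `R`, 1 to 3 the line, 4 and 5 the output, 6 the length of the normal vector, 7 `r`,
8 the sign of the candidates, 9 the point to evaluate, 10 and 11 the best point and its loss.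
-/

/-! ### A program logic with step counts for the real RAM -/

namespace RealRAM

/-- `p` halts from `s` within `T` steps, in a configuration that satisfies `Q`. -/
def Runs (p : Program) (s : State) (T : ℕ) (Q : State → Prop) : Prop :=
  ∃ t s', Exec p s t s' ∧ t ≤ T ∧ Q s'

/-- Whether the index register `r` is assigned to somewhere in the program text. -/
def Program.writesNatReg : Program → ℕ → Bool
  | .setNat r' _, r => r' == r
  | .seq p q, r => p.writesNatReg r || q.writesNatReg r
  | .ite _ p q, r => p.writesNatReg r || q.writesNatReg r
  | .while _ p, r => p.writesNatReg r
  | _, _ => false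

/-- Whether the real register `r` is assigned to somewhere in the program text. -/
def Program.writesRealReg : Program → ℕ → Bool
  | .setReal r' _, r => r' == r
  | .seq p q, r => p.writesRealReg r || q.writesRealReg r
  | .ite _ p q, r => p.writesRealReg r || q.writesRealReg r
  | .while _ p, r => p.writesRealReg r
  | _, _ => false

/-- Whether some cell of the index array `m` is assigned to somewhere in the program text. -/
def Program.writesNatMem : Program → ℕ → Bool
  | .writeNat m' _ _, m => m' == m
  | .seq p q, m => p.writesNatMem m || q.writesNatMem m
  | .ite _ p q, m => p.writesNatMem m || q.writesNatMem m
  | .while _ p, m => p.writesNatMem m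
  | _, _ => false

/-- Whether some cell of the real array `m` is assigned to somewhere in the program text. -/
def Program.writesRealMem : Program → ℕ → Bool
  | .writeReal m' _ _, m => m' == m
  | .seq p q, m => p.writesRealMem m || q.writesRealMem m
  | .ite _ p q, m => p.writesRealMem m || q.writesRealMem m
  | .while _ p, m => p.writesRealMem m
  | _, _ => false

/-- `s'` agrees with `s` on all registers and arrays that `p` does not write to. -/
structure Frame (p : Program) (s s' : State) : Prop where
  natReg : ∀ r, p.writesNatReg r = false → s'.natReg r = s.natReg r
  realReg : ∀ r, p.writesRealReg r = false → s'.realReg r = s.realReg r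
  natMem : ∀ m, p.writesNatMem m = false → s'.natMem m = s.natMem m
  realMem : ∀ m, p.writesRealMem m = false → s'.realMem m = s.realMem m

theorem Frame.refl (p : Program) (s : State) : Frame p s s :=
  ⟨fun _ _ => rfl, fun _ _ => rfl, fun _ _ => rfl, fun _ _ => rfl⟩

theorem Frame.trans {p : Program} {s s' s'' : State} (h : Frame p s s') (h' : Frame p s' s'') :
    Frame p s s'' :=
  ⟨fun r hr => (h'.natReg r hr).trans (h.natReg r hr),
   fun r hr => (h'.realReg r hr).trans (h.realReg r hr),
   fun r hr => (h'.natMem r hr).trans (h.natMem r hr),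
   fun r hr => (h'.realMem r hr).trans (h.realMem r hr)⟩

theorem Frame.mono {p q : Program} {s s' : State} (h : Frame p s s')
    (h₁ : ∀ r, q.writesNatReg r = false → p.writesNatReg r = false)
    (h₂ : ∀ r, q.writesRealReg r = false → p.writesRealReg r = false)
    (h₃ : ∀ r, q.writesNatMem r = false → p.writesNatMem r = false)
    (h₄ : ∀ r, q.writesRealMem r = false → p.writesRealMem r = false) : Frame q s s' :=
  ⟨fun r hr => h.natReg r (h₁ r hr), fun r hr => h.realReg r (h₂ r hr),
   fun r hr => h.natMem r (h₃ r hr), fun r hr => h.realMem r (h₄ r hr)⟩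

theorem Frame.seq_left {p q : Program} {s s' : State} (h : Frame p s s') :
    Frame (.seq p q) s s' := by
  apply h.mono <;> intro r hr <;>
    simp_all [Program.writesNatReg, Program.writesRealReg, Program.writesNatMem,
      Program.writesRealMem]

theorem Frame.seq_right {p q : Program} {s s' : State} (h : Frame q s s') :
    Frame (.seq p q) s s' := by
  apply h.mono <;> intro r hr <;>
    simp_all [Program.writesNatReg, Program.writesRealReg, Program.writesNatMem,
      Program.writesRealMem]

theorem Frame.ite_left {b : Test} {p q : Program} {s s' : State} (h : Frame p s s') :
    Frame (.ite b p q) s s' := by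
  apply h.mono <;> intro r hr <;>
    simp_all [Program.writesNatReg, Program.writesRealReg, Program.writesNatMem,
      Program.writesRealMem]

theorem Frame.ite_right {b : Test} {p q : Program} {s s' : State} (h : Frame q s s') :
    Frame (.ite b p q) s s' := by
  apply h.mono <;> intro r hr <;>
    simp_all [Program.writesNatReg, Program.writesRealReg, Program.writesNatMem,
      Program.writesRealMem]

theorem Frame.while {b : Test} {p : Program} {s s' : State} (h : Frame p s s') :
    Frame (.while b p) s s' := by
  apply h.mono <;> intro r hr <;>
    simpa [Program.writesNatReg, Program.writesRealReg, Program.writesNatMem,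
      Program.writesRealMem] using hr

theorem Exec.frame {p : Program} {s s' : State} {t : ℕ} (h : Exec p s t s') : Frame p s s' := by
  induction h with
  | skip s => exact Frame.refl _ _
  | setNat s r e =>
    refine ⟨fun r' hr => ?_, fun _ _ => rfl, fun _ _ => rfl, fun _ _ => rfl⟩
    simp only [Program.writesNatReg, beq_eq_false_iff_ne] at hr
    simp [Function.update_of_ne hr.symm]
  | setReal s r e =>
    refine ⟨fun _ _ => rfl, fun r' hr => ?_, fun _ _ => rfl, fun _ _ => rfl⟩
    simp only [Program.writesRealReg, beq_eq_false_iff_ne] at hr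
    simp [Function.update_of_ne hr.symm]
  | writeNat s m i e =>
    refine ⟨fun _ _ => rfl, fun _ _ => rfl, fun r' hr => ?_, fun _ _ => rfl⟩
    simp only [Program.writesNatMem, beq_eq_false_iff_ne] at hr
    simp [Function.update_of_ne hr.symm]
  | writeReal s m i e =>
    refine ⟨fun _ _ => rfl, fun _ _ => rfl, fun _ _ => rfl, fun r' hr => ?_⟩
    simp only [Program.writesRealMem, beq_eq_false_iff_ne] at hr
    simp [Function.update_of_ne hr.symm]
  | seq _ _ ih₁ ih₂ => exact ih₁.seq_left.trans ih₂.seq_right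
  | iteTrue _ _ ih => exact ih.ite_left
  | iteFalse _ _ ih => exact ih.ite_right
  | whileFalse => exact Frame.refl _ _
  | whileTrue _ _ _ ih₁ ih₂ => exact ih₁.while.trans ih₂

theorem Runs.mono {p : Program} {s : State} {T T' : ℕ} {Q Q' : State → Prop}
    (h : Runs p s T Q) (hT : T ≤ T') (hQ : ∀ s', Frame p s s' → Q s' → Q' s') :
    Runs p s T' Q' := by
  obtain ⟨t, s', he, ht, hq⟩ := h
  exact ⟨t, s', he, ht.trans hT, hQ s' he.frame hq⟩

theorem Runs.seq {p q : Program} {s : State} {T₁ T₂ : ℕ} {R Q : State → Prop}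
    (hp : Runs p s T₁ R) (hq : ∀ s', Frame p s s' → R s' → Runs q s' T₂ Q) :
    Runs (.seq p q) s (T₁ + T₂) Q := by
  obtain ⟨t, s', he, ht, hr⟩ := hp
  obtain ⟨t', s'', he', ht', hQ⟩ := hq s' he.frame hr
  exact ⟨t + t', s'', he.seq he', by omega, hQ⟩

/-- The number of nodes of the program: an upper bound for the cost of a loop-free program. -/
def Program.bound : Program → ℕ
  | .skip => 1
  | .setNat _ e => e.cost + 1
  | .setReal _ e => e.cost + 1
  | .writeNat _ i e => i.cost + e.cost + 1
  | .writeReal _ i e => i.cost + e.cost + 1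
  | .seq p q => p.bound + q.bound
  | .ite b p q => b.cost + (p.bound + q.bound)
  | .while _ _ => 0

/-- Whether the program contains no loop. -/
def Program.loopFree : Program → Bool
  | .seq p q => p.loopFree && q.loopFree
  | .ite _ p q => p.loopFree && q.loopFree
  | .while _ _ => false
  | _ => true

/-- The weakest precondition of a loop-free program. Assigned values are named by quantifiers, so
that the description of the final configuration does not grow exponentially. -/
def Program.wp : Program → (State → Prop) → State → Prop
  | .skip, Q, s => Q s
  | .setNat r e, Q, s => ∀ x, x = e.eval s → Q { s with natReg := Function.update s.natReg r x }
  | .setReal r e, Q, s => ∀ x, x = e.eval s → Q { s with realReg := Function.update s.realReg r x }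
  | .writeNat m i e, Q, s => ∀ j x, j = i.eval s → x = e.eval s → Q { s with
      natMem := Function.update s.natMem m (Function.update (s.natMem m) j x) }
  | .writeReal m i e, Q, s => ∀ j x, j = i.eval s → x = e.eval s → Q { s with
      realMem := Function.update s.realMem m (Function.update (s.realMem m) j x) }
  | .seq p q, Q, s => p.wp (q.wp Q) s
  | .ite b p q, Q, s => (b.Holds s → p.wp Q s) ∧ (¬ b.Holds s → q.wp Q s)
  | .while _ _, _, _ => False

theorem Runs.of_wp {p : Program} {s : State} {T : ℕ} {Q : State → Prop} (hQ : p.wp Q s)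
    (hp : p.loopFree = true) (hT : p.bound ≤ T) : Runs p s T Q := by
  suffices H : Runs p s p.bound Q by
    obtain ⟨t, s', he, ht, hq⟩ := H
    exact ⟨t, s', he, ht.trans hT, hq⟩
  clear hT
  induction p generalizing s Q with
  | skip => exact ⟨_, _, .skip s, le_rfl, hQ⟩
  | setNat r e => exact ⟨_, _, .setNat s r e, le_rfl, hQ _ rfl⟩
  | setReal r e => exact ⟨_, _, .setReal s r e, le_rfl, hQ _ rfl⟩
  | writeNat m i e => exact ⟨_, _, .writeNat s m i e, le_rfl, hQ _ _ rfl rfl⟩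
  | writeReal m i e => exact ⟨_, _, .writeReal s m i e, le_rfl, hQ _ _ rfl rfl⟩
  | seq p q ihp ihq =>
    simp only [Program.loopFree, Bool.and_eq_true] at hp
    obtain ⟨t, s', he, ht, h⟩ := ihp hQ hp.1
    obtain ⟨t', s'', he', ht', h'⟩ := ihq h hp.2
    exact ⟨t + t', s'', he.seq he', add_le_add ht ht', h'⟩
  | ite b p q ihp ihq =>
    simp only [Program.loopFree, Bool.and_eq_true] at hp
    by_cases hb : b.Holds s
    · obtain ⟨t, s', he, ht, h⟩ := ihp (hQ.1 hb) hp.1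
      exact ⟨_, s', .iteTrue hb he, by simp only [Program.bound]; omega, h⟩
    · obtain ⟨t, s', he, ht, h⟩ := ihq (hQ.2 hb) hp.2
      exact ⟨_, s', .iteFalse hb he, by simp only [Program.bound]; omega, h⟩
  | _ => exact hQ.elim

theorem Runs.ite {b : Test} {p q : Program} {s : State} {T : ℕ} {Q : State → Prop}
    (hp : b.Holds s → Runs p s T Q) (hq : ¬ b.Holds s → Runs q s T Q) :
    Runs (.ite b p q) s (b.cost + T) Q := by
  by_cases hb : b.Holds s
  · obtain ⟨t, s', he, ht, h⟩ := hp hb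
    exact ⟨_, s', .iteTrue hb he, by omega, h⟩
  · obtain ⟨t, s', he, ht, h⟩ := hq hb
    exact ⟨_, s', .iteFalse hb he, by omega, h⟩

/-- The loop rule: every round takes at most `T` steps and decreases the measure `μ`. -/
theorem Runs.while {b : Test} {p : Program} {s₀ : State} {T : ℕ} (I : State → Prop)
    (μ : State → ℕ) (h₀ : I s₀)
    (step : ∀ s, Frame (.while b p) s₀ s → I s → b.Holds s →
      Runs p s T (fun s' => I s' ∧ μ s' < μ s)) :
    Runs (.while b p) s₀ (μ s₀ * (T + b.cost) + b.cost) (fun s' => I s' ∧ ¬ b.Holds s') := by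
  suffices H : ∀ k s, μ s ≤ k → Frame (.while b p) s₀ s → I s →
      Runs (.while b p) s (k * (T + b.cost) + b.cost) (fun s' => I s' ∧ ¬ b.Holds s') from
    H _ s₀ le_rfl (Frame.refl _ _) h₀
  intro k
  induction k with
  | zero =>
    intro s hs hF hI
    by_cases hb : b.Holds s
    · obtain ⟨t, s', -, -, -, h⟩ := step s hF hI hb
      omega
    · exact ⟨_, s, .whileFalse hb, by omega, hI, hb⟩
  | succ k ih =>
    intro s hs hF hI
    by_cases hb : b.Holds s
    · obtain ⟨t, s', he, ht, hI', h⟩ := step s hF hI hb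
      obtain ⟨t', s'', he', ht', hQ⟩ := ih s' (by omega) (hF.trans he.frame.while) hI'
      exact ⟨_, s'', .whileTrue hb he he', by rw [Nat.succ_mul]; omega, hQ⟩
    · exact ⟨_, s, .whileFalse hb, by omega, hI, hb⟩

/-- `for r := 0, …, N - 1 do body`. -/
def forLoop (r : ℕ) (N : NatExpr) (body : Program) : Program :=
  .seq (.setNat r (.const 0))
    (.while (.natLt (.reg r) N) (.seq body (.setNat r (.add (.reg r) (.const 1)))))

/-- The rule for counting loops. The invariant has to speak of the written locations only, as the
frame condition relates the current to the initial configuration. -/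
theorem Runs.forLoop {r : ℕ} {N : NatExpr} {body : Program} {s₀ : State} (m T : ℕ)
    (I : ℕ → State → Prop)
    (hr : body.writesNatReg r = false)
    (hI : ∀ k s x, I k s → I k { s with natReg := Function.update s.natReg r x })
    (hN : ∀ s, Frame (forLoop r N body) s₀ s → N.eval s = m)
    (h₀ : I 0 s₀)
    (step : ∀ k s, k < m → Frame (forLoop r N body) s₀ s → s.natReg r = k → I k s →
      Runs body s T (I (k + 1))) :
    Runs (forLoop r N body) s₀ ((m + 1) * (T + N.cost + 6)) (I m) := by
  have hw : Runs (.while (.natLt (.reg r) N) (.seq body (.setNat r (.add (.reg r) (.const 1)))))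
      { s₀ with natReg := Function.update s₀.natReg r 0 }
      (m * (T + 4 + (1 + N.cost + 1)) + (1 + N.cost + 1))
      (fun s' => (s'.natReg r ≤ m ∧ I (s'.natReg r) s') ∧
        ¬ (Test.natLt (.reg r) N).Holds s' ∧ Frame (RealRAM.forLoop r N body) s₀ s') := by
    have hinit : Frame (RealRAM.forLoop r N body) s₀
        { s₀ with natReg := Function.update s₀.natReg r 0 } :=
      (Exec.setNat s₀ r (.const 0)).frame.seq_left
    have := Runs.while (b := .natLt (.reg r) N)
      (p := .seq body (.setNat r (.add (.reg r) (.const 1))))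
      (s₀ := { s₀ with natReg := Function.update s₀.natReg r 0 }) (T := T + 4)
      (fun s' => s'.natReg r ≤ m ∧ I (s'.natReg r) s') (fun s' => m - s'.natReg r)
      ⟨by simp, by simpa using hI 0 s₀ 0 h₀⟩ ?_
    · refine this.mono ?_ ?_
      · simp [Test.cost, NatExpr.cost]
      · intro s' hF h
        exact ⟨h.1, h.2, hinit.trans hF.seq_right⟩
    · intro s hF hIs hb
      have hF' := hinit.trans (hF.seq_right (p := .setNat r (.const 0)))
      simp only [Test.Holds, NatExpr.eval] at hb
      rw [hN s hF'] at hb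
      obtain ⟨t, s', he, ht, hI'⟩ := step _ s hb hF' rfl hIs.2
      have hrs : s'.natReg r = s.natReg r := he.frame.natReg r hr
      refine ⟨_, _, he.seq (Exec.setNat s' r _), ?_, ?_, ?_⟩
      · simp [NatExpr.cost]; omega
      · simp only [NatExpr.eval, Function.update_self, hrs]
        exact ⟨hb, hI _ _ _ hI'⟩
      · simp only [NatExpr.eval, Function.update_self, hrs]; omega
  obtain ⟨t, s', he, ht, ⟨hle, hI'⟩, hb, hF⟩ := hw
  refine ⟨_, s', (Exec.setNat s₀ r (.const 0)).seq he, ?_, ?_⟩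
  · simp only [NatExpr.cost]
    have : (m + 1) * (T + N.cost + 6) = m * (T + 4 + (1 + N.cost + 1)) + (T + N.cost + 6) := by
      ring
    omega
  · simp only [Test.Holds, NatExpr.eval, hN s' hF, not_lt] at hb
    rwa [le_antisymm hle hb] at hI'

end RealRAM

/-! ### Segments of arrays, and merging -/

/-- The cells `a, …, b - 1` of an array. -/
def seg (f : ℕ → ℕ) (a b : ℕ) : List ℕ := (List.range' a (b - a)).map f

theorem seg_eq_nil (f : ℕ → ℕ) {a b : ℕ} (h : b ≤ a) : seg f a b = [] := by
  simp [seg, Nat.sub_eq_zero_of_le h]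

theorem seg_cons (f : ℕ → ℕ) {a b : ℕ} (h : a < b) : seg f a b = f a :: seg f (a + 1) b := by
  obtain ⟨c, rfl⟩ : ∃ c, b = a + 1 + c := ⟨b - (a + 1), by omega⟩
  have h1 : a + 1 + c - a = c + 1 := by omega
  have h2 : a + 1 + c - (a + 1) = c := by omega
  simp [seg, h1, h2, List.range'_succ]

@[simp] theorem length_seg (f : ℕ → ℕ) (a b : ℕ) : (seg f a b).length = b - a := by simp [seg]

theorem getElem_seg (f : ℕ → ℕ) (a b i : ℕ) (h : i < (seg f a b).length) :
    (seg f a b)[i] = f (a + i) := by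
  simp [seg]

theorem seg_append (f : ℕ → ℕ) {a b c : ℕ} (h : a ≤ b) (h' : b ≤ c) :
    seg f a b ++ seg f b c = seg f a c := by
  have h1 : a + (b - a) = b := by omega
  have := @List.range'_append_1 a (b - a) (c - b)
  rw [h1, show b - a + (c - b) = c - a by omega] at this
  simp [seg, ← this]

theorem seg_congr {f g : ℕ → ℕ} {a b : ℕ} (h : ∀ k, a ≤ k → k < b → f k = g k) :
    seg f a b = seg g a b := by
  simp only [seg, List.map_inj_left, List.mem_range'_1]
  intro k hk
  exact h k hk.1 (by omega)

theorem seg_update_snoc (f : ℕ → ℕ) (k x : ℕ) :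
    seg (Function.update f k x) 0 (k + 1) = seg f 0 k ++ [x] := by
  rw [← seg_append _ (Nat.zero_le k) (Nat.le_succ k), seg_cons _ (Nat.lt_succ_self k),
    seg_eq_nil _ le_rfl, Function.update_self]
  congr 1
  exact seg_congr fun j _ hj => Function.update_of_ne hj.ne _ _

theorem seg_id (n : ℕ) : seg id 0 n = List.range n := by
  simp [seg, List.range_eq_range']

/-- Cut into consecutive blocks of length `d`, the list has blocks with nondecreasing keys. -/
def ChunkSorted (key : ℕ → ℝ) (d : ℕ) (l : List ℕ) : Prop :=
  ∀ i j (_ : i < j) (hj : j < l.length), i / d = j / d → key l[i] ≤ key l[j]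

theorem ChunkSorted.append {key : ℕ → ℝ} {d c : ℕ} {l l' : List ℕ} (h : ChunkSorted key d l)
    (hl : l.length = c * d) (hs : l'.Pairwise (fun a b => key a ≤ key b)) :
    ChunkSorted key d (l ++ l') := by
  intro i j hij hj he
  rcases Nat.eq_zero_or_pos d with rfl | hd
  · obtain rfl : l = [] := List.eq_nil_of_length_eq_zero (by simpa using hl)
    simp only [List.nil_append]
    exact List.pairwise_iff_getElem.1 hs i j _ (by simpa using hj) hij
  by_cases hjl : j < l.length
  · rw [List.getElem_append_left hjl, List.getElem_append_left (hij.trans hjl)]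
    exact h i j hij hjl he
  · by_cases hil : i < l.length
    · have h1 : i / d < c := Nat.div_lt_of_lt_mul (by rw [mul_comm]; omega)
      have h2 : c ≤ j / d := (Nat.le_div_iff_mul_le hd).2 (by omega)
      omega
    · rw [List.getElem_append_right (by omega), List.getElem_append_right (by omega)]
      simp only [List.length_append] at hj
      exact List.pairwise_iff_getElem.1 hs _ _ _ (by omega) (by omega)

/-- Merging two lists of indices by their keys. -/
noncomputable def mergeBy (key : ℕ → ℝ) (l l' : List ℕ) : List ℕ :=
  List.merge l l' (fun a b => decide (key a ≤ key b))

theorem pairwise_mergeBy {key : ℕ → ℝ} {l l' : List ℕ}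
    (hl : l.Pairwise (fun a b => key a ≤ key b)) (hl' : l'.Pairwise (fun a b => key a ≤ key b)) :
    (mergeBy key l l').Pairwise (fun a b => key a ≤ key b) := by
  have := List.pairwise_merge (le := fun a b => decide (key a ≤ key b))
    (by simpa using fun a b c h h' => le_trans h h') (by simpa using fun a b => le_total _ _) l l'
    (by simpa using hl) (by simpa using hl')
  simpa [mergeBy] using this

/-- The invariant of one pass of merge sort: `f` is the array before the pass, with sorted blocks
of length `w`; `g` is the array being written, up to cell `k`; what is left of the two blocks being
merged is in the segments `p, …, pe - 1` and `q, …, qe - 1` of `f`. -/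
structure MergeInv (key : ℕ → ℝ) (f g : ℕ → ℕ) (m w k p pe q qe : ℕ) : Prop where
  p_le : p ≤ pe
  q_le : q ≤ qe
  qe_le : qe ≤ m
  count : k + (pe - p) + (qe - q) = qe
  perm : (seg g 0 k ++ mergeBy key (seg f p pe) (seg f q qe)).Perm (seg f 0 qe)
  sorted : ChunkSorted key (w + w) (seg g 0 k ++ mergeBy key (seg f p pe) (seg f q qe))
  dvd : qe = m ∨ ∃ c, qe = c * (w + w)

theorem MergeInv.init (key : ℕ → ℝ) (f g : ℕ → ℕ) (m w : ℕ) : MergeInv key f g m w 0 0 0 0 0 where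
  p_le := le_rfl
  q_le := le_rfl
  qe_le := Nat.zero_le _
  count := rfl
  perm := by simp [seg_eq_nil, mergeBy]
  sorted := by simp [seg_eq_nil, mergeBy, ChunkSorted]
  dvd := .inr ⟨0, by simp⟩

theorem pairwise_seg_of_chunkSorted {key : ℕ → ℝ} {f : ℕ → ℕ} {m w a b c : ℕ}
    (hf : ChunkSorted key w (seg f 0 m)) (ha : a = c * w) (hb : b ≤ a + w) (hbm : b ≤ m) :
    (seg f a b).Pairwise (fun x y => key x ≤ key y) := by
  rw [List.pairwise_iff_getElem]
  intro i j hi hj hij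
  rw [length_seg] at hi hj
  rw [getElem_seg, getElem_seg]
  have := hf (a + i) (a + j) (by omega) (by rw [length_seg]; omega) ?_
  · simpa [getElem_seg] using this
  · rw [Nat.div_eq_of_lt_le (k := c), Nat.div_eq_of_lt_le (k := c)] <;> rw [ha] at * <;>
      try rw [Nat.succ_mul]
    all_goals omega

theorem MergeInv.refill {key : ℕ → ℝ} {f g : ℕ → ℕ} {m w k p pe q qe : ℕ} (hw : 0 < w)
    (hf : ChunkSorted key w (seg f 0 m)) (h : MergeInv key f g m w k p pe q qe)
    (hp : pe ≤ p) (hq : qe ≤ q) (hk : k < m) :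
    MergeInv key f g m w k k (min m (k + w)) (min m (k + w)) (min m (min m (k + w) + w)) := by
  obtain ⟨h1, h2, h3, h4, h5, h6, h7⟩ := h
  obtain rfl : qe = k := by omega
  obtain ⟨c, rfl⟩ := h7.resolve_left hk.ne
  rw [seg_eq_nil f hp, seg_eq_nil f hq] at h5 h6
  simp only [mergeBy, List.merge_right, List.append_nil] at h5 h6
  set k := c * (w + w) with hkdef
  refine ⟨by omega, by omega, by omega, by omega, ?_, ?_, ?_⟩
  · refine (List.Perm.append h5 (List.merge_perm_append _)).trans ?_
    rw [seg_append _ (by omega) (by omega), seg_append _ (by omega) (by omega)]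
  · refine h6.append (c := c) (by simp [k]) (pairwise_mergeBy ?_ ?_)
    · exact pairwise_seg_of_chunkSorted hf (c := c + c) (by rw [hkdef]; ring) (by omega) (by omega)
    · by_cases hkw : k + w ≤ m
      · exact pairwise_seg_of_chunkSorted hf (c := c + c + 1) (a := min m (k + w))
          (by rw [min_eq_right hkw, hkdef]; ring) (by omega) (by omega)
      · rw [seg_eq_nil _ (by omega)]
        exact List.Pairwise.nil
  · by_cases hkw : k + w + w ≤ m
    · right
      refine ⟨c + 1, ?_⟩
      rw [min_eq_right (a := m) (b := k + w) (by omega), min_eq_right hkw, hkdef]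
      ring
    · left
      omega

theorem MergeInv.step_left {key : ℕ → ℝ} {f g : ℕ → ℕ} {m w k p pe q qe : ℕ}
    (h : MergeInv key f g m w k p pe q qe)
    (hp : p < pe) (hle : qe ≤ q ∨ key (f p) ≤ key (f q)) :
    MergeInv key f (Function.update g k (f p)) m w (k + 1) (p + 1) pe q qe := by
  have key_eq : seg (Function.update g k (f p)) 0 (k + 1) ++
      mergeBy key (seg f (p + 1) pe) (seg f q qe) =
      seg g 0 k ++ mergeBy key (seg f p pe) (seg f q qe) := by
    rw [seg_update_snoc, List.append_assoc, seg_cons f hp]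
    congr 1
    rcases Nat.lt_or_ge q qe with hq | hq
    · have := hle.resolve_left (by omega)
      rw [seg_cons f hq, mergeBy, mergeBy, List.cons_merge_cons_pos _ _ _ (by simpa using this)]
      rfl
    · rw [seg_eq_nil f hq]
      simp [mergeBy]
  obtain ⟨h1, h2, h3, h4, h5, h6, h7⟩ := h
  exact ⟨hp, h2, h3, by clear h7; omega, key_eq ▸ h5, key_eq ▸ h6, h7⟩

theorem MergeInv.step_right {key : ℕ → ℝ} {f g : ℕ → ℕ} {m w k p pe q qe : ℕ}
    (h : MergeInv key f g m w k p pe q qe)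
    (hq : q < qe) (hle : pe ≤ p ∨ ¬ key (f p) ≤ key (f q)) :
    MergeInv key f (Function.update g k (f q)) m w (k + 1) p pe (q + 1) qe := by
  have key_eq : seg (Function.update g k (f q)) 0 (k + 1) ++
      mergeBy key (seg f p pe) (seg f (q + 1) qe) =
      seg g 0 k ++ mergeBy key (seg f p pe) (seg f q qe) := by
    rw [seg_update_snoc, List.append_assoc, seg_cons f hq]
    congr 1
    rcases Nat.lt_or_ge p pe with hp | hp
    · have := hle.resolve_left (by omega)
      rw [seg_cons f hp, mergeBy, mergeBy, List.cons_merge_cons_neg _ _ _ (by simpa using this)]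
      rfl
    · rw [seg_eq_nil f hp]
      simp [mergeBy]
  obtain ⟨h1, h2, h3, h4, h5, h6, h7⟩ := h
  exact ⟨h1, hq, h3, by clear h7; omega, key_eq ▸ h5, key_eq ▸ h6, h7⟩

/-! ### Merge sort on the real RAM -/

namespace RealRAM

/-- One step of a merging pass: if both blocks are used up, the next two blocks are taken; then the
smaller head is moved to the array 21. The blocks are the cells from register 23 to register 24 and
from register 25 to register 26 of the array 20. -/
def mergeStep : Program :=
  .seq
    (.ite (.and (.natLe (.reg 24) (.reg 23)) (.natLe (.reg 26) (.reg 25)))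
      (.seq (.setNat 23 (.reg 22))
        (.seq (.setNat 24 (.sub (.reg 20) (.sub (.reg 20) (.add (.reg 22) (.reg 21)))))
          (.seq (.setNat 25 (.reg 24))
            (.setNat 26 (.sub (.reg 20) (.sub (.reg 20) (.add (.reg 24) (.reg 21))))))))
      .skip)
    (.ite (.or (.natLe (.reg 26) (.reg 25))
        (.and (.natLt (.reg 23) (.reg 24))
          (.realLe (.read 10 (.read 20 (.reg 23))) (.read 10 (.read 20 (.reg 25))))))
      (.seq (.writeNat 21 (.reg 22) (.read 20 (.reg 23))) (.setNat 23 (.add (.reg 23) (.const 1))))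
      (.seq (.writeNat 21 (.reg 22) (.read 20 (.reg 25))) (.setNat 25 (.add (.reg 25) (.const 1)))))

/-- One pass of merge sort, from blocks of length `w` to blocks of length `2 w`, where `w` is in
register 21. -/
def mergePass : Program :=
  .seq (.seq (.setNat 23 (.const 0)) (.seq (.setNat 24 (.const 0))
      (.seq (.setNat 25 (.const 0)) (.setNat 26 (.const 0)))))
    (.seq (forLoop 22 (.reg 20) mergeStep)
      (.seq (forLoop 22 (.reg 20) (.writeNat 20 (.reg 22) (.read 21 (.reg 22))))
        (.setNat 21 (.add (.reg 21) (.reg 21)))))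

/-- Bottom-up merge sort. The number `m` of keys is in register 20, the keys are in the first
`m` cells of the real array 10; the sorted list of their indices is put into the array 20. -/
def sortProgram : Program :=
  .seq (forLoop 22 (.reg 20) (.writeNat 20 (.reg 22) (.reg 22)))
    (.seq (.setNat 21 (.const 1)) (.while (.natLt (.reg 21) (.reg 20)) mergePass))

/-- The invariant of `mergeStep`, as a condition on the configuration. -/
def MergeState (key : ℕ → ℝ) (f : ℕ → ℕ) (m w k : ℕ) (s : State) : Prop :=
  MergeInv key f (s.natMem 21) m w k (s.natReg 23) (s.natReg 24) (s.natReg 25) (s.natReg 26)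

theorem runs_mergeStep {key : ℕ → ℝ} {f : ℕ → ℕ} {m w k : ℕ} {s : State} (hw : 0 < w)
    (hf : ChunkSorted key w (seg f 0 m)) (hk : k < m) (h20 : s.natReg 20 = m)
    (h21 : s.natReg 21 = w) (h22 : s.natReg 22 = k) (hkey : s.realMem 10 = key)
    (hf' : s.natMem 20 = f) (h : MergeState key f m w k s) :
    Runs mergeStep s 70 (MergeState key f m w (k + 1)) := by
  have refill : Runs (.ite (.and (.natLe (.reg 24) (.reg 23)) (.natLe (.reg 26) (.reg 25)))
      (.seq (.setNat 23 (.reg 22))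
        (.seq (.setNat 24 (.sub (.reg 20) (.sub (.reg 20) (.add (.reg 22) (.reg 21)))))
          (.seq (.setNat 25 (.reg 24))
            (.setNat 26 (.sub (.reg 20) (.sub (.reg 20) (.add (.reg 24) (.reg 21))))))))
      .skip) s 34 (fun s' => MergeState key f m w k s' ∧
        (s'.natReg 23 < s'.natReg 24 ∨ s'.natReg 25 < s'.natReg 26)) := by
    refine Runs.of_wp ?_ rfl (by decide)
    refine ⟨fun hc => ?_, fun hc => ?_⟩
    · simp only [Test.Holds, NatExpr.eval] at hc
      have := h.refill hw hf hc.1 hc.2 hk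
      simp only [Program.wp, NatExpr.eval, MergeState, Function.update_apply]
      rintro x rfl x rfl x rfl x rfl
      simp only [Nat.reduceEqDiff, if_false, if_true, h20, h21, h22]
      rw [show m - (m - (k + w)) = min m (k + w) by omega,
        show m - (m - (min m (k + w) + w)) = min m (min m (k + w) + w) by omega]
      exact ⟨this, .inl (by omega)⟩
    · simp only [Test.Holds, NatExpr.eval] at hc
      exact ⟨h, by omega⟩
  refine (Runs.seq (T₂ := 36) refill fun s' hF hs' => ?_).mono le_rfl fun _ _ => id
  obtain ⟨hs', hne⟩ := hs'
  have e10 : s'.realMem 10 = key := (hF.realMem 10 rfl).trans hkey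
  have e20 : s'.natMem 20 = f := (hF.natMem 20 rfl).trans hf'
  have e22 : s'.natReg 22 = k := (hF.natReg 22 rfl).trans h22
  refine Runs.of_wp ?_ rfl (by decide)
  refine ⟨fun hc => ?_, fun hc => ?_⟩ <;>
    simp only [Test.Holds, NatExpr.eval, RealExpr.eval, e10, e20] at hc <;>
    simp only [Program.wp, NatExpr.eval, e20, e22]
  · rintro _ _ rfl rfl _ rfl
    have := hs'.step_left (by have := hs'.q_le; omega) (hc.imp_right And.right)
    simpa [MergeState, Function.update_apply] using this
  · rintro _ _ rfl rfl _ rfl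
    rw [not_or, not_and_or] at hc
    have := hs'.step_right (by omega) (hc.2.imp_left not_lt.1)
    simpa [MergeState, Function.update_apply] using this

theorem runs_mergePass {key : ℕ → ℝ} {m w : ℕ} {s : State} (hw : 0 < w)
    (hf : ChunkSorted key w (seg (s.natMem 20) 0 m)) (h20 : s.natReg 20 = m)
    (h21 : s.natReg 21 = w) (hkey : s.realMem 10 = key) :
    Runs mergePass s (90 * (m + 1) + 20) (fun s' => s'.natReg 21 = w + w ∧
      (seg (s'.natMem 20) 0 m).Perm (seg (s.natMem 20) 0 m) ∧
      ChunkSorted key (w + w) (seg (s'.natMem 20) 0 m)) := by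
  set f := s.natMem 20 with hfdef
  have init : Runs (.seq (.setNat 23 (.const 0)) (.seq (.setNat 24 (.const 0))
      (.seq (.setNat 25 (.const 0)) (.setNat 26 (.const 0))))) s 8 (MergeState key f m w 0) := by
    refine Runs.of_wp ?_ rfl (by decide)
    simpa [Program.wp, MergeState, NatExpr.eval, Function.update_apply] using
      MergeInv.init key f _ m w
  have hmain := Runs.seq (T₂ := (m + 1) * (70 + 1 + 6) + ((m + 1) * (4 + 1 + 6) + 4)) init
    (q := .seq (forLoop 22 (.reg 20) mergeStep)
      (.seq (forLoop 22 (.reg 20) (.writeNat 20 (.reg 22) (.read 21 (.reg 22))))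
        (.setNat 21 (.add (.reg 21) (.reg 21)))))
    (Q := fun s' => s'.natReg 21 = w + w ∧ (seg (s'.natMem 20) 0 m).Perm (seg f 0 m) ∧
      ChunkSorted key (w + w) (seg (s'.natMem 20) 0 m)) ?_
  · exact hmain.mono (by ring_nf; omega) fun _ _ => id
  intro s₁ hF₁ hs₁
  refine Runs.seq (R := MergeState key f m w m)
    (Runs.forLoop (N := .reg 20) m 70 (MergeState key f m w) rfl ?_ ?_ hs₁ ?_) ?_
  · intro k s' x h
    simpa [MergeState, Function.update_apply] using h
  · intro s' hF
    exact ((hF.natReg 20 rfl).trans (hF₁.natReg 20 rfl)).trans h20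
  · intro k s' hk hF h22 hI
    exact runs_mergeStep hw hf hk (((hF.natReg 20 rfl).trans (hF₁.natReg 20 rfl)).trans h20)
      (((hF.natReg 21 rfl).trans (hF₁.natReg 21 rfl)).trans h21) h22
      (((hF.realMem 10 rfl).trans (hF₁.realMem 10 rfl)).trans hkey)
      ((hF.natMem 20 rfl).trans (hF₁.natMem 20 rfl)) hI
  intro s₂ hF₂ hs₂
  have e20 : s₂.natReg 20 = m := ((hF₂.natReg 20 rfl).trans (hF₁.natReg 20 rfl)).trans h20
  have e21 : s₂.natReg 21 = w := ((hF₂.natReg 21 rfl).trans (hF₁.natReg 21 rfl)).trans h21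
  have hend : (seg (s₂.natMem 21) 0 m).Perm (seg f 0 m) ∧
      ChunkSorted key (w + w) (seg (s₂.natMem 21) 0 m) := by
    obtain ⟨h1, h2, h3, h4, h5, h6, -⟩ := hs₂
    have hqe : s₂.natReg 26 = m := by omega
    rw [seg_eq_nil f (a := s₂.natReg 23) (by omega),
      seg_eq_nil f (a := s₂.natReg 25) (by omega)] at h5 h6
    simp only [mergeBy, List.merge_right, List.append_nil, hqe] at h5 h6
    exact ⟨h5, h6⟩
  refine Runs.seq (R := fun s' => ∀ j < m, s'.natMem 20 j = s₂.natMem 21 j)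
    (Runs.forLoop (N := .reg 20) m 4 (fun k s' => ∀ j < k, s'.natMem 20 j = s₂.natMem 21 j)
      rfl ?_ ?_ ?_ ?_) ?_
  · intro k s' x h
    exact h
  · intro s' hF
    exact (hF.natReg 20 rfl).trans e20
  · simp
  · intro k s' hk hF h22 hI
    refine Runs.of_wp ?_ rfl (by decide)
    rintro _ _ rfl rfl j hj
    have e : s'.natMem 21 = s₂.natMem 21 := hF.natMem 21 rfl
    simp only [NatExpr.eval, h22, Function.update_self, e]
    rcases Nat.lt_succ_iff_lt_or_eq.1 hj with hj | rfl
    · rw [Function.update_of_ne hj.ne, hI j hj]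
    · rw [Function.update_self]
  · intro s₃ hF₃ hs₃
    refine Runs.of_wp ?_ rfl (by decide)
    have e3 : s₃.natReg 21 = w := (hF₃.natReg 21 rfl).trans e21
    have hseg : seg (s₃.natMem 20) 0 m = seg (s₂.natMem 21) 0 m :=
      seg_congr fun k _ hk => hs₃ k hk
    rintro _ rfl
    simp only [NatExpr.eval, Function.update_self, e3, hseg]
    exact ⟨trivial, hend⟩

/-- The first `m` cells of `idx` enumerate the numbers below `m`, by nondecreasing key. -/
structure SortedPerm (key : ℕ → ℝ) (idx : ℕ → ℕ) (m : ℕ) : Prop where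
  perm : (seg idx 0 m).Perm (List.range m)
  mono : ∀ i j, i ≤ j → j < m → key (idx i) ≤ key (idx j)

theorem runs_sortProgram {s : State} {m : ℕ} (h20 : s.natReg 20 = m) :
    Runs sortProgram s (150 * ((m + 1) * (m.size + 1)))
      (fun s' => SortedPerm (s.realMem 10) (s'.natMem 20) m) := by
  set key := s.realMem 10 with hkey
  have h1 : Runs (forLoop 22 (.reg 20) (.writeNat 20 (.reg 22) (.reg 22))) s
      ((m + 1) * (3 + 1 + 6)) (fun s' => ∀ j < m, s'.natMem 20 j = j) := by
    refine Runs.forLoop (N := .reg 20) m 3 (fun k s' => ∀ j < k, s'.natMem 20 j = j)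
      rfl (fun k s' x h => h) (fun s' hF => (hF.natReg 20 rfl).trans h20) (by simp) ?_
    intro k s' hk hF h22 hI
    refine Runs.of_wp ?_ rfl (by decide)
    rintro _ _ rfl rfl j hj
    simp only [NatExpr.eval, h22, Function.update_self]
    rcases Nat.lt_succ_iff_lt_or_eq.1 hj with hj | rfl
    · rw [Function.update_of_ne hj.ne, hI j hj]
    · rw [Function.update_self]
  have h2 := Runs.seq (q := .seq (.setNat 21 (.const 1))
      (.while (.natLt (.reg 21) (.reg 20)) mergePass)) h1
    (T₂ := 2 + (m.size * ((90 * (m + 1) + 20) + 3) + 3))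
    (Q := fun s' => SortedPerm key (s'.natMem 20) m) ?_
  · refine h2.mono ?_ fun _ _ => id
    generalize m.size = z
    have : 150 * ((m + 1) * (z + 1)) = (m + 1) * (3 + 1 + 6) +
        (2 + (z * (90 * (m + 1) + 20 + 3) + 3)) + (60 * (m * z) + 140 * m + 37 * z + 135) := by
      ring
    omega
  intro s₁ hF₁ hs₁
  refine Runs.seq (R := fun s' => s'.natReg 21 = 1)
    (Runs.of_wp (by simp [Program.wp, NatExpr.eval]) rfl (by decide)) ?_
  intro s₂ hF₂ hs₂
  have e20 : s₂.natReg 20 = m := ((hF₂.natReg 20 rfl).trans (hF₁.natReg 20 rfl)).trans h20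
  have e10 : s₂.realMem 10 = key := ((hF₂.realMem 10 rfl).trans (hF₁.realMem 10 rfl))
  have hid : seg (s₂.natMem 20) 0 m = List.range m := by
    rw [hF₂.natMem 20 rfl, ← seg_id]
    exact seg_congr fun k _ hk => hs₁ k hk
  refine (Runs.while (b := .natLt (.reg 21) (.reg 20)) (p := mergePass) (s₀ := s₂)
    (T := 90 * (m + 1) + 20)
    (fun s' => (∃ j, s'.natReg 21 = 2 ^ j) ∧ (seg (s'.natMem 20) 0 m).Perm (List.range m) ∧
      ChunkSorted key (s'.natReg 21) (seg (s'.natMem 20) 0 m))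
    (fun s' => m.size - Nat.log 2 (s'.natReg 21)) ?_ ?_).mono ?_ ?_
  · refine ⟨⟨0, by rw [hs₂, pow_zero]⟩, by rw [hid], fun i j hij _ he => ?_⟩
    rw [hs₂, Nat.div_one, Nat.div_one] at he
    omega
  · rintro s' hF ⟨⟨j, hj⟩, hperm, hsort⟩ hb
    have e20' : s'.natReg 20 = m := (hF.natReg 20 rfl).trans e20
    simp only [Test.Holds, NatExpr.eval, e20'] at hb
    have hpos : 0 < s'.natReg 21 := by rw [hj]; positivity
    refine (runs_mergePass hpos hsort e20' rfl ((hF.realMem 10 rfl).trans e10)).mono le_rfl ?_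
    rintro s'' - ⟨h21, hp, hs⟩
    have hdouble : s'.natReg 21 + s'.natReg 21 = 2 ^ (j + 1) := by rw [hj, pow_succ]; ring
    refine ⟨⟨⟨j + 1, by rw [h21, hdouble]⟩, hp.trans hperm, by rw [h21]; exact hs⟩, ?_⟩
    rw [h21, hdouble, hj, Nat.log_pow (by norm_num), Nat.log_pow (by norm_num)]
    have : j < m.size := Nat.lt_size.2 (hj ▸ hb.le)
    omega
  · simp [hs₂, Test.cost, NatExpr.cost]
  · rintro s' hF ⟨⟨-, hperm, hsort⟩, hb⟩
    simp only [Test.Holds, NatExpr.eval, (hF.natReg 20 rfl).trans e20, not_lt] at hb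
    refine ⟨hperm, fun i j hij hj => ?_⟩
    rcases hij.eq_or_lt with rfl | hij
    · exact le_rfl
    · have := hsort i j hij (by simpa using hj) (by
        rw [Nat.div_eq_of_lt (by omega), Nat.div_eq_of_lt (by omega)])
      simpa [getElem_seg] using this

end RealRAM

/-! ### The weight loss along a line, and its candidate breakpoints -/

section LineProblem

open Filter Topology

/-- A customer with coordinate `x` along a line and height `y` over it is captured by the follower
who attacks the point `s` of the line in the direction with half-angle tangent `t`, where `r` is half
the minimal distance. The directions with `0 < t` are those pointing backwards along the line. -/
def Captures (r x y s t : ℝ) : Prop := (r + y) * t ^ 2 - 2 * (s - x) * t + (r - y) < 0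

theorem Captures.mono {r x y s s' t : ℝ} (ht : 0 < t) (hs : s ≤ s') (h : Captures r x y s t) :
    Captures r x y s' t := by
  unfold Captures at *
  nlinarith

open Classical in
/-- The weight captured by the follower in the direction `t`. -/
noncomputable def captureSum (n : ℕ) (ξ h w : ℕ → ℝ) (r s t : ℝ) : ℝ :=
  ∑ i ∈ Finset.range n with Captures r (ξ i) (h i) s t, w i

/-- The largest weight that the follower captures in a backward direction. -/
noncomputable def depth (n : ℕ) (ξ h w : ℕ → ℝ) (r s : ℝ) : ℝ :=
  sSup (captureSum n ξ h w r s '' Set.Ioi 0)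

theorem isGreatest_depth (n : ℕ) (ξ h w : ℕ → ℝ) (r s : ℝ) :
    IsGreatest (captureSum n ξ h w r s '' Set.Ioi 0) (depth n ξ h w r s) := by
  classical
  have hfin : (captureSum n ξ h w r s '' Set.Ioi 0).Finite := by
    refine (((Finset.range n).powerset.image fun S => ∑ i ∈ S, w i).finite_toSet).subset ?_
    rintro _ ⟨t, -, rfl⟩
    simp only [Finset.coe_image, Set.mem_image, Finset.mem_coe, Finset.mem_powerset]
    refine ⟨_, Finset.filter_subset (fun i => Captures r (ξ i) (h i) s t) _, ?_⟩
    unfold captureSum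
    congr!
  have hne : (captureSum n ξ h w r s '' Set.Ioi 0).Nonempty :=
    ⟨_, 1, Set.mem_Ioi.2 one_pos, rfl⟩
  exact ⟨hne.csSup_mem hfin, fun _ h => le_csSup hfin.bddAbove h⟩

theorem captureSum_le_depth {n : ℕ} {ξ h w : ℕ → ℝ} {r s t : ℝ} (ht : 0 < t) :
    captureSum n ξ h w r s t ≤ depth n ξ h w r s :=
  (isGreatest_depth n ξ h w r s).2 ⟨t, ht, rfl⟩

theorem exists_depth_eq (n : ℕ) (ξ h w : ℕ → ℝ) (r s : ℝ) :
    ∃ t, 0 < t ∧ captureSum n ξ h w r s t = depth n ξ h w r s :=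
  (isGreatest_depth n ξ h w r s).1

theorem captureSum_le_of_subset {n : ℕ} {ξ h w : ℕ → ℝ} {r s s' t t' : ℝ} (hw : ∀ i < n, 0 < w i)
    (hsub : ∀ i < n, Captures r (ξ i) (h i) s t → Captures r (ξ i) (h i) s' t') :
    captureSum n ξ h w r s t ≤ captureSum n ξ h w r s' t' := by
  classical
  refine Finset.sum_le_sum_of_subset_of_nonneg ?_ ?_
  · intro i hi
    simp only [Finset.mem_filter, Finset.mem_range] at *
    exact ⟨hi.1, hsub i hi.1 hi.2⟩
  · intro i hi _
    simp only [Finset.mem_filter, Finset.mem_range] at hi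
    exact (hw i hi.1).le

theorem depth_mono {n : ℕ} {ξ h w : ℕ → ℝ} {r : ℝ} (hw : ∀ i < n, 0 < w i) :
    Monotone (depth n ξ h w r) := by
  intro s s' hs
  obtain ⟨t, ht, he⟩ := exists_depth_eq n ξ h w r s
  rw [← he]
  exact (captureSum_le_of_subset hw fun i _ hi => hi.mono ht hs).trans (captureSum_le_depth ht)

/-- The largest captured weight at the point `s` of the line; forward directions are treated as
backward directions of the mirrored line. -/
noncomputable def lineLoss (n : ℕ) (ξ h w : ℕ → ℝ) (r s : ℝ) : ℝ :=
  max (depth n ξ h w r s) (depth n (-ξ) h w r (-s))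

/-- If the best attack at `s` is backward, then no point in front of `s` is better. -/
theorem lineLoss_le_of_le {n : ℕ} {ξ h w : ℕ → ℝ} {r s s' : ℝ} (hw : ∀ i < n, 0 < w i)
    (hd : depth n (-ξ) h w r (-s) ≤ depth n ξ h w r s) (hs : s ≤ s') :
    lineLoss n ξ h w r s ≤ lineLoss n ξ h w r s' := by
  rw [lineLoss, max_eq_left hd]
  exact (depth_mono hw hs).trans (le_max_left _ _)

/-- If the best attack at `s` is forward, then no point behind `s` is better. -/
theorem lineLoss_le_of_ge {n : ℕ} {ξ h w : ℕ → ℝ} {r s s' : ℝ} (hw : ∀ i < n, 0 < w i)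
    (hd : depth n ξ h w r s ≤ depth n (-ξ) h w r (-s)) (hs : s' ≤ s) :
    lineLoss n ξ h w r s ≤ lineLoss n ξ h w r s' := by
  rw [lineLoss, max_eq_right hd]
  exact (depth_mono hw (neg_le_neg hs)).trans (le_max_right _ _)

/-- `tan (θ / 2)` as a function of `cot θ`. -/
noncomputable def halfTan (c : ℝ) : ℝ := √(1 + c ^ 2) - c

theorem halfTan_pos (c : ℝ) : 0 < halfTan c := by
  have : |c| < √(1 + c ^ 2) := by
    rw [← Real.sqrt_sq_eq_abs]
    exact Real.sqrt_lt_sqrt (sq_nonneg c) (by linarith)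
  unfold halfTan
  linarith [le_abs_self c]

theorem halfTan_sq (c : ℝ) : halfTan c ^ 2 + 2 * c * halfTan c - 1 = 0 := by
  have := Real.sq_sqrt (show 0 ≤ 1 + c ^ 2 by positivity)
  unfold halfTan
  nlinarith

theorem eq_halfTan {c t : ℝ} (ht : 0 < t) (h : t ^ 2 + 2 * c * t - 1 = 0) : t = halfTan c := by
  have h1 := halfTan_sq c
  have h2 := halfTan_pos c
  have h3 : (t - halfTan c) * (t * halfTan c + 1) = 0 := by
    linear_combination (halfTan c) * h - t * h1
  rcases mul_eq_zero.1 h3 with h4 | h4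
  · linarith
  · nlinarith [mul_pos ht h2]

theorem halfTan_anti {c c' : ℝ} (h : c ≤ c') : halfTan c' ≤ halfTan c := by
  by_contra! hlt
  have h1 := halfTan_sq c
  have h2 := halfTan_pos c
  have h3 := halfTan_sq c'
  nlinarith [mul_le_mul_of_nonneg_right h (halfTan_pos c').le, mul_pos h2 (halfTan_pos c')]

theorem halfTan_neg (c : ℝ) : halfTan (-c) = 1 / halfTan c := by
  have h2 := halfTan_pos c
  refine (eq_halfTan (by positivity) ?_).symm
  have := halfTan_sq c
  field_simp
  linarith

/-- The point of the line from which the direction `t` just captures the customer `(x, y)`, made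
monotone in `t` by cutting off the part on which it decreases (for `σ = 1`; for `σ = -1` the
opposite direction is meant). -/
noncomputable def envelope (r σ x y t : ℝ) : ℝ :=
  open Classical in
  if σ * r - y < (σ * r + y) * t ^ 2 then x + ((σ * r + y) * t + (σ * r - y) / t) / 2
  else x + σ * √((σ * r + y) * (σ * r - y))

/-- The candidate breakpoint of the customers `i` and `j`: the point from which the line through
both customers bounds an attacked half-plane. If this is not possible, and in particular for
`i = j`, it is the point at which the threshold of `i` is stationary. -/
noncomputable def candidate (r σ : ℝ) (ξ h : ℕ → ℝ) (i j : ℕ) : ℝ :=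
  open Classical in
  if h j - h i ≠ 0 then envelope r σ (ξ i) (h i) (halfTan ((ξ j - ξ i) / (h j - h i)))
  else ξ i + σ * √((σ * r + h i) * (σ * r - h i))

theorem envelope_neg (r x y : ℝ) {t : ℝ} (ht : 0 < t) :
    envelope r (-1) x y t = -envelope r 1 (-x) y (1 / t) := by
  have hiff : (-1 * r - y < (-1 * r + y) * t ^ 2) ↔
      (1 * r - y < (1 * r + y) * (1 / t) ^ 2) := by
    rw [one_div, inv_pow, ← div_eq_mul_inv, lt_div_iff₀ (by positivity)]
    constructor <;> intro h <;> linarith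
  unfold envelope
  by_cases hc : 1 * r - y < (1 * r + y) * (1 / t) ^ 2
  · rw [if_pos hc, if_pos (hiff.2 hc)]
    field_simp
    ring
  · rw [if_neg hc, if_neg (fun h => hc (hiff.1 h))]
    rw [show (-1 * r + y) * (-1 * r - y) = (1 * r + y) * (1 * r - y) by ring]
    ring

/-- The candidates of forward attacks are the mirrored candidates of backward attacks. -/
theorem candidate_neg (r : ℝ) (ξ h : ℕ → ℝ) (i j : ℕ) :
    candidate r (-1) ξ h i j = -candidate r 1 (-ξ) h i j := by
  unfold candidate
  by_cases hc : h j - h i ≠ 0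
  · rw [if_pos hc, if_pos hc, envelope_neg _ _ _ (halfTan_pos _), ← halfTan_neg]
    congr 3
    simp only [Pi.neg_apply]
    ring
  · rw [if_neg hc, if_neg hc]
    rw [show (-1 * r + h i) * (-1 * r - h i) = (1 * r + h i) * (1 * r - h i) by ring]
    simp only [Pi.neg_apply]
    ring

theorem envelope_one_mono {r x y t t' : ℝ} (hr : 0 ≤ r) (ht : 0 < t) (htt' : t ≤ t') :
    envelope r 1 x y t ≤ envelope r 1 x y t' := by
  have ht' : 0 < t' := ht.trans_le htt'
  have hsq : t ^ 2 ≤ t' ^ 2 := pow_le_pow_left₀ ht.le htt' 2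
  unfold envelope
  simp only [one_mul]
  by_cases h1 : r - y < (r + y) * t ^ 2
  · have hA : 0 < r + y := by
      by_contra! hA
      nlinarith [sq_nonneg t]
    have h2 : r - y < (r + y) * t' ^ 2 := h1.trans_le (by gcongr)
    rw [if_pos h1, if_pos h2]
    -- the difference is `(t' - t) * ((r + y) * t * t' - (r - y)) / (2 * t * t')`
    have h3 : 0 ≤ (t' - t) * ((r + y) * (t * t') - (r - y)) := by
      apply mul_nonneg (by linarith)
      nlinarith [mul_le_mul_of_nonneg_left htt' ht.le]
    have h4 : x + ((r + y) * t' + (r - y) / t') / 2 - (x + ((r + y) * t + (r - y) / t) / 2) =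
        (t' - t) * ((r + y) * (t * t') - (r - y)) / (2 * (t * t')) := by
      field_simp
      ring
    have h5 := div_nonneg h3 (by positivity : 0 ≤ 2 * (t * t'))
    linarith
  · rw [if_neg h1]
    by_cases h2 : r - y < (r + y) * t' ^ 2
    · rw [if_pos h2]
      have hA : 0 < r + y := by
        by_contra! hA
        nlinarith [sq_nonneg t']
      have hB : 0 ≤ r - y := (by positivity : 0 ≤ (r + y) * t ^ 2).trans (not_lt.1 h1)
      -- the arithmetic-geometric mean inequality
      have h3 : √((r + y) * (r - y)) ≤ ((r + y) * t' + (r - y) / t') / 2 := by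
        apply Real.sqrt_le_iff.2 ⟨by positivity, ?_⟩
        have h4 : (r + y) * (r - y) = ((r + y) * t') * ((r - y) / t') := by field_simp
        rw [h4]
        nlinarith [sq_nonneg ((r + y) * t' - (r - y) / t')]
      linarith
    · rw [if_neg h2]

theorem envelope_mono {r σ x y t t' : ℝ} (hr : 0 ≤ r) (hσ : σ = 1 ∨ σ = -1) (ht : 0 < t)
    (htt' : t ≤ t') : envelope r σ x y t ≤ envelope r σ x y t' := by
  rcases hσ with rfl | rfl
  · exact envelope_one_mono hr ht htt'
  · rw [envelope_neg _ _ _ ht, envelope_neg _ _ _ (ht.trans_le htt')]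
    exact neg_le_neg (envelope_one_mono hr (by have := ht.trans_le htt'; positivity)
      (one_div_le_one_div_of_le ht htt'))

/-- If a set of customers can be captured simultaneously from every point beyond `E`, but not from
`E`, then `E` is a candidate. The directions used beyond `E` accumulate at a direction `t`; if
moving `t` neither way captures the whole set from `E`, then one customer's threshold is stationary
at `t`, or two customers with thresholds of opposite monotonicity are tight. -/
theorem exists_candidate_eq {r E : ℝ} {ξ h : ℕ → ℝ} (hr : 0 ≤ r) (S : Finset ℕ)
    (hE : ∀ u > E, ∃ t > 0, ∀ i ∈ S, Captures r (ξ i) (h i) u t)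
    (hE' : ¬ ∃ t > 0, ∀ i ∈ S, Captures r (ξ i) (h i) E t) :
    ∃ i ∈ S, ∃ j ∈ S, candidate r 1 ξ h i j = E := by
  by_contra! hcand
  have hself : ∀ i ∈ S, ξ i + √((r + h i) * (r - h i)) ≠ E := by
    intro i hi
    have := hcand i hi i hi
    simpa [candidate] using this
  -- the accumulation point, in the coordinate `p = t / (1 + t)`
  obtain ⟨p, ⟨hp0, hp1⟩, hp⟩ : ∃ p ∈ Set.Icc (0 : ℝ) 1, ∀ i ∈ S,
      (r + h i) * p ^ 2 - 2 * (E - ξ i) * (p * (1 - p)) + (r - h i) * (1 - p) ^ 2 ≤ 0 := by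
    have hseq : ∀ k : ℕ, ∃ p ∈ Set.Icc (0 : ℝ) 1, ∀ i ∈ S,
        (r + h i) * p ^ 2 - 2 * (E + 1 / ((k : ℝ) + 1) - ξ i) * (p * (1 - p)) +
          (r - h i) * (1 - p) ^ 2 ≤ 0 := by
      intro k
      obtain ⟨t, ht, hc⟩ := hE (E + 1 / ((k : ℝ) + 1)) (by
        have : (0 : ℝ) < 1 / ((k : ℝ) + 1) := by positivity
        linarith)
      have h1t : 0 < 1 + t := by linarith [show 0 < t from ht]
      refine ⟨t / (1 + t), ⟨by positivity, by rw [div_le_one h1t]; linarith⟩, fun i hi => ?_⟩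
      have hci := hc i hi
      unfold Captures at hci
      have hp' : 1 - t / (1 + t) = 1 / (1 + t) := by field_simp; ring
      rw [hp']
      have : (r + h i) * (t / (1 + t)) ^ 2 -
          2 * (E + 1 / ((k : ℝ) + 1) - ξ i) * (t / (1 + t) * (1 / (1 + t))) +
          (r - h i) * (1 / (1 + t)) ^ 2 =
          ((r + h i) * t ^ 2 - 2 * (E + 1 / ((k : ℝ) + 1) - ξ i) * t + (r - h i)) /
            (1 + t) ^ 2 := by
        field_simp
      rw [this]
      exact div_nonpos_of_nonpos_of_nonneg hci.le (by positivity)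
    choose p hpI hp using hseq
    obtain ⟨q, hq, φ, hφ, hlim⟩ := isCompact_Icc.tendsto_subseq hpI
    refine ⟨q, hq, fun i hi => ?_⟩
    have hu : Tendsto (fun k => E + 1 / (((φ k : ℕ) : ℝ) + 1)) atTop (𝓝 (E + 0)) :=
      tendsto_const_nhds.add (tendsto_one_div_add_atTop_nhds_zero_nat.comp hφ.tendsto_atTop)
    rw [add_zero] at hu
    have hl : Tendsto (fun k => (r + h i) * (p (φ k)) ^ 2 -
        2 * (E + 1 / (((φ k : ℕ) : ℝ) + 1) - ξ i) * (p (φ k) * (1 - p (φ k))) +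
        (r - h i) * (1 - p (φ k)) ^ 2) atTop
        (𝓝 ((r + h i) * q ^ 2 - 2 * (E - ξ i) * (q * (1 - q)) + (r - h i) * (1 - q) ^ 2)) := by
      have hlim' : Tendsto (fun k => p (φ k)) atTop (𝓝 q) := hlim
      exact (((hlim'.pow 2).const_mul _).sub (((hu.sub_const _).const_mul 2).mul
        (hlim'.mul (hlim'.const_sub 1)))).add (((hlim'.const_sub 1).pow 2).const_mul _)
    exact le_of_tendsto' hl fun k => hp (φ k) i hi
  have hbeyond : ∀ i ∈ S, ∀ u > E, ∃ t > 0, Captures r (ξ i) (h i) u t := fun i hi u hu =>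
    (hE u hu).imp fun t ht => ⟨ht.1, ht.2 i hi⟩
  rcases hp0.eq_or_lt with rfl | hp0
  · -- accumulation at `t = 0`
    have key : ∀ i ∈ S, ∀ᶠ t in 𝓝[>] (0 : ℝ), Captures r (ξ i) (h i) E t := by
      intro i hi
      have hB : r - h i ≤ 0 := by simpa using hp i hi
      rcases hB.eq_or_lt with hB | hB
      · have hEξ : ξ i < E := by
          refine lt_of_le_of_ne (le_of_forall_gt fun u hu => ?_) (by simpa [hB] using hself i hi)
          obtain ⟨t, ht, hc⟩ := hbeyond i hi u hu
          unfold Captures at hc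
          by_contra! hlt
          nlinarith [mul_nonneg (sub_nonneg.2 hlt) (le_of_lt ht),
            mul_nonneg (show 0 ≤ r + h i by linarith) (sq_nonneg t)]
        have hcont : ContinuousAt (fun t : ℝ => (r + h i) * t - 2 * (E - ξ i)) 0 := by fun_prop
        have hev := Tendsto.eventually_lt_const
          (show (r + h i) * 0 - 2 * (E - ξ i) < 0 by linarith) hcont
        filter_upwards [nhdsWithin_le_nhds hev, self_mem_nhdsWithin] with t h1 h2
        unfold Captures
        have h2 : 0 < t := h2
        rw [hB]
        nlinarith
      · have hcont : ContinuousAt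
            (fun t : ℝ => (r + h i) * t ^ 2 - 2 * (E - ξ i) * t + (r - h i)) 0 := by fun_prop
        exact nhdsWithin_le_nhds (hcont.eventually (gt_mem_nhds (by simpa using hB)))
    obtain ⟨t, hpos, ht⟩ := ((eventually_mem_nhdsWithin).and
      ((eventually_all_finset S).2 key)).exists
    exact hE' ⟨t, hpos, ht⟩
  rcases hp1.eq_or_lt with rfl | hp1
  · -- accumulation at infinity, in the coordinate `1 / t`
    have key : ∀ i ∈ S, ∀ᶠ t in 𝓝[>] (0 : ℝ), Captures r (ξ i) (h i) E (1 / t) := by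
      intro i hi
      have hiff : ∀ t : ℝ, 0 < t → (r - h i) * t ^ 2 - 2 * (E - ξ i) * t + (r + h i) < 0 →
          Captures r (ξ i) (h i) E (1 / t) := by
        intro t ht hlt
        have : (r + h i) * (1 / t) ^ 2 - 2 * (E - ξ i) * (1 / t) + (r - h i) =
            ((r - h i) * t ^ 2 - 2 * (E - ξ i) * t + (r + h i)) / t ^ 2 := by
          field_simp
          ring
        unfold Captures
        rw [this]
        exact div_neg_of_neg_of_pos hlt (by positivity)
      have hA : r + h i ≤ 0 := by simpa using hp i hi
      rcases hA.eq_or_lt with hA | hA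
      · have hEξ : ξ i < E := by
          refine lt_of_le_of_ne (le_of_forall_gt fun u hu => ?_) (by simpa [hA] using hself i hi)
          obtain ⟨t, ht, hc⟩ := hbeyond i hi u hu
          unfold Captures at hc
          by_contra! hlt
          rw [hA] at hc
          nlinarith [mul_nonneg (sub_nonneg.2 hlt) (le_of_lt ht)]
        have hcont : ContinuousAt (fun t : ℝ => (r - h i) * t - 2 * (E - ξ i)) 0 := by fun_prop
        have hev := Tendsto.eventually_lt_const
          (show (r - h i) * 0 - 2 * (E - ξ i) < 0 by linarith) hcont
        filter_upwards [nhdsWithin_le_nhds hev, self_mem_nhdsWithin] with t h1 h2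
        have h2 : 0 < t := h2
        refine hiff t h2 ?_
        rw [hA]
        nlinarith
      · have hcont : ContinuousAt
            (fun t : ℝ => (r - h i) * t ^ 2 - 2 * (E - ξ i) * t + (r + h i)) 0 := by fun_prop
        have hev := Tendsto.eventually_lt_const
          (show (r - h i) * 0 ^ 2 - 2 * (E - ξ i) * 0 + (r + h i) < 0 by linarith) hcont
        filter_upwards [nhdsWithin_le_nhds hev, self_mem_nhdsWithin] with t h1 h2
        exact hiff t h2 h1
    obtain ⟨t, hpos, ht⟩ := ((eventually_mem_nhdsWithin).and
      ((eventually_all_finset S).2 key)).exists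
    exact hE' ⟨1 / t, one_div_pos.2 hpos, ht⟩
  -- accumulation at an interior direction
  set t₀ := p / (1 - p) with ht₀
  have h1p : 0 < 1 - p := by linarith
  have ht₀pos : 0 < t₀ := by positivity
  have hG : ∀ i ∈ S, (r + h i) * t₀ ^ 2 - 2 * (E - ξ i) * t₀ + (r - h i) ≤ 0 := by
    intro i hi
    have : (r + h i) * t₀ ^ 2 - 2 * (E - ξ i) * t₀ + (r - h i) =
        ((r + h i) * p ^ 2 - 2 * (E - ξ i) * (p * (1 - p)) + (r - h i) * (1 - p) ^ 2) /
          (1 - p) ^ 2 := by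
      rw [ht₀]
      field_simp
    rw [this]
    exact div_nonpos_of_nonpos_of_nonneg (hp i hi) (by positivity)
  have hEeq : ∀ i, (r + h i) * t₀ ^ 2 - 2 * (E - ξ i) * t₀ + (r - h i) = 0 →
      E = ξ i + ((r + h i) * t₀ + (r - h i) / t₀) / 2 := by
    intro i hi
    field_simp
    linarith
  have hstat : ∀ i ∈ S, (r + h i) * t₀ ^ 2 - 2 * (E - ξ i) * t₀ + (r - h i) = 0 →
      (r + h i) * t₀ ^ 2 ≠ r - h i := by
    intro i hi htight hD
    have hA : 0 ≤ r + h i := by nlinarith [sq_nonneg t₀]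
    apply hself i hi
    rw [hEeq i htight, ← hD, show (r + h i) * ((r + h i) * t₀ ^ 2) = ((r + h i) * t₀) ^ 2 by ring,
      Real.sqrt_sq (by positivity)]
    field_simp
    ring
  have hpair : ∀ i ∈ S, ∀ j ∈ S,
      (r + h i) * t₀ ^ 2 - 2 * (E - ξ i) * t₀ + (r - h i) = 0 →
      (r + h j) * t₀ ^ 2 - 2 * (E - ξ j) * t₀ + (r - h j) = 0 →
      r - h i < (r + h i) * t₀ ^ 2 → ¬ (r + h j) * t₀ ^ 2 < r - h j := by
    intro i hi j hj hti htj hDi hDj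
    apply hcand i hi j hj
    have hne : h j - h i ≠ 0 := by
      intro he
      have : h j = h i := by linarith
      rw [this] at hDj
      linarith
    have hθ : halfTan ((ξ j - ξ i) / (h j - h i)) = t₀ := by
      refine (eq_halfTan ht₀pos ?_).symm
      field_simp
      linarith
    rw [candidate, if_pos hne, hθ, envelope, if_pos (by simpa using hDi), one_mul]
    exact (hEeq i hti).symm
  have hfactor : ∀ i, (r + h i) * t₀ ^ 2 - 2 * (E - ξ i) * t₀ + (r - h i) = 0 → ∀ t,
      (r + h i) * t ^ 2 - 2 * (E - ξ i) * t + (r - h i) =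
        (t - t₀) * ((r + h i) * (t + t₀) - 2 * (E - ξ i)) := by
    intro i hi t
    linear_combination hi
  have hslope : ∀ i, (r + h i) * t₀ ^ 2 - 2 * (E - ξ i) * t₀ + (r - h i) = 0 →
      ((r + h i) * (t₀ + t₀) - 2 * (E - ξ i)) * t₀ = (r + h i) * t₀ ^ 2 - (r - h i) := by
    intro i hi
    linear_combination hi
  have hcontF : ∀ i, ContinuousAt (fun t : ℝ => (r + h i) * (t + t₀) - 2 * (E - ξ i)) t₀ :=
    fun i => by fun_prop
  have hloose : ∀ i ∈ S, (r + h i) * t₀ ^ 2 - 2 * (E - ξ i) * t₀ + (r - h i) ≠ 0 →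
      ∀ᶠ t in 𝓝 t₀, Captures r (ξ i) (h i) E t := by
    intro i hi hne
    have hcont : ContinuousAt
      (fun t : ℝ => (r + h i) * t ^ 2 - 2 * (E - ξ i) * t + (r - h i)) t₀ := by fun_prop
    exact hcont.eventually (gt_mem_nhds (lt_of_le_of_ne (hG i hi) hne))
  by_cases hinc : ∃ i ∈ S, (r + h i) * t₀ ^ 2 - 2 * (E - ξ i) * t₀ + (r - h i) = 0 ∧
      r - h i < (r + h i) * t₀ ^ 2
  · obtain ⟨i, hi, hti, hDi⟩ := hinc
    have key : ∀ j ∈ S, ∀ᶠ t in 𝓝[<] t₀, Captures r (ξ j) (h j) E t := by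
      intro j hj
      by_cases htj : (r + h j) * t₀ ^ 2 - 2 * (E - ξ j) * t₀ + (r - h j) = 0
      · have hDj : r - h j < (r + h j) * t₀ ^ 2 :=
          lt_of_le_of_ne (not_lt.1 (hpair i hi j hj hti htj hDi)) (hstat j hj htj).symm
        have hpos : 0 < (r + h j) * (t₀ + t₀) - 2 * (E - ξ j) := by
          have := hslope j htj
          by_contra! hle
          nlinarith
        filter_upwards [nhdsWithin_le_nhds ((hcontF j).eventually (lt_mem_nhds hpos)),
          self_mem_nhdsWithin] with t h1 h2
        unfold Captures
        rw [hfactor j htj t]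
        exact mul_neg_of_neg_of_pos (sub_neg.2 h2) h1
      · exact nhdsWithin_le_nhds (hloose j hj htj)
    have hpos : ∀ᶠ t in 𝓝[<] t₀, 0 < t := nhdsWithin_le_nhds (lt_mem_nhds ht₀pos)
    obtain ⟨t, hpos, ht⟩ := (hpos.and ((eventually_all_finset S).2 key)).exists
    exact hE' ⟨t, hpos, ht⟩
  · have key : ∀ j ∈ S, ∀ᶠ t in 𝓝[>] t₀, Captures r (ξ j) (h j) E t := by
      intro j hj
      by_cases htj : (r + h j) * t₀ ^ 2 - 2 * (E - ξ j) * t₀ + (r - h j) = 0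
      · have hDj : (r + h j) * t₀ ^ 2 < r - h j :=
          lt_of_le_of_ne (not_lt.1 fun hlt => hinc ⟨j, hj, htj, hlt⟩) (hstat j hj htj)
        have hneg : (r + h j) * (t₀ + t₀) - 2 * (E - ξ j) < 0 := by
          have := hslope j htj
          by_contra! hle
          nlinarith
        filter_upwards [nhdsWithin_le_nhds ((hcontF j).eventually (gt_mem_nhds hneg)),
          self_mem_nhdsWithin] with t h1 h2
        unfold Captures
        rw [hfactor j htj t]
        exact mul_neg_of_pos_of_neg (sub_pos.2 h2) h1
      · exact nhdsWithin_le_nhds (hloose j hj htj)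
    have hpos : ∀ᶠ t in 𝓝[>] t₀, 0 < t := nhdsWithin_le_nhds (lt_mem_nhds ht₀pos)
    obtain ⟨t, hpos, ht⟩ := (hpos.and ((eventually_all_finset S).2 key)).exists
    exact hE' ⟨t, hpos, ht⟩

/-- If `depth` increases between `s` and `s₀`, then it keeps its value up to a candidate. -/
theorem exists_candidate_depth_eq {n : ℕ} {ξ h w : ℕ → ℝ} {r s s₀ : ℝ} (hr : 0 ≤ r)
    (hw : ∀ i < n, 0 < w i) (hlt : depth n ξ h w r s < depth n ξ h w r s₀) :
    ∃ i < n, ∃ j < n, s ≤ candidate r 1 ξ h i j ∧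
      depth n ξ h w r (candidate r 1 ξ h i j) ≤ depth n ξ h w r s := by
  classical
  set P := depth n ξ h w r with hP
  have hmono : Monotone P := depth_mono hw
  set U : Set ℝ := {u | P u ≤ P s}
  have hbdd : BddAbove U := ⟨s₀, fun u hu => by
    by_contra! h
    exact absurd (hmono h.le) (not_le.2 (lt_of_le_of_lt hu hlt))⟩
  have hsU : s ∈ U := le_refl (P s)
  set E := sSup U
  have hsE : s ≤ E := le_csSup hbdd hsU
  have hbelow : ∀ u < E, P u ≤ P s := by
    intro u hu
    obtain ⟨u', hu', huu'⟩ := exists_lt_of_lt_csSup ⟨s, hsU⟩ hu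
    exact (hmono huu'.le).trans hu'
  -- captured sets stay captured slightly before `E`
  have hPE : P E ≤ P s := by
    obtain ⟨t, ht, he⟩ := exists_depth_eq n ξ h w r E
    have hev : ∀ᶠ u in 𝓝[<] E, ∀ i ∈ Finset.range n, Captures r (ξ i) (h i) E t →
        Captures r (ξ i) (h i) u t := by
      refine (eventually_all_finset _).2 fun i _ => ?_
      by_cases hc : Captures r (ξ i) (h i) E t
      · have hcont : ContinuousAt
          (fun u : ℝ => (r + h i) * t ^ 2 - 2 * (u - ξ i) * t + (r - h i)) E := by fun_prop
        filter_upwards [nhdsWithin_le_nhds (hcont.eventually (gt_mem_nhds hc))] with u hu _ using hu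
      · exact Eventually.of_forall fun u h => absurd h hc
    obtain ⟨u, hu, huE⟩ := (hev.and self_mem_nhdsWithin).exists
    calc P E = captureSum n ξ h w r E t := he.symm
      _ ≤ captureSum n ξ h w r u t :=
        captureSum_le_of_subset hw fun i hi => hu i (Finset.mem_range.2 hi)
      _ ≤ P u := captureSum_le_depth ht
      _ ≤ P s := hbelow u huE
  have habove : ∀ u > E, P s < P u := by
    intro u hu
    by_contra! h
    exact absurd (le_csSup hbdd (show u ∈ U from h)) (not_le.2 hu)
  -- one and the same set of customers is captured at points arbitrarily close to `E`
  have hset : ∃ S ∈ (Finset.range n).powerset, P s < ∑ i ∈ S, w i ∧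
      ∀ u > E, ∃ t > 0, ∀ i ∈ S, Captures r (ξ i) (h i) u t := by
    by_contra! hno
    have hno' : ∀ S ∈ (Finset.range n).powerset, ∃ u > E, P s < ∑ i ∈ S, w i →
        ∀ t > 0, ∃ i ∈ S, ¬ Captures r (ξ i) (h i) u t := by
      intro S hS
      by_cases hPS : P s < ∑ i ∈ S, w i
      · obtain ⟨u, hu, hc⟩ := hno S hS hPS
        exact ⟨u, hu, fun _ => hc⟩
      · exact ⟨E + 1, by linarith, fun h => absurd h hPS⟩
    choose! f hf hf' using hno'
    obtain ⟨u, hu⟩ : ∃ u > E, ∀ S ∈ (Finset.range n).powerset, u ≤ f S := by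
      obtain ⟨S, hS, hmin⟩ := Finset.exists_min_image (Finset.range n).powerset f
        ⟨∅, Finset.empty_mem_powerset _⟩
      exact ⟨f S, hf S hS, hmin⟩
    obtain ⟨t, ht, he⟩ := exists_depth_eq n ξ h w r u
    have hS : (Finset.range n).filter (fun i => Captures r (ξ i) (h i) u t) ∈
        (Finset.range n).powerset := Finset.mem_powerset.2 (Finset.filter_subset _ _)
    have hlt : P s < ∑ i ∈ (Finset.range n).filter (fun i => Captures r (ξ i) (h i) u t), w i := by
      have := habove u hu.1
      rw [hP, ← he] at this
      unfold captureSum at this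
      convert this
    obtain ⟨i, hi, hc⟩ := hf' _ hS hlt t ht
    exact hc ((Finset.mem_filter.1 hi).2.mono ht (hu.2 _ hS))
  obtain ⟨S, hS, hPS, hcap⟩ := hset
  have hSn : ∀ i ∈ S, i < n := fun i hi => Finset.mem_range.1 (Finset.mem_powerset.1 hS hi)
  obtain ⟨i, hi, j, hj, he⟩ := exists_candidate_eq hr S hcap (by
    rintro ⟨t, ht, hc⟩
    refine absurd hPE (not_le.2 (hPS.trans_le (le_trans ?_ (captureSum_le_depth ht))))
    refine Finset.sum_le_sum_of_subset_of_nonneg (fun i hi => ?_) fun i hi _ => ?_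
    · exact Finset.mem_filter.2 ⟨Finset.mem_range.2 (hSn i hi), hc i hi⟩
    · exact (hw i (Finset.mem_range.1 (Finset.mem_filter.1 hi).1)).le)
  exact ⟨i, hSn i hi, j, hSn j hj, he ▸ hsE, he ▸ hPE⟩

/-- A point that is better than `s₀` is matched by a candidate. -/
theorem exists_candidate_lineLoss_le {n : ℕ} {ξ h w : ℕ → ℝ} {r s s₀ : ℝ} (hr : 0 ≤ r)
    (hw : ∀ i < n, 0 < w i) (hlt : lineLoss n ξ h w r s < lineLoss n ξ h w r s₀) :
    ∃ σ : ℝ, (σ = 1 ∨ σ = -1) ∧ ∃ i < n, ∃ j < n,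
      lineLoss n ξ h w r (candidate r σ ξ h i j) ≤ lineLoss n ξ h w r s := by
  rw [lineLoss, lineLoss, max_lt_iff, lt_max_iff, lt_max_iff] at hlt
  rcases le_total (depth n (-ξ) h w r (-s₀)) (depth n ξ h w r s₀) with hle | hle
  · have h1 : depth n ξ h w r s < depth n ξ h w r s₀ := hlt.1.elim id fun h => h.trans_le hle
    obtain ⟨i, hi, j, hj, hs, hd⟩ := exists_candidate_depth_eq hr hw h1
    exact ⟨1, .inl rfl, i, hi, j, hj, max_le_max hd (depth_mono hw (neg_le_neg hs))⟩
  · have h1 : depth n (-ξ) h w r (-s) < depth n (-ξ) h w r (-s₀) :=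
      hlt.2.elim (fun h => h.trans_le hle) id
    obtain ⟨i, hi, j, hj, hs, hd⟩ := exists_candidate_depth_eq hr hw h1
    refine ⟨-1, .inr rfl, i, hi, j, hj, ?_⟩
    rw [candidate_neg, lineLoss, neg_neg]
    exact max_le_max (depth_mono hw (by linarith)) hd

end LineProblem

/-! ### Coordinates along a line -/

section LineGeometry

open Filter Topology

/-- `ξ` and `h` are the coordinates of the customers along and over the line `a x + b y = c`, where
`ℓ` is the length of `(a, b)`. -/
structure LineCoordinates {n : ℕ} (v : Fin n → Plane) (a b c ℓ : ℝ) (ξ h : ℕ → ℝ) : Prop where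
  pos : 0 < ℓ
  sq : ℓ ^ 2 = a ^ 2 + b ^ 2
  along : ∀ i : Fin n, ξ i = (b * v i 0 - a * v i 1) / ℓ
  height : ∀ i : Fin n, h i = (a * v i 0 + b * v i 1 - c) / ℓ

/-- The point with coordinate `s` on the line `a x + b y = c`. -/
noncomputable def linePoint (a b c ℓ s : ℝ) : Plane :=
  !₂[(b * s + a * (c / ℓ)) / ℓ, (b * (c / ℓ) - a * s) / ℓ]

variable {n : ℕ} {v : Fin n → Plane} {a b c ℓ : ℝ} {ξ h : ℕ → ℝ}

theorem Plane.dist_sq (x y : Plane) : dist x y ^ 2 = (x 0 - y 0) ^ 2 + (x 1 - y 1) ^ 2 := by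
  rw [EuclideanSpace.dist_eq, Real.sq_sqrt (by positivity), Fin.sum_univ_two, Real.dist_eq,
    Real.dist_eq, sq_abs, sq_abs]

theorem LineCoordinates.dist_lt_iff (H : LineCoordinates v a b c ℓ ξ h) (s : ℝ) (i : Fin n)
    (p q : ℝ) (y : Plane) (hy0 : y 0 = linePoint a b c ℓ s 0 + (b * p + a * q) / ℓ)
    (hy1 : y 1 = linePoint a b c ℓ s 1 + (b * q - a * p) / ℓ) :
    dist (v i) y < dist (v i) (linePoint a b c ℓ s) ↔
      p ^ 2 + q ^ 2 < 2 * (p * (ξ i - s) + q * h i) := by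
  have hℓ := H.pos.ne'
  have hsq : (a ^ 2 + b ^ 2) / ℓ ^ 2 = 1 := by rw [← H.sq]; field_simp
  rw [← sq_lt_sq₀ dist_nonneg dist_nonneg, Plane.dist_sq, Plane.dist_sq, hy0, hy1, H.along, H.height]
  set X := v i 0
  set Y := v i 1
  have h0 : linePoint a b c ℓ s 0 = (b * s + a * (c / ℓ)) / ℓ := by simp [linePoint]
  have h1 : linePoint a b c ℓ s 1 = (b * (c / ℓ) - a * s) / ℓ := by simp [linePoint]
  rw [h0, h1, ← sub_pos, ← sub_pos (b := p ^ 2 + q ^ 2)]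
  have key : (X - (b * s + a * (c / ℓ)) / ℓ) ^ 2 + (Y - (b * (c / ℓ) - a * s) / ℓ) ^ 2 -
      ((X - ((b * s + a * (c / ℓ)) / ℓ + (b * p + a * q) / ℓ)) ^ 2 +
        (Y - ((b * (c / ℓ) - a * s) / ℓ + (b * q - a * p) / ℓ)) ^ 2) =
      2 * (p * ((b * X - a * Y) / ℓ - s * ((a ^ 2 + b ^ 2) / ℓ ^ 2)) +
        q * ((a * X + b * Y) / ℓ - c / ℓ * ((a ^ 2 + b ^ 2) / ℓ ^ 2))) -
        (p ^ 2 + q ^ 2) * ((a ^ 2 + b ^ 2) / ℓ ^ 2) := by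
    field_simp
    ring
  rw [key, hsq, mul_one, mul_one, mul_one, ← sub_div]

theorem LineCoordinates.dist_linePoint_sq (H : LineCoordinates v a b c ℓ ξ h) (s p q : ℝ) (y : Plane)
    (hy0 : y 0 = linePoint a b c ℓ s 0 + (b * p + a * q) / ℓ)
    (hy1 : y 1 = linePoint a b c ℓ s 1 + (b * q - a * p) / ℓ) :
    dist y (linePoint a b c ℓ s) ^ 2 = p ^ 2 + q ^ 2 := by
  have hℓ := H.pos.ne'
  rw [Plane.dist_sq, hy0, hy1]
  have : (linePoint a b c ℓ s 0 + (b * p + a * q) / ℓ - linePoint a b c ℓ s 0) ^ 2 +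
      (linePoint a b c ℓ s 1 + (b * q - a * p) / ℓ - linePoint a b c ℓ s 1) ^ 2 =
      (p ^ 2 + q ^ 2) * ((a ^ 2 + b ^ 2) / ℓ ^ 2) := by
    field_simp
    ring
  rw [this, ← H.sq]
  field_simp

theorem captureSum_eq_sum_fin {w : Fin n → ℝ} {w' : ℕ → ℝ} (hw' : ∀ i : Fin n, w' i = w i)
    (r s t : ℝ) : open Classical in captureSum n ξ h w' r s t =
      ∑ i : Fin n, if Captures r (ξ i) (h i) s t then w i else 0 := by
  classical
  rw [captureSum, Finset.sum_filter, Finset.sum_range]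
  refine Finset.sum_congr rfl fun i _ => ?_
  rw [hw']

/-- A set of customers attacked in the direction `t` lies in an open half-plane, at distance more
than `r` from the leader; the follower's point is chosen just so far that it still wins this set. -/
theorem LineCoordinates.captureSum_le_weightLoss (H : LineCoordinates v a b c ℓ ξ h)
    {w : Fin n → ℝ} {w' : ℕ → ℝ} (hw' : ∀ i : Fin n, w' i = w i) (hw : ∀ i, 0 < w i) {R : ℝ}
    (hR : 0 ≤ R) (s : ℝ) {ε t : ℝ} (hε : ε = 1 ∨ ε = -1) :
    captureSum n (fun i => ε * ξ i) h w' (R / 2) (ε * s) t ≤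
      weightLoss v w R (linePoint a b c ℓ s) := by
  classical
  have hε2 : ε ^ 2 = 1 := by rcases hε with rfl | rfl <;> norm_num
  set K : Fin n → ℝ := fun i => (h i * (1 - t ^ 2) - 2 * (ε * (ξ i - s)) * t) / (1 + t ^ 2)
  have h1t : 0 < 1 + t ^ 2 := by positivity
  have hK : ∀ i : Fin n, Captures (R / 2) (ε * ξ i) (h i) (ε * s) t ↔ R / 2 < K i := by
    intro i
    rw [Captures, lt_div_iff₀ h1t]
    constructor <;> intro h <;> linarith
  obtain ⟨κ, hκ, hκK⟩ : ∃ κ, R / 2 < κ ∧ ∀ i : Fin n, R / 2 < K i → κ < K i := by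
    have : ∀ᶠ κ in 𝓝[>] (R / 2), ∀ i : Fin n, R / 2 < K i → κ < K i := by
      refine eventually_all.2 fun i => ?_
      by_cases hi : R / 2 < K i
      · exact nhdsWithin_le_nhds ((gt_mem_nhds hi).mono fun κ hκ _ => hκ)
      · exact Eventually.of_forall fun κ h => absurd h hi
    obtain ⟨κ, h1, h2⟩ := (this.and self_mem_nhdsWithin).exists
    exact ⟨κ, h2, h1⟩
  set ρ := 2 * κ with hρ
  set p := -(ε * (2 * t) * ρ / (1 + t ^ 2)) with hp
  set q := (1 - t ^ 2) * ρ / (1 + t ^ 2) with hq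
  have hpq : p ^ 2 + q ^ 2 = ρ ^ 2 := by
    have : p ^ 2 + q ^ 2 = (ε ^ 2 * (2 * t) ^ 2 + (1 - t ^ 2) ^ 2) * ρ ^ 2 / (1 + t ^ 2) ^ 2 := by
      rw [hp, hq]; field_simp
    rw [this, hε2]
    field_simp
    ring
  set y : Plane := !₂[linePoint a b c ℓ s 0 + (b * p + a * q) / ℓ,
    linePoint a b c ℓ s 1 + (b * q - a * p) / ℓ] with hy
  have hy0 : y 0 = linePoint a b c ℓ s 0 + (b * p + a * q) / ℓ := by simp [hy]
  have hy1 : y 1 = linePoint a b c ℓ s 1 + (b * q - a * p) / ℓ := by simp [hy]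
  have hfar : R ≤ dist y (linePoint a b c ℓ s) := by
    refine (sq_le_sq₀ hR dist_nonneg).1 ?_
    rw [H.dist_linePoint_sq s p q y hy0 hy1, hpq]
    exact pow_le_pow_left₀ hR (by linarith) 2
  refine le_trans ?_ ((isGreatest_weightLoss v w R _).2 ⟨y, hfar, rfl⟩)
  rw [captureSum_eq_sum_fin (ξ := fun i => ε * ξ i) hw', ← Finset.sum_filter, capturedWeight]
  refine Finset.sum_le_sum_of_subset_of_nonneg (fun i hi => ?_) fun i _ _ => (hw i).le
  simp only [Finset.mem_filter, Finset.mem_univ, true_and] at hi ⊢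
  rw [H.dist_lt_iff s i p q y hy0 hy1, hpq]
  have hi' := hκK i ((hK i).1 hi)
  have : 2 * (p * (ξ i - s) + q * h i) = 2 * (ρ * K i) := by
    simp only [K, hp, hq]
    field_simp
    ring
  rw [this]
  have hρpos : 0 < ρ := by linarith
  nlinarith

theorem captures_of_direction {r x y s p q ρ : ℝ} (hp : p < 0) (hρ : 0 < ρ)
    (hpq : p ^ 2 + q ^ 2 = ρ ^ 2) (hr : 2 * r ≤ ρ)
    (hc : p ^ 2 + q ^ 2 < 2 * (p * (x - s) + q * y)) :
    Captures r x y s ((ρ - q) / -p) := by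
  have hqρ : 0 < ρ - q := by nlinarith
  have hp' : p ≠ 0 := hp.ne
  have key : (r + y) * ((ρ - q) / -p) ^ 2 - 2 * (s - x) * ((ρ - q) / -p) + (r - y) =
      2 * (ρ - q) / p ^ 2 * (r * ρ - (p * (x - s) + q * y)) +
        (r - y) * ((p ^ 2 + q ^ 2 - ρ ^ 2) / p ^ 2) := by
    field_simp
    ring
  rw [Captures, key, hpq, sub_self, zero_div, mul_zero, add_zero]
  exact mul_neg_of_pos_of_neg (by have := sq_pos_of_neg hp; positivity) (by nlinarith)

/-- Every attack is an attack in a direction `t`; the directions orthogonal to the line, which have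
no such parameter, are perturbed. -/
theorem LineCoordinates.weightLoss_le (H : LineCoordinates v a b c ℓ ξ h)
    {w : Fin n → ℝ} {w' : ℕ → ℝ} (hw' : ∀ i : Fin n, w' i = w i) (hw : ∀ i, 0 < w i) {R : ℝ}
    (s : ℝ) :
    ∃ ε : ℝ, (ε = 1 ∨ ε = -1) ∧ ∃ t > 0, weightLoss v w R (linePoint a b c ℓ s) ≤
      captureSum n (fun i => ε * ξ i) h w' (R / 2) (ε * s) t := by
  classical
  obtain ⟨y, hy, hmax⟩ := (isGreatest_weightLoss v w R (linePoint a b c ℓ s)).1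
  have hℓ := H.pos.ne'
  set x := linePoint a b c ℓ s
  set p := (b * (y 0 - x 0) - a * (y 1 - x 1)) / ℓ with hp
  set q := (a * (y 0 - x 0) + b * (y 1 - x 1)) / ℓ with hq
  have hsq : (a ^ 2 + b ^ 2) / ℓ ^ 2 = 1 := by rw [← H.sq]; field_simp
  have hy0 : y 0 = x 0 + (b * p + a * q) / ℓ := by
    have : (b * p + a * q) / ℓ = (y 0 - x 0) * ((a ^ 2 + b ^ 2) / ℓ ^ 2) := by
      rw [hp, hq]; field_simp; ring
    rw [this, hsq]; ring
  have hy1 : y 1 = x 1 + (b * q - a * p) / ℓ := by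
    have : (b * q - a * p) / ℓ = (y 1 - x 1) * ((a ^ 2 + b ^ 2) / ℓ ^ 2) := by
      rw [hp, hq]; field_simp; ring
    rw [this, hsq]; ring
  set ρ := dist y x with hρ
  have hpq : p ^ 2 + q ^ 2 = ρ ^ 2 := (H.dist_linePoint_sq s p q y hy0 hy1).symm
  suffices hmain : ∃ ε : ℝ, (ε = 1 ∨ ε = -1) ∧ ∃ t > 0, ∀ i : Fin n,
      p ^ 2 + q ^ 2 < 2 * (p * (ξ i - s) + q * h i) →
        Captures (R / 2) (ε * ξ i) (h i) (ε * s) t by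
    obtain ⟨ε, hε, t, ht, hsub⟩ := hmain
    refine ⟨ε, hε, t, ht, ?_⟩
    rw [← hmax, captureSum_eq_sum_fin (ξ := fun i => ε * ξ i) hw', ← Finset.sum_filter,
      capturedWeight]
    refine Finset.sum_le_sum_of_subset_of_nonneg (fun i hi => ?_) fun i _ _ => (hw i).le
    simp only [Finset.mem_filter, Finset.mem_univ, true_and] at hi ⊢
    exact hsub i ((H.dist_lt_iff s i p q y hy0 hy1).1 hi)
  have hρ0 : 0 ≤ ρ := dist_nonneg
  have hρR : 2 * (R / 2) ≤ ρ := by have : R ≤ ρ := hy; linarith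
  rcases lt_trichotomy p 0 with hp0 | hp0 | hp0
  · have hρ1 : 0 < ρ := lt_of_le_of_ne hρ0 fun h0 => by nlinarith [sq_nonneg q]
    refine ⟨1, .inl rfl, (ρ - q) / -p, div_pos (by nlinarith) (by linarith), fun i hi => ?_⟩
    rw [one_mul, one_mul]
    exact captures_of_direction hp0 hρ1 hpq hρR hi
  · -- an orthogonal attack: `t` is taken close to `0` or to infinity
    rw [hp0] at hpq ⊢
    have hq2 : q ^ 2 = ρ ^ 2 := by linarith
    rcases lt_trichotomy q 0 with hq0 | hq0 | hq0
    · have hqρ : -q = ρ := by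
        have : (-q - ρ) * (-q + ρ) = 0 := by linear_combination hq2
        rcases mul_eq_zero.1 this with h | h <;> linarith
      have hev : ∀ᶠ t in 𝓝[>] (0 : ℝ), ∀ i : Fin n,
          0 ^ 2 + q ^ 2 < 2 * (0 * (ξ i - s) + q * h i) →
            Captures (R / 2) (1 * ξ i) (h i) (1 * s) (1 / t) := by
        refine eventually_all.2 fun i => ?_
        by_cases hi : 0 ^ 2 + q ^ 2 < 2 * (0 * (ξ i - s) + q * h i)
        · have hA : R / 2 + h i < 0 := by nlinarith
          have hcont : ContinuousAt (fun t : ℝ => (R / 2 - h i) * t ^ 2 - 2 * (s - ξ i) * t +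
            (R / 2 + h i)) 0 := by fun_prop
          have hev := Tendsto.eventually_lt_const
            (show (R / 2 - h i) * 0 ^ 2 - 2 * (s - ξ i) * 0 + (R / 2 + h i) < 0 by linarith) hcont
          filter_upwards [nhdsWithin_le_nhds hev, self_mem_nhdsWithin] with t h1 h2 _
          have h2 : 0 < t := h2
          have : (R / 2 + h i) * (1 / t) ^ 2 - 2 * (1 * s - 1 * ξ i) * (1 / t) + (R / 2 - h i) =
              ((R / 2 - h i) * t ^ 2 - 2 * (s - ξ i) * t + (R / 2 + h i)) / t ^ 2 := by
            field_simp
            ring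
          rw [Captures, this]
          exact div_neg_of_neg_of_pos h1 (by positivity)
        · exact Eventually.of_forall fun t h => absurd h hi
      obtain ⟨t, h1, h2⟩ := (hev.and self_mem_nhdsWithin).exists
      exact ⟨1, .inl rfl, 1 / t, one_div_pos.2 h2, h1⟩
    · refine ⟨1, .inl rfl, 1, one_pos, fun i hi => ?_⟩
      rw [hq0] at hi
      norm_num at hi
    · have hqρ : q = ρ := by
        have : (q - ρ) * (q + ρ) = 0 := by linear_combination hq2
        rcases mul_eq_zero.1 this with h | h <;> linarith
      have hev : ∀ᶠ t in 𝓝[>] (0 : ℝ), ∀ i : Fin n,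
          0 ^ 2 + q ^ 2 < 2 * (0 * (ξ i - s) + q * h i) →
            Captures (R / 2) (1 * ξ i) (h i) (1 * s) t := by
        refine eventually_all.2 fun i => ?_
        by_cases hi : 0 ^ 2 + q ^ 2 < 2 * (0 * (ξ i - s) + q * h i)
        · have hB : R / 2 - h i < 0 := by nlinarith
          have hcont : ContinuousAt (fun t : ℝ => (R / 2 + h i) * t ^ 2 -
            2 * (1 * s - 1 * ξ i) * t + (R / 2 - h i)) 0 := by fun_prop
          have hev := Tendsto.eventually_lt_const (show (R / 2 + h i) * 0 ^ 2 -
            2 * (1 * s - 1 * ξ i) * 0 + (R / 2 - h i) < 0 by linarith) hcont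
          filter_upwards [nhdsWithin_le_nhds hev] with t h1 _ using h1
        · exact Eventually.of_forall fun t h => absurd h hi
      obtain ⟨t, h1, h2⟩ := (hev.and self_mem_nhdsWithin).exists
      exact ⟨1, .inl rfl, t, h2, h1⟩
  · have hρ1 : 0 < ρ := lt_of_le_of_ne hρ0 fun h0 => by nlinarith [sq_nonneg q]
    have hpq' : (-p) ^ 2 + q ^ 2 = ρ ^ 2 := by rw [neg_sq]; exact hpq
    refine ⟨-1, .inr rfl, (ρ - q) / -(-p), div_pos (by nlinarith) (by linarith), fun i hi => ?_⟩
    refine captures_of_direction (neg_neg_of_pos hp0) hρ1 hpq' hρR ?_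
    linarith

theorem LineCoordinates.weightLoss_eq_lineLoss (H : LineCoordinates v a b c ℓ ξ h)
    {w : Fin n → ℝ} {w' : ℕ → ℝ} (hw' : ∀ i : Fin n, w' i = w i) (hw : ∀ i, 0 < w i) {R : ℝ}
    (hR : 0 ≤ R) (s : ℝ) :
    weightLoss v w R (linePoint a b c ℓ s) = lineLoss n ξ h w' (R / 2) s := by
  have h1 : (fun i => (1 : ℝ) * ξ i) = ξ := by simp
  have h2 : (fun i => (-1 : ℝ) * ξ i) = -ξ := by ext; simp
  apply le_antisymm
  · obtain ⟨ε, rfl | rfl, t, ht, hle⟩ := H.weightLoss_le hw' hw s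
    · rw [h1, one_mul] at hle
      exact hle.trans ((captureSum_le_depth ht).trans (le_max_left _ _))
    · rw [h2, neg_one_mul] at hle
      exact hle.trans ((captureSum_le_depth ht).trans (le_max_right _ _))
  · apply max_le
    · obtain ⟨t, ht, he⟩ := exists_depth_eq n ξ h w' (R / 2) s
      have := H.captureSum_le_weightLoss hw' hw hR s (t := t) (.inl rfl)
      rw [h1, one_mul] at this
      exact he ▸ this
    · obtain ⟨t, ht, he⟩ := exists_depth_eq n (-ξ) h w' (R / 2) (-s)
      have := H.captureSum_le_weightLoss hw' hw hR s (t := t) (.inr rfl)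
      rw [h2, neg_one_mul] at this
      exact he ▸ this

/-- A minimizer of `lineLoss` gives a local optimal point. -/
theorem LineCoordinates.isLocalOptimal (H : LineCoordinates v a b c ℓ ξ h)
    {w : Fin n → ℝ} {w' : ℕ → ℝ} (hw' : ∀ i : Fin n, w' i = w i) (hw : ∀ i, 0 < w i) {R : ℝ}
    (hR : 0 ≤ R) {L : Line} (hL : L.points = {x | a * x 0 + b * x 1 = c}) {s : ℝ}
    (hs : ∀ s', lineLoss n ξ h w' (R / 2) s ≤ lineLoss n ξ h w' (R / 2) s') :
    IsLocalOptimal v w R L (linePoint a b c ℓ s) := by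
  have hℓ := H.pos.ne'
  have hsq : (a ^ 2 + b ^ 2) / ℓ ^ 2 = 1 := by rw [← H.sq]; field_simp
  refine ⟨?_, fun x' hx' => ?_⟩
  · rw [hL]
    have h0 : linePoint a b c ℓ s 0 = (b * s + a * (c / ℓ)) / ℓ := by simp [linePoint]
    have h1 : linePoint a b c ℓ s 1 = (b * (c / ℓ) - a * s) / ℓ := by simp [linePoint]
    rw [Set.mem_ofPred_eq, h0, h1]
    have : a * ((b * s + a * (c / ℓ)) / ℓ) + b * ((b * (c / ℓ) - a * s) / ℓ) =
        c * ((a ^ 2 + b ^ 2) / ℓ ^ 2) := by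
      field_simp
      ring
    rw [this, hsq, mul_one]
  · rw [hL, Set.mem_ofPred_eq] at hx'
    have hx : x' = linePoint a b c ℓ ((b * x' 0 - a * x' 1) / ℓ) := by
      ext k
      fin_cases k
      · have : (b * ((b * x' 0 - a * x' 1) / ℓ) + a * (c / ℓ)) / ℓ =
            x' 0 * ((a ^ 2 + b ^ 2) / ℓ ^ 2) := by
          rw [← hx']; field_simp; ring
        simp [linePoint, this, hsq]
      · have : (b * (c / ℓ) - a * ((b * x' 0 - a * x' 1) / ℓ)) / ℓ =
            x' 1 * ((a ^ 2 + b ^ 2) / ℓ ^ 2) := by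
          rw [← hx']; field_simp; ring
        simp [linePoint, this, hsq]
    rw [hx, H.weightLoss_eq_lineLoss hw' hw hR, H.weightLoss_eq_lineLoss hw' hw hR]
    exact hs _

/-- The cotangent of the angle between the line and a direction of slope `m` decreases in `m`, on
both sides of the slope of the line. -/
theorem cot_anti {m m' : ℝ} (hm : m ≤ m') (hpos : 0 < (a + b * m) * (a + b * m')) :
    (b - a * m') / (a + b * m') ≤ (b - a * m) / (a + b * m) := by
  have h1 : a + b * m ≠ 0 := left_ne_zero_of_mul hpos.ne'
  have h2 : a + b * m' ≠ 0 := right_ne_zero_of_mul hpos.ne'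
  have : (b - a * m) / (a + b * m) - (b - a * m') / (a + b * m') =
      (a ^ 2 + b ^ 2) * (m' - m) / ((a + b * m) * (a + b * m')) := by
    field_simp
    ring
  have h3 : 0 ≤ (a ^ 2 + b ^ 2) * (m' - m) / ((a + b * m) * (a + b * m')) :=
    div_nonneg (mul_nonneg (by positivity) (by linarith)) hpos.le
  linarith

end LineGeometry

/-! ### Sweeping over the attack directions -/

section Sweep

open Filter Topology

open Classical in
/-- The events `(k₁, d₁)`, `(k₂, d₂)` describe when a customer of weight `w` is captured: the sum of
the `d`s of past events is the captured weight (at events it may be larger). -/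
structure EventSpec (cap : ℝ → Prop) (w k₁ d₁ k₂ d₂ : ℝ) : Prop where
  nonneg₁ : 0 ≤ k₁
  nonneg₂ : 0 ≤ k₂
  le : ∀ t > 0, (if cap t then w else 0) ≤ (if k₁ < t then d₁ else 0) + (if k₂ < t then d₂ else 0)
  eq : ∀ t > 0, t ≠ k₁ → t ≠ k₂ →
    (if cap t then w else 0) = (if k₁ < t then d₁ else 0) + (if k₂ < t then d₂ else 0)

/-- A quadratic inequality with positive leading coefficient, solved. -/
theorem captures_iff_of_pos {r x y s t : ℝ} (hA : 0 < r + y) :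
    Captures r x y s t ↔ 0 < (s - x) ^ 2 - (r + y) * (r - y) ∧
      (s - x - √((s - x) ^ 2 - (r + y) * (r - y))) / (r + y) < t ∧
      t < (s - x + √((s - x) ^ 2 - (r + y) * (r - y))) / (r + y) := by
  set g := s - x
  set D := g ^ 2 - (r + y) * (r - y) with hD
  rw [div_lt_iff₀ hA, lt_div_iff₀ hA, Captures]
  have key : (r + y) * ((r + y) * t ^ 2 - 2 * g * t + (r - y)) = (t * (r + y) - g) ^ 2 - D := by
    rw [hD]; ring
  have h1 : (r + y) * t ^ 2 - 2 * g * t + (r - y) < 0 ↔ (t * (r + y) - g) ^ 2 < D := by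
    rw [← sub_neg (b := D), ← key]
    constructor
    · exact fun h => mul_neg_of_pos_of_neg hA h
    · intro h
      by_contra! h'
      exact absurd (mul_nonneg hA.le h') (not_le.2 h)
  rw [h1]
  constructor
  · intro h
    have hpos : 0 < D := lt_of_le_of_lt (sq_nonneg _) h
    have := abs_lt.1 ((Real.sqrt_sq_eq_abs _ ▸ Real.sqrt_lt_sqrt (sq_nonneg _) h))
    exact ⟨hpos, by linarith, by linarith⟩
  · rintro ⟨hpos, h2, h3⟩
    have h4 : |t * (r + y) - g| < √D := abs_lt.2 ⟨by linarith, by linarith⟩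
    have := pow_lt_pow_left₀ h4 (abs_nonneg _) two_ne_zero
    rwa [sq_abs, Real.sq_sqrt hpos.le] at this

theorem captures_iff_of_nonpos {r x y s t : ℝ} (hr : 0 ≤ r) (hA : r + y ≤ 0) (ht : 0 < t) :
    Captures r x y s t ↔ 0 < s - x + √((s - x) ^ 2 - (r + y) * (r - y)) ∧
      (r - y) / (s - x + √((s - x) ^ 2 - (r + y) * (r - y))) < t := by
  set g := s - x
  have hB : 0 ≤ r - y := by linarith
  have hAB : (r + y) * (r - y) ≤ 0 := mul_nonpos_of_nonpos_of_nonneg hA hB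
  set q := √(g ^ 2 - (r + y) * (r - y)) with hq
  have hq2 : q ^ 2 = g ^ 2 - (r + y) * (r - y) := Real.sq_sqrt (by nlinarith [sq_nonneg g])
  have hgq : |g| ≤ q := by
    rw [← Real.sqrt_sq_eq_abs]
    exact Real.sqrt_le_sqrt (by linarith)
  have hgq' : g ≤ q := (le_abs_self g).trans hgq
  have hgq'' : 0 ≤ g + q := by linarith [neg_abs_le g]
  -- the quadratic form factors through its positive root `(r - y) / (g + q)`
  have key : (g + q) * ((r + y) * t ^ 2 - 2 * g * t + (r - y)) =
      ((r - y) - t * (g + q)) * ((g + q) - t * (r + y)) := by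
    linear_combination t * hq2
  rw [Captures]
  rcases hgq''.eq_or_lt with h0 | h0
  · rw [← h0]
    simp only [lt_irrefl, false_and, iff_false, not_lt]
    have hg : g ≤ 0 := by
      have := Real.sqrt_nonneg (g ^ 2 - (r + y) * (r - y))
      rw [← hq] at this
      linarith
    have hA0 : (r + y) * (r - y) = 0 := by
      have : q = -g := by linarith
      rw [this] at hq2
      linarith [neg_sq g]
    rcases mul_eq_zero.1 hA0 with h | h
    · rw [h]; nlinarith
    · have : r + y = 0 := by linarith
      rw [this]; nlinarith
  · rw [div_lt_iff₀ h0]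
    have hsecond : 0 < (g + q) - t * (r + y) := by nlinarith
    constructor
    · intro h
      refine ⟨h0, ?_⟩
      by_contra! hle
      have h1 := mul_neg_of_pos_of_neg h0 h
      rw [key] at h1
      exact absurd (mul_nonneg (sub_nonneg.2 hle) hsecond.le) (not_le.2 h1)
    · rintro ⟨-, h⟩
      by_contra! hle
      have h1 := mul_nonneg h0.le hle
      rw [key] at h1
      exact absurd (mul_neg_of_neg_of_pos (sub_neg.2 h) hsecond) (not_lt.2 h1)

theorem eventSpec_inactive {r x y s w : ℝ} (hr : 0 ≤ r)
    (hc : ¬ (0 < s - x + √((s - x) ^ 2 - (r + y) * (r - y)) ∧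
      (r + y ≤ 0 ∨ 0 < (s - x) ^ 2 - (r + y) * (r - y)))) :
    EventSpec (Captures r x y s) w 0 0 0 0 := by
  have hno : ∀ t > 0, ¬ Captures r x y s t := by
    intro t ht h
    apply hc
    rcases le_or_gt (r + y) 0 with hA | hA
    · exact ⟨((captures_iff_of_nonpos hr hA ht).1 h).1, .inl hA⟩
    · obtain ⟨h1, -, h3⟩ := (captures_iff_of_pos hA).1 h
      refine ⟨?_, .inr h1⟩
      by_contra! hle
      exact absurd (h3.trans_le (div_nonpos_of_nonpos_of_nonneg hle hA.le)) (not_lt.2 ht.le)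
  exact ⟨le_rfl, le_rfl, fun t ht => by simp [hno t ht], fun t ht _ _ => by simp [hno t ht]⟩

theorem eventSpec_of_pos {r x y s w : ℝ} (hw : 0 < w)
    (hc : 0 < s - x + √((s - x) ^ 2 - (r + y) * (r - y)) ∧
      (r + y ≤ 0 ∨ 0 < (s - x) ^ 2 - (r + y) * (r - y))) (hA : 0 < r + y) :
    EventSpec (Captures r x y s) w
      (max 0 ((s - x - √((s - x) ^ 2 - (r + y) * (r - y))) / (r + y))) w
      ((s - x + √((s - x) ^ 2 - (r + y) * (r - y))) / (r + y)) (-w) := by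
  have hD := hc.2.resolve_left (not_le.2 hA)
  set q := √((s - x) ^ 2 - (r + y) * (r - y))
  have hhi : 0 < (s - x + q) / (r + y) := div_pos hc.1 hA
  have hlohi : max 0 ((s - x - q) / (r + y)) ≤ (s - x + q) / (r + y) := by
    refine max_le hhi.le ?_
    have : 0 ≤ q := Real.sqrt_nonneg _
    gcongr
    linarith
  have hcap : ∀ t > 0, Captures r x y s t ↔
      max 0 ((s - x - q) / (r + y)) < t ∧ t < (s - x + q) / (r + y) := by
    intro t ht
    rw [captures_iff_of_pos hA, max_lt_iff]
    exact ⟨fun h => ⟨⟨ht, h.2.1⟩, h.2.2⟩, fun h => ⟨hD, h.1.2, h.2⟩⟩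
  refine ⟨le_max_left _ _, hhi.le, fun t ht => ?_, fun t ht h1 h2 => ?_⟩
  · rw [hcap t ht]
    by_cases h3 : max 0 ((s - x - q) / (r + y)) < t <;> by_cases h4 : (s - x + q) / (r + y) < t
    · simp [h3, h4, not_lt.2 h4.le]
    · rw [if_pos h3, if_neg h4]
      split_ifs <;> linarith
    · exact absurd (hlohi.trans_lt h4) h3
    · simp [h3, h4]
  · rw [hcap t ht]
    by_cases h3 : max 0 ((s - x - q) / (r + y)) < t <;> by_cases h4 : (s - x + q) / (r + y) < t
    · simp [h3, h4, not_lt.2 h4.le]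
    · rw [if_pos h3, if_neg h4, if_pos ⟨h3, lt_of_le_of_ne (not_lt.1 h4) h2⟩, add_zero]
    · exact absurd (hlohi.trans_lt h4) h3
    · simp [h3, h4]

theorem eventSpec_of_nonpos {r x y s w : ℝ} (hr : 0 ≤ r)
    (hc : 0 < s - x + √((s - x) ^ 2 - (r + y) * (r - y))) (hA : r + y ≤ 0) :
    EventSpec (Captures r x y s) w
      ((r - y) / (s - x + √((s - x) ^ 2 - (r + y) * (r - y)))) w 0 0 := by
  have hcap : ∀ t > 0, Captures r x y s t ↔
      (r - y) / (s - x + √((s - x) ^ 2 - (r + y) * (r - y))) < t := fun t ht =>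
    (captures_iff_of_nonpos hr hA ht).trans ⟨fun h => h.2, fun h => ⟨hc, h⟩⟩
  exact ⟨div_nonneg (by linarith) hc.le, le_rfl, fun t ht => by simp [hcap t ht],
    fun t ht _ _ => by simp [hcap t ht]⟩

/-- The greatest sum of the events up to some event is the depth. -/
theorem eq_depth_of_events {n : ℕ} {ξ h w : ℕ → ℝ} {r s : ℝ} (hw : ∀ i < n, 0 < w i)
    {key δ : ℕ → ℝ} {best : ℝ} (hev : ∀ i < n, EventSpec (Captures r (ξ i) (h i) s) (w i)
      (key i) (δ i) (key (n + i)) (δ (n + i)))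
    (h0 : 0 ≤ best)
    (hle : ∀ e < n + n, ∑ e' ∈ Finset.range (n + n) with key e' ≤ key e, δ e' ≤ best)
    (hex : best = 0 ∨ ∃ e < n + n,
      best = ∑ e' ∈ Finset.range (n + n) with key e' ≤ key e, δ e') :
    best = depth n ξ h w r s := by
  classical
  have hsum : ∀ t, ∑ e ∈ Finset.range (n + n) with key e < t, δ e =
      ∑ i ∈ Finset.range n, ((if key i < t then δ i else 0) +
        if key (n + i) < t then δ (n + i) else 0) := by
    intro t
    rw [Finset.sum_filter, Finset.sum_range_add, Finset.sum_add_distrib]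
  have hcap : ∀ t, captureSum n ξ h w r s t =
      ∑ i ∈ Finset.range n, if Captures r (ξ i) (h i) s t then w i else 0 := by
    intro t
    rw [captureSum, Finset.sum_filter]
  apply le_antisymm
  · rcases hex with hz | ⟨e, he, hbest⟩
    · rw [hz]
      obtain ⟨t, -, ht⟩ := exists_depth_eq n ξ h w r s
      rw [← ht]
      exact Finset.sum_nonneg fun i hi =>
        (hw i (Finset.mem_range.1 (Finset.mem_filter.1 hi).1)).le
    · -- a direction just after the event `e`
      have hkey0 : ∀ e < n + n, 0 ≤ key e := by
        intro e he
        rcases Nat.lt_or_ge e n with h | h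
        · exact (hev e h).nonneg₁
        · have := (hev (e - n) (by omega)).nonneg₂
          rwa [show n + (e - n) = e by omega] at this
      have hnear : ∀ᶠ t in 𝓝[>] (key e), ∀ e' ∈ Finset.range (n + n),
          key e < key e' → t < key e' := by
        refine (eventually_all_finset _).2 fun e' _ => ?_
        by_cases hlt : key e < key e'
        · exact nhdsWithin_le_nhds ((gt_mem_nhds hlt).mono fun t ht _ => ht)
        · exact Eventually.of_forall fun t h => absurd h hlt
      obtain ⟨t, hnear, het⟩ := (hnear.and self_mem_nhdsWithin).exists
      have het : key e < t := het
      have hiff : ∀ e' < n + n, key e' < t ↔ key e' ≤ key e := by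
        intro e' he'
        refine ⟨fun h => ?_, fun h => h.trans_lt het⟩
        by_contra! hlt
        exact lt_asymm h (hnear e' (Finset.mem_range.2 he') hlt)
      have hne : ∀ e' < n + n, t ≠ key e' := by
        rintro e' he' rfl
        exact absurd ((hiff e' he').not.1 (lt_irrefl _)) (fun h =>
          lt_irrefl _ (hnear e' (Finset.mem_range.2 he') (not_le.1 h)))
      have htpos : 0 < t := (hkey0 e he).trans_lt het
      refine le_trans (le_of_eq ?_) (captureSum_le_depth htpos)
      rw [hbest, hcap, Finset.sum_congr (Finset.filter_congr fun e' he' =>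
        (hiff e' (Finset.mem_range.1 he')).symm) fun _ _ => rfl, hsum]
      refine Finset.sum_congr rfl fun i hi => ?_
      have hi := Finset.mem_range.1 hi
      exact ((hev i hi).eq t htpos (hne i (by omega)) (hne (n + i) (by omega))).symm
  · obtain ⟨t, ht, he⟩ := exists_depth_eq n ξ h w r s
    rw [← he, hcap]
    refine (Finset.sum_le_sum fun i hi => (hev i (Finset.mem_range.1 hi)).le t ht).trans ?_
    rw [← hsum]
    by_cases hex : ((Finset.range (n + n)).filter fun e => key e < t).Nonempty
    · obtain ⟨e, he, hmax⟩ := Finset.exists_max_image _ key hex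
      simp only [Finset.mem_filter, Finset.mem_range] at he hmax
      refine le_trans (le_of_eq (Finset.sum_congr (Finset.filter_congr fun e' he' => ?_)
        fun _ _ => rfl)) (hle e he.1)
      exact ⟨fun h => hmax e' ⟨Finset.mem_range.1 he', h⟩, fun h => h.trans_lt he.2⟩
    · rw [Finset.not_nonempty_iff_eq_empty.1 hex]
      simpa using h0

end Sweep

/-! ### Prefix sums in sorted order -/

namespace RealRAM

namespace SortedPerm

variable {key : ℕ → ℝ} {idx : ℕ → ℕ} {m : ℕ}

theorem lt (H : SortedPerm key idx m) {j : ℕ} (hj : j < m) : idx j < m := by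
  have : idx j ∈ List.range m := H.perm.subset (by
    simpa [seg] using ⟨j, hj, rfl⟩)
  simpa using this

theorem exists_eq (H : SortedPerm key idx m) {e : ℕ} (he : e < m) : ∃ j < m, idx j = e := by
  have := H.perm.symm.subset (List.mem_range.2 he)
  simpa [seg] using this

theorem injOn (H : SortedPerm key idx m) {i j : ℕ} (hi : i < m) (hj : j < m)
    (h : idx i = idx j) : i = j := by
  have hnd : (seg idx 0 m).Nodup := H.perm.nodup_iff.2 List.nodup_range
  have := (List.Nodup.getElem_inj_iff hnd (hi := by simpa using hi) (hj := by simpa using hj)).1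
    (by rw [getElem_seg, getElem_seg, zero_add, zero_add, h])
  exact this

theorem sum_comp {M : Type*} [AddCommMonoid M] (H : SortedPerm key idx m) (f : ℕ → M) :
    ∑ j ∈ Finset.range m, f (idx j) = ∑ e ∈ Finset.range m, f e := by
  refine Finset.sum_nbij idx ?_ ?_ ?_ fun _ _ => rfl
  · exact fun j hj => Finset.mem_range.2 (H.lt (Finset.mem_range.1 hj))
  · exact fun i hi j hj h => H.injOn (Finset.mem_range.1 hi) (Finset.mem_range.1 hj) h
  · intro e he
    obtain ⟨j, hj, h⟩ := H.exists_eq (Finset.mem_range.1 he)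
    exact ⟨j, Finset.mem_coe.2 (Finset.mem_range.2 hj), h⟩

/-- Position `j` is the last one with its key. -/
def Last (key : ℕ → ℝ) (idx : ℕ → ℕ) (m j : ℕ) : Prop :=
  m ≤ j + 1 ∨ key (idx j) < key (idx (j + 1))

theorem sum_prefix (H : SortedPerm key idx m) (δ : ℕ → ℝ) {j : ℕ} (hj : j < m)
    (hl : Last key idx m j) : ∑ j' ∈ Finset.range (j + 1), δ (idx j') =
      ∑ e ∈ Finset.range m with key e ≤ key (idx j), δ e := by
  classical
  rw [Finset.sum_filter, ← H.sum_comp fun e => if key e ≤ key (idx j) then δ e else 0,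
    ← Finset.sum_filter]
  refine Finset.sum_congr ?_ fun _ _ => rfl
  ext i
  simp only [Finset.mem_range, Finset.mem_filter]
  constructor
  · exact fun hi => ⟨by omega, H.mono i j (by omega) hj⟩
  · rintro ⟨him, hi⟩
    by_contra! hlt
    rcases hl with h | h
    · omega
    · exact absurd (H.mono (j + 1) i hlt him) (not_le.2 (hi.trans_lt h))

theorem exists_last (H : SortedPerm key idx m) {e : ℕ} (he : e < m) :
    ∃ j < m, Last key idx m j ∧ key (idx j) = key e := by
  classical
  obtain ⟨j₀, hj₀, h₀⟩ := H.exists_eq he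
  obtain ⟨j, hj, hmax⟩ := Finset.exists_max_image
    ((Finset.range m).filter fun j => key (idx j) = key e) id
    ⟨j₀, Finset.mem_filter.2 ⟨Finset.mem_range.2 hj₀, by rw [h₀]⟩⟩
  simp only [Finset.mem_filter, Finset.mem_range, id] at hj hmax
  refine ⟨j, hj.1, ?_, hj.2⟩
  by_contra hl
  simp only [Last, not_or, not_le, not_lt] at hl
  have := H.mono j (j + 1) (by omega) hl.1
  have := hmax (j + 1) ⟨hl.1, by linarith [hj.2, hl.2]⟩
  omega

end SortedPerm

/-! ### Evaluating the weight loss -/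

/-- The data of a query: the number of customers, their coordinates with respect to the line, their
weights, and half the minimal distance. -/
structure LineData (n : ℕ) (ξ h w : ℕ → ℝ) (r : ℝ) (s : State) : Prop where
  n_eq : s.natReg 0 = n
  ξ_eq : s.realMem 3 = ξ
  h_eq : s.realMem 4 = h
  w_eq : s.realMem 2 = w
  r_eq : s.realReg 7 = r

theorem LineData.frame {n : ℕ} {ξ h w : ℕ → ℝ} {r : ℝ} {p : Program} {s s' : State}
    (H : LineData n ξ h w r s) (hF : Frame p s s')
    (hp : (p.writesNatReg 0 || p.writesRealMem 3 || p.writesRealMem 4 || p.writesRealMem 2 ||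
      p.writesRealReg 7) = false) : LineData n ξ h w r s' := by
  simp only [Bool.or_eq_false_iff] at hp
  obtain ⟨⟨⟨⟨h0, h3⟩, h4⟩, h2⟩, h7⟩ := hp
  exact ⟨(hF.natReg _ h0).trans H.n_eq, (hF.realMem _ h3).trans H.ξ_eq,
    (hF.realMem _ h4).trans H.h_eq, (hF.realMem _ h2).trans H.w_eq,
    (hF.realReg _ h7).trans H.r_eq⟩

/-- The two events of customer `i` are computed in the real registers 19 to 22. -/
def computeEvent : Program :=
  .seq (.setReal 13 (.mul (.reg 12) (.sub (.reg 9) (.read 3 (.reg 1)))))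
  (.seq (.setReal 23 (.add (.reg 7) (.read 4 (.reg 1))))
  (.seq (.setReal 24 (.sub (.reg 7) (.read 4 (.reg 1))))
  (.seq (.setReal 18 (.sub (.mul (.reg 13) (.reg 13)) (.mul (.reg 23) (.reg 24))))
  (.seq (.setReal 14 (.add (.reg 13) (.sqrt (.reg 18))))
  (.ite (.and (.realLt (.const 0) (.reg 14))
      (.or (.realLe (.reg 23) (.const 0)) (.realLt (.const 0) (.reg 18))))
    (.ite (.realLt (.const 0) (.reg 23))
      (.seq (.setReal 19 (.div (.sub (.reg 13) (.sqrt (.reg 18))) (.reg 23)))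
      (.seq (.setReal 20 (.read 2 (.reg 1)))
      (.seq (.setReal 21 (.div (.reg 14) (.reg 23)))
      (.seq (.setReal 22 (.sub (.const 0) (.read 2 (.reg 1))))
      (.ite (.realLe (.reg 19) (.const 0)) (.setReal 19 (.const 0)) .skip)))))
      (.seq (.setReal 19 (.div (.reg 24) (.reg 14)))
      (.seq (.setReal 20 (.read 2 (.reg 1)))
      (.seq (.setReal 21 (.const 0)) (.setReal 22 (.const 0))))))
    (.seq (.setReal 19 (.const 0))
    (.seq (.setReal 20 (.const 0))
    (.seq (.setReal 21 (.const 0)) (.setReal 22 (.const 0))))))))))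

/-- The two events of customer `i` are entered into the arrays 10 (keys) and 5 (weights). -/
def storeEvent : Program :=
  .seq (.writeReal 10 (.reg 1) (.reg 19))
  (.seq (.writeReal 5 (.reg 1) (.reg 20))
  (.seq (.writeReal 10 (.add (.reg 0) (.reg 1)) (.reg 21))
    (.writeReal 5 (.add (.reg 0) (.reg 1)) (.reg 22))))

/-- One step of the sweep: register 15 holds the current sum, register 16 the greatest one. -/
def sweepStep : Program :=
  .seq (.setReal 15 (.add (.reg 15) (.read 5 (.read 20 (.reg 2)))))
    (.ite (.or (.natLe (.reg 20) (.add (.reg 2) (.const 1)))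
        (.realLt (.read 10 (.read 20 (.reg 2))) (.read 10 (.read 20 (.add (.reg 2) (.const 1))))))
      (.ite (.realLt (.reg 16) (.reg 15)) (.setReal 16 (.reg 15)) .skip)
      .skip)

/-- Computes into register 16 the depth at the point in register 9, on the line mirrored by the sign
in register 12. -/
def depthProgram : Program :=
  .seq (forLoop 1 (.reg 0) (.seq computeEvent storeEvent))
  (.seq (.setNat 20 (.add (.reg 0) (.reg 0)))
  (.seq sortProgram
  (.seq (.seq (.setReal 15 (.const 0)) (.setReal 16 (.const 0)))
    (forLoop 2 (.reg 20) sweepStep))))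

theorem runs_computeEvent {n i : ℕ} {ξ h w : ℕ → ℝ} {r ε s₀ : ℝ} {s : State}
    (H : LineData n ξ h w r s) (hr : 0 ≤ r) (hw : 0 < w i) (h1 : s.natReg 1 = i)
    (h12 : s.realReg 12 = ε) (h9 : s.realReg 9 = s₀) :
    Runs computeEvent s 120 (fun s' => EventSpec (Captures r (ε * ξ i) (h i) (ε * s₀)) (w i)
      (s'.realReg 19) (s'.realReg 20) (s'.realReg 21) (s'.realReg 22)) := by
  refine Runs.of_wp ?_ rfl (by decide)
  have hg : ε * (s₀ - ξ i) = ε * s₀ - ε * ξ i := by ring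
  simp only [computeEvent, Program.wp, RealExpr.eval, NatExpr.eval, Function.update_apply, h1, h12,
    h9, H.ξ_eq, H.h_eq, H.w_eq, H.r_eq, Test.Holds]
  rintro g hg' A hA B hB D hD q hq
  simp only [Nat.reduceEqDiff, if_false, if_true, Rat.cast_zero] at *
  rw [hg] at hg'
  rw [← pow_two, hA, hB, hg'] at hD
  rw [hg', hD] at hq
  refine ⟨fun hc => ⟨fun hA' => ?_, fun hA' => ?_⟩, fun hc => ?_⟩
  · rintro k₁ hk₁ d₁ hd₁ k₂ hk₂ d₂ hd₂
    rw [hq, hA, hD] at hc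
    have hspec := eventSpec_of_pos hw hc (hA ▸ hA')
    have hm : ∀ k, k = max 0 ((ε * s₀ - ε * ξ i -
        √((ε * s₀ - ε * ξ i) ^ 2 - (r + h i) * (r - h i))) / (r + h i)) →
        EventSpec (Captures r (ε * ξ i) (h i) (ε * s₀)) (w i) k d₁ k₂ d₂ := by
      intro k hk
      rw [hk, hd₁, hk₂, hd₂, hq, hA, zero_sub]
      exact hspec
    rw [hg', hD, hA] at hk₁
    refine ⟨fun hneg k hk => hm k ?_, fun hneg => hm k₁ ?_⟩
    · rw [hk, max_eq_left (hk₁ ▸ hneg)]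
    · rw [← hk₁, max_eq_right (not_le.1 hneg).le]
  · rintro k₁ hk₁ d₁ hd₁ k₂ hk₂ d₂ hd₂
    rw [hq, hA, hD] at hc
    rw [hk₁, hd₁, hk₂, hd₂, hq, hB]
    exact eventSpec_of_nonpos hr hc.1 (hA ▸ not_lt.1 hA')
  · rintro k₁ hk₁ d₁ hd₁ k₂ hk₂ d₂ hd₂
    rw [hq, hA, hD] at hc
    rw [hk₁, hd₁, hk₂, hd₂]
    exact eventSpec_inactive hr hc

theorem runs_depthProgram {n : ℕ} {ξ h w : ℕ → ℝ} {r ε s₀ : ℝ} {s : State}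
    (H : LineData n ξ h w r s) (hr : 0 ≤ r) (hw : ∀ i < n, 0 < w i)
    (h12 : s.realReg 12 = ε) (h9 : s.realReg 9 = s₀) :
    Runs depthProgram s (900 * ((n + 1) * (n.size + 2)))
      (fun s' => s'.realReg 16 = depth n (fun i => ε * ξ i) h w r (ε * s₀)) := by
  have hmain : Runs depthProgram s ((n + 1) * ((120 + 20) + 1 + 6) + (4 +
      (150 * ((n + n + 1) * ((n + n).size + 1)) + (4 + (n + n + 1) * (40 + 1 + 6)))))
      (fun s' => s'.realReg 16 = depth n (fun i => ε * ξ i) h w r (ε * s₀)) := by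
    refine Runs.seq (R := fun s' => ∀ i < n, EventSpec (Captures r (ε * ξ i) (h i) (ε * s₀)) (w i)
      (s'.realMem 10 i) (s'.realMem 5 i) (s'.realMem 10 (n + i)) (s'.realMem 5 (n + i)))
      (Runs.forLoop n (120 + 20) (fun k s' => ∀ i < k,
        EventSpec (Captures r (ε * ξ i) (h i) (ε * s₀)) (w i) (s'.realMem 10 i) (s'.realMem 5 i)
          (s'.realMem 10 (n + i)) (s'.realMem 5 (n + i))) rfl (fun k s x h => h)
        (fun s' hF => (hF.natReg 0 rfl).trans H.n_eq) (by simp) ?_) ?_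
    · intro k s' hk hF h1 hI
      have H' : LineData n ξ h w r s' := H.frame hF rfl
      refine Runs.seq (runs_computeEvent H' hr (hw k hk) h1 ((hF.realReg 12 rfl).trans h12)
        ((hF.realReg 9 rfl).trans h9)) fun s'' hF' hspec => ?_
      have hI' : ∀ i < k, EventSpec (Captures r (ε * ξ i) (h i) (ε * s₀)) (w i)
          (s''.realMem 10 i) (s''.realMem 5 i) (s''.realMem 10 (n + i))
          (s''.realMem 5 (n + i)) := by
        rw [hF'.realMem 10 rfl, hF'.realMem 5 rfl]
        exact hI
      have e0 : s''.natReg 0 = n := (hF'.natReg 0 rfl).trans H'.n_eq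
      have e1 : s''.natReg 1 = k := (hF'.natReg 1 rfl).trans h1
      refine Runs.of_wp ?_ rfl (by decide)
      simp only [storeEvent, Program.wp, RealExpr.eval, NatExpr.eval, e0, e1]
      rintro j₁ _ e₁ rfl j₂ _ e₂ rfl j₃ _ e₃ rfl j₄ _ e₄ rfl i hi
      simp only [Function.update_apply, e₁, e₂, e₃, e₄]
      rcases Nat.lt_succ_iff_lt_or_eq.1 hi with hi | rfl
      · have g1 : i ≠ n + k := by omega
        have g2 : i ≠ k := by omega
        have g3 : n + i ≠ n + k := by omega
        have g4 : n + i ≠ k := by omega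
        simpa [g1, g2, g3, g4] using hI' i hi
      · have g1 : n ≠ 0 := by omega
        simpa [Function.update_apply, g1] using hspec
    intro s₁ hF₁ hs₁
    have H₁ : LineData n ξ h w r s₁ := H.frame hF₁ rfl
    refine Runs.seq (R := fun s' => s'.natReg 20 = n + n)
      (Runs.of_wp (by simp [Program.wp, NatExpr.eval, H₁.n_eq]) rfl (by decide))
      fun s₂ hF₂ hs₂ => ?_
    refine Runs.seq (runs_sortProgram hs₂) fun s₃ hF₃ hs₃ => ?_
    set key := s₂.realMem 10 with hkey
    set δ := s₂.realMem 5 with hδ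
    have e10 : s₃.realMem 10 = key := hF₃.realMem 10 rfl
    have e5 : s₃.realMem 5 = δ := hF₃.realMem 5 rfl
    have hev : ∀ i < n, EventSpec (Captures r (ε * ξ i) (h i) (ε * s₀)) (w i)
        (key i) (δ i) (key (n + i)) (δ (n + i)) := by
      rw [hkey, hδ, hF₂.realMem 10 rfl, hF₂.realMem 5 rfl]
      exact hs₁
    set idx := s₃.natMem 20 with hidx
    refine Runs.seq (R := fun s' => s'.realReg 15 = 0 ∧ s'.realReg 16 = 0)
      (Runs.of_wp (by simp [Program.wp, RealExpr.eval]) rfl (by decide))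
      fun s₄ hF₄ hs₄ => ?_
    have f20 : s₄.natReg 20 = n + n :=
      ((hF₄.natReg 20 rfl).trans (hF₃.natReg 20 rfl)).trans hs₂
    refine (Runs.forLoop (N := .reg 20) (n + n) 40 (fun k s' =>
      s'.realReg 15 = ∑ j ∈ Finset.range k, δ (idx j) ∧ 0 ≤ s'.realReg 16 ∧
      (∀ j < k, SortedPerm.Last key idx (n + n) j →
        ∑ j' ∈ Finset.range (j + 1), δ (idx j') ≤ s'.realReg 16) ∧
      (s'.realReg 16 = 0 ∨ ∃ j < k, SortedPerm.Last key idx (n + n) j ∧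
        s'.realReg 16 = ∑ j' ∈ Finset.range (j + 1), δ (idx j'))) rfl (fun k s x h => h)
        (fun s' hF => (hF.natReg 20 rfl).trans f20) (by simp [hs₄]) ?_).mono le_rfl ?_
    · rintro k s' hk hF h2 ⟨hcur, hb0, hbl, hbe⟩
      have g10 : s'.realMem 10 = key := ((hF.realMem 10 rfl).trans (hF₄.realMem 10 rfl)).trans e10
      have g5 : s'.realMem 5 = δ := ((hF.realMem 5 rfl).trans (hF₄.realMem 5 rfl)).trans e5
      have g20 : s'.natMem 20 = idx := (hF.natMem 20 rfl).trans (hF₄.natMem 20 rfl)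
      have gm : s'.natReg 20 = n + n := (hF.natReg 20 rfl).trans f20
      refine Runs.of_wp ?_ rfl (by decide)
      simp only [sweepStep, Program.wp, RealExpr.eval, NatExpr.eval, Function.update_apply, h2,
        g10, g5, g20, gm, Test.Holds, Nat.reduceEqDiff, if_false, if_true]
      rintro x hx
      rw [hcur, ← Finset.sum_range_succ (fun j => δ (idx j))] at hx
      refine ⟨fun hl => ⟨?_, ?_⟩, fun hl => ?_⟩
      · rintro hlt y rfl
        refine ⟨hx, hb0.trans hlt.le, fun j hj hlj => ?_, .inr ⟨k, by omega, hl, hx⟩⟩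
        rcases Nat.lt_succ_iff_lt_or_eq.1 hj with hj | rfl
        · exact (hbl j hj hlj).trans hlt.le
        · exact hx.ge
      · intro hlt
        refine ⟨hx, hb0, fun j hj hlj => ?_, ?_⟩
        · rcases Nat.lt_succ_iff_lt_or_eq.1 hj with hj | rfl
          · exact hbl j hj hlj
          · rw [← hx]; exact not_lt.1 hlt
        · exact hbe.imp_right fun ⟨j, hj, h⟩ => ⟨j, by omega, h⟩
      · refine ⟨hx, hb0, fun j hj hlj => ?_, ?_⟩
        · rcases Nat.lt_succ_iff_lt_or_eq.1 hj with hj | rfl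
          · exact hbl j hj hlj
          · exact absurd hlj hl
        · exact hbe.imp_right fun ⟨j, hj, h⟩ => ⟨j, by omega, h⟩
    · rintro s' - ⟨-, hb0, hbl, hbe⟩
      refine eq_depth_of_events hw hev hb0 (fun e he => ?_) (hbe.imp_right ?_)
      · obtain ⟨j, hj, hl, hke⟩ := hs₃.exists_last he
        rw [← hke]
        exact (hs₃.sum_prefix δ hj hl).symm.trans_le (hbl j hj hl)
      · rintro ⟨j, hj, hl, hb⟩
        exact ⟨idx j, hs₃.lt hj, hb.trans (hs₃.sum_prefix δ hj hl)⟩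
  refine hmain.mono ?_ fun _ _ => id
  have hsize : (n + n).size ≤ n.size + 1 := by
    rw [Nat.size_le, pow_succ]
    have := Nat.lt_size_self n
    omega
  have h1 : (n + n + 1) * ((n + n).size + 1) ≤ (n + n + 1) * (n.size + 2) :=
    Nat.mul_le_mul_left _ (by omega)
  have h2 : 900 * ((n + 1) * (n.size + 2)) = 150 * ((n + n + 1) * (n.size + 2)) +
    600 * (n * n.size) + 1200 * n + 750 * n.size + 1500 := by ring
  generalize (n + n + 1) * ((n + n).size + 1) = x at *
  generalize (n + n + 1) * (n.size + 2) = y at *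
  generalize (n + 1) * (n.size + 2) = x' at *
  generalize n * n.size = y' at *
  omega

/-- Evaluates the weight loss at the point in register 9: afterwards the backward depth is in
register 17, the forward depth in register 16. -/
def lossProgram : Program :=
  .seq (.setReal 12 (.const 1))
  (.seq depthProgram
  (.seq (.seq (.setReal 17 (.reg 16)) (.setReal 12 (.const (-1))))
    depthProgram))

theorem runs_lossProgram {n : ℕ} {ξ h w : ℕ → ℝ} {r s₀ : ℝ} {s : State}
    (H : LineData n ξ h w r s) (hr : 0 ≤ r) (hw : ∀ i < n, 0 < w i) (h9 : s.realReg 9 = s₀) :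
    Runs lossProgram s (2000 * ((n + 1) * (n.size + 2)))
      (fun s' => s'.realReg 17 = depth n ξ h w r s₀ ∧
        s'.realReg 16 = depth n (-ξ) h w r (-s₀)) := by
  have hmain : Runs lossProgram s (2 + (900 * ((n + 1) * (n.size + 2)) + (4 +
      900 * ((n + 1) * (n.size + 2))))) (fun s' => s'.realReg 17 = depth n ξ h w r s₀ ∧
        s'.realReg 16 = depth n (-ξ) h w r (-s₀)) := by
    refine Runs.seq (R := fun s' => s'.realReg 12 = 1)
      (Runs.of_wp (by simp [Program.wp, RealExpr.eval]) rfl (by decide)) fun s₁ hF₁ h₁ => ?_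
    refine Runs.seq (runs_depthProgram (H.frame hF₁ rfl) hr hw h₁ ((hF₁.realReg 9 rfl).trans h9))
      fun s₂ hF₂ h₂ => ?_
    simp only [one_mul] at h₂
    refine Runs.seq (R := fun s' => s'.realReg 17 = depth n ξ h w r s₀ ∧ s'.realReg 12 = -1)
      (Runs.of_wp (by simpa [Program.wp, RealExpr.eval, Function.update_apply] using h₂) rfl
        (by decide)) fun s₃ hF₃ h₃ => ?_
    refine (runs_depthProgram (((H.frame hF₁ rfl).frame hF₂ rfl).frame hF₃ rfl) hr hw h₃.2
      (((hF₃.realReg 9 rfl).trans (hF₂.realReg 9 rfl)).trans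
        ((hF₁.realReg 9 rfl).trans h9))).mono le_rfl fun s' hF h' => ?_
    refine ⟨(hF.realReg 17 rfl).trans h₃.1, ?_⟩
    rw [h', neg_one_mul]
    congr 1
    ext i
    simp
  refine hmain.mono ?_ fun _ _ => id
  have : 1 ≤ (n + 1) * (n.size + 2) := Nat.succ_le_of_lt (by positivity)
  omega

end RealRAM

/-! ### Searching the candidates -/

namespace RealRAM

/-- Computes into register 25 the candidate of the customers in the index registers 9 and 10, for
the sign in register 8. -/
def candidateProgram : Program :=
  .seq (.setReal 30 (.sub (.read 4 (.reg 10)) (.read 4 (.reg 9))))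
  (.seq (.setReal 31 (.add (.mul (.reg 8) (.reg 7)) (.read 4 (.reg 9))))
  (.seq (.setReal 32 (.sub (.mul (.reg 8) (.reg 7)) (.read 4 (.reg 9))))
  (.seq (.setReal 33 (.div (.sub (.read 3 (.reg 10)) (.read 3 (.reg 9))) (.reg 30)))
  (.seq (.setReal 33 (.sub (.sqrt (.add (.const 1) (.mul (.reg 33) (.reg 33)))) (.reg 33)))
  (.seq (.setReal 25 (.add (.read 3 (.reg 9)) (.mul (.reg 8) (.sqrt (.mul (.reg 31) (.reg 32))))))
    (.ite (.and (.or (.realLt (.reg 30) (.const 0)) (.realLt (.const 0) (.reg 30)))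
        (.realLt (.reg 32) (.mul (.reg 31) (.mul (.reg 33) (.reg 33)))))
      (.setReal 25 (.add (.read 3 (.reg 9))
        (.div (.add (.mul (.reg 31) (.reg 33)) (.div (.reg 32) (.reg 33))) (.const 2))))
      .skip))))))

theorem runs_candidateProgram {n i j : ℕ} {ξ h w : ℕ → ℝ} {r σ : ℝ} {s : State}
    (H : LineData n ξ h w r s) (h9 : s.natReg 9 = i) (h10 : s.natReg 10 = j)
    (h8 : s.realReg 8 = σ) :
    Runs candidateProgram s 80 (fun s' => s'.realReg 25 = candidate r σ ξ h i j) := by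
  refine Runs.of_wp ?_ rfl (by decide)
  simp only [candidateProgram, Program.wp, RealExpr.eval, NatExpr.eval, Function.update_apply, h9,
    h10, h8, H.ξ_eq, H.h_eq, H.r_eq, Test.Holds]
  simp only [Nat.reduceEqDiff, if_false, if_true]
  rintro Δ hΔ A hA B hB c hc t ht κ hκ
  have ht' : t = halfTan ((ξ j - ξ i) / (h j - h i)) := by
    rw [ht, halfTan, pow_two, hc, hΔ, Rat.cast_one]
  constructor
  · rintro ⟨h1, h2⟩ x hx
    rw [← pow_two, hA, hB, ht'] at h2
    have hne : h j - h i ≠ 0 := by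
      rw [Rat.cast_zero, hΔ] at h1
      exact h1.elim ne_of_lt ne_of_gt
    rw [candidate, if_pos hne, envelope, if_pos h2, hx, hA, hB, ht']
    norm_num
  · intro hcond
    rw [hκ, hA, hB, candidate]
    by_cases hne : h j - h i ≠ 0
    · rw [if_pos hne, envelope, if_neg]
      intro h2
      refine hcond ⟨?_, ?_⟩
      · rw [Rat.cast_zero, hΔ]
        exact lt_or_gt_of_ne hne
      · rw [← pow_two, hA, hB, ht']
        exact h2
    · rw [if_neg hne]

/-- The number of candidates that are left in list `l`; its cells of the array 0 are those from
`natMem 3 l` to `natMem 4 l`. -/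
def listSize (s : State) (l : ℕ) : ℕ := s.natMem 4 l - s.natMem 3 l

/-- The candidate in cell `a` of list `l`. -/
noncomputable def listValue (r σ : ℝ) (ξ h : ℕ → ℝ) (s : State) (l a : ℕ) : ℝ :=
  candidate r σ ξ h (s.natMem 2 l) (s.natMem 0 a)

/-- Finds the middle candidate of list `l`, and adds the size of the list to register 5. -/
def midStep : Program :=
  .seq (.seq (.setNat 8 (.half (.add (.read 3 (.reg 1)) (.read 4 (.reg 1)))))
    (.seq (.setNat 9 (.read 2 (.reg 1))) (.setNat 10 (.read 0 (.reg 8)))))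
  (.seq candidateProgram
    (.seq (.writeNat 5 (.reg 1) (.reg 8))
    (.seq (.writeReal 10 (.reg 1) (.reg 25))
    (.seq (.writeReal 11 (.reg 1) (.reg 25))
      (.setNat 5 (.add (.reg 5) (.sub (.read 4 (.reg 1)) (.read 3 (.reg 1)))))))))

theorem runs_midLoop {n M : ℕ} {ξ h w : ℕ → ℝ} {r σ : ℝ} {s : State}
    (H : LineData n ξ h w r s) (h8 : s.realReg 8 = σ) (h4 : s.natReg 4 = M)
    (h5 : s.natReg 5 = 0) :
    Runs (forLoop 1 (.reg 4) midStep) s ((M + 1) * (130 + 1 + 6)) (fun s' =>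
      (∀ l < M, s'.natMem 5 l = (s.natMem 3 l + s.natMem 4 l) / 2 ∧
        s'.realMem 10 l = listValue r σ ξ h s l (s'.natMem 5 l) ∧
        s'.realMem 11 l = s'.realMem 10 l) ∧
      s'.natReg 5 = ∑ l ∈ Finset.range M, listSize s l) := by
  refine Runs.forLoop (N := .reg 4) M 130 (fun k s' =>
      (∀ l < k, s'.natMem 5 l = (s.natMem 3 l + s.natMem 4 l) / 2 ∧
        s'.realMem 10 l = listValue r σ ξ h s l (s'.natMem 5 l) ∧
        s'.realMem 11 l = s'.realMem 10 l) ∧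
      s'.natReg 5 = ∑ l ∈ Finset.range k, listSize s l) rfl
      (fun k s' x hI => ⟨hI.1, by simpa using hI.2⟩)
      (fun s' hF => (hF.natReg 4 rfl).trans h4) ⟨by simp, by simpa using h5⟩ ?_
  rintro k s' hk hF h1 ⟨hI, hT⟩
  have m0 : s'.natMem 0 = s.natMem 0 := hF.natMem 0 rfl
  have m2 : s'.natMem 2 = s.natMem 2 := hF.natMem 2 rfl
  have m3 : s'.natMem 3 = s.natMem 3 := hF.natMem 3 rfl
  have m4 : s'.natMem 4 = s.natMem 4 := hF.natMem 4 rfl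
  refine Runs.seq (T₁ := 20) (T₂ := 80 + 30) (R := fun s' =>
      s'.natReg 8 = (s.natMem 3 k + s.natMem 4 k) / 2 ∧
      s'.natReg 9 = s.natMem 2 k ∧
      s'.natReg 10 = s.natMem 0 ((s.natMem 3 k + s.natMem 4 k) / 2))
    (Runs.of_wp (by simp [Program.wp, NatExpr.eval, h1, m0, m2, m3, m4])
      rfl (by decide)) ?_
  rintro s₁ hF₁ ⟨g8, g9, g10⟩
  refine Runs.seq (runs_candidateProgram ((H.frame hF rfl).frame hF₁ rfl) g9 g10
    ((hF₁.realReg 8 rfl).trans ((hF.realReg 8 rfl).trans h8))) ?_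
  intro s₂ hF₂ h25
  refine Runs.of_wp ?_ rfl (by decide)
  have e1 : s₂.natReg 1 = k := ((hF₂.natReg 1 rfl).trans (hF₁.natReg 1 rfl)).trans h1
  have e5 : s₂.natReg 5 = s'.natReg 5 := (hF₂.natReg 5 rfl).trans (hF₁.natReg 5 rfl)
  have e8 : s₂.natReg 8 = (s.natMem 3 k + s.natMem 4 k) / 2 := (hF₂.natReg 8 rfl).trans g8
  have e3 : s₂.natMem 3 = s.natMem 3 :=
    ((hF₂.natMem 3 rfl).trans (hF₁.natMem 3 rfl)).trans m3
  have e4 : s₂.natMem 4 = s.natMem 4 :=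
    ((hF₂.natMem 4 rfl).trans (hF₁.natMem 4 rfl)).trans m4
  have f5 : s₂.natMem 5 = s'.natMem 5 := (hF₂.natMem 5 rfl).trans (hF₁.natMem 5 rfl)
  have f10 : s₂.realMem 10 = s'.realMem 10 := (hF₂.realMem 10 rfl).trans (hF₁.realMem 10 rfl)
  have f11 : s₂.realMem 11 = s'.realMem 11 := (hF₂.realMem 11 rfl).trans (hF₁.realMem 11 rfl)
  simp only [Program.wp, RealExpr.eval, NatExpr.eval, e1, e8, h25]
  rintro j₁ _ d₁ rfl j₂ _ d₂ rfl j₃ _ d₃ rfl x hx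
  simp only [Function.update_self, ne_eq, Nat.reduceEqDiff, not_false_eq_true,
    Function.update_of_ne, e3, e4, e5, f5, f10, f11, d₁, d₂, d₃] at hx ⊢
  refine ⟨fun l hl => ?_, ?_⟩
  · rcases Nat.lt_succ_iff_lt_or_eq.1 hl with hl | rfl
    · simpa only [Function.update_of_ne hl.ne] using hI l hl
    · simp [listValue]
  · rw [hx, hT, Finset.sum_range_succ, listSize]

/-- One step of the selection of the weighted median. -/
def medianStep : Program :=
  .seq (.setNat 8 (.read 20 (.reg 7)))
  (.seq (.setReal 9 (.read 10 (.reg 8)))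
  (.seq (.setNat 6 (.add (.reg 6) (.sub (.read 4 (.reg 8)) (.read 3 (.reg 8)))))
    (.setNat 7 (.add (.reg 7) (.const 1)))))

/-- Selects into register 9 the median of the middle candidates, weighted with the list sizes. -/
def medianProgram : Program :=
  .seq (.seq (.setNat 6 (.const 0)) (.setNat 7 (.const 0)))
    (.while (.natLt (.add (.reg 6) (.reg 6)) (.reg 5)) medianStep)

/-- At least half of the total size is in lists with middle candidate at most `s₀`, and at least half
in lists with middle candidate at least `s₀`. -/
def IsWeightedMedian (M : ℕ) (size : ℕ → ℕ) (key : ℕ → ℝ) (s₀ : ℝ) : Prop :=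
  open Classical in
  ∑ l ∈ Finset.range M, size l ≤ 2 * ∑ l ∈ Finset.range M with key l ≤ s₀, size l ∧
  ∑ l ∈ Finset.range M, size l ≤ 2 * ∑ l ∈ Finset.range M with s₀ ≤ key l, size l

theorem SortedPerm.isWeightedMedian {M p : ℕ} {size idx : ℕ → ℕ} {key : ℕ → ℝ}
    (H : SortedPerm key idx M) (hp : p < M)
    (h₁ : 2 * ∑ j ∈ Finset.range p, size (idx j) < ∑ l ∈ Finset.range M, size l)
    (h₂ : ∑ l ∈ Finset.range M, size l ≤ 2 * ∑ j ∈ Finset.range (p + 1), size (idx j)) :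
    IsWeightedMedian M size key (key (idx p)) := by
  classical
  constructor
  · refine h₂.trans (Nat.mul_le_mul_left _ ?_)
    rw [Finset.sum_filter, ← H.sum_comp fun l => if key l ≤ key (idx p) then size l else 0,
      ← Finset.sum_filter]
    refine Finset.sum_le_sum_of_subset fun j hj => ?_
    have hj := Finset.mem_range.1 hj
    exact Finset.mem_filter.2 ⟨Finset.mem_range.2 (by omega), H.mono j p (by omega) hp⟩
  · have hsplit : ∑ l ∈ Finset.range M, size l ≤ ∑ j ∈ Finset.range p, size (idx j) +
        ∑ l ∈ Finset.range M with key (idx p) ≤ key l, size l := by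
      rw [Finset.sum_filter, ← H.sum_comp fun l => if key (idx p) ≤ key l then size l else 0,
        ← Finset.sum_filter, ← H.sum_comp size]
      rw [← Finset.sum_filter_add_sum_filter_not (Finset.range M) (fun j => j < p)]
      refine add_le_add (Finset.sum_le_sum_of_subset fun j hj => ?_)
        (Finset.sum_le_sum_of_subset fun j hj => ?_)
      · exact Finset.mem_range.2 (Finset.mem_filter.1 hj).2
      · obtain ⟨hj, hjp⟩ := Finset.mem_filter.1 hj
        exact Finset.mem_filter.2 ⟨hj, H.mono p j (not_lt.1 hjp) (Finset.mem_range.1 hj)⟩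
    omega

theorem runs_medianProgram {M : ℕ} {s : State}
    (hsort : SortedPerm (s.realMem 10) (s.natMem 20) M)
    (h5 : s.natReg 5 = ∑ l ∈ Finset.range M, listSize s l) :
    Runs medianProgram s (40 * (M + 1)) (fun s' =>
      IsWeightedMedian M (listSize s) (s.realMem 10) (s'.realReg 9)) := by
  set idx := s.natMem 20 with hidx
  set key := s.realMem 10 with hkey
  have hmain : Runs medianProgram s (4 + (M * (25 + 5) + 5)) (fun s' =>
      IsWeightedMedian M (listSize s) key (s'.realReg 9)) := by
    refine Runs.seq (R := fun s' => s'.natReg 6 = 0 ∧ s'.natReg 7 = 0)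
      (Runs.of_wp (by simp [Program.wp, NatExpr.eval]) rfl (by decide)) fun s₁ hF₁ h₁ => ?_
    refine (Runs.while (T := 25) (fun s' => s'.natReg 7 ≤ M ∧
        s'.natReg 6 = ∑ j ∈ Finset.range (s'.natReg 7), listSize s (idx j) ∧
        (s'.natReg 7 ≠ 0 → s'.realReg 9 = key (idx (s'.natReg 7 - 1)) ∧
          2 * ∑ j ∈ Finset.range (s'.natReg 7 - 1), listSize s (idx j) <
            ∑ l ∈ Finset.range M, listSize s l)) (fun s' => M - s'.natReg 7) ?_ ?_).mono ?_ ?_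
    · simp [h₁]
    · rintro s' hF ⟨hle, hcum, -⟩ hb
      have g5 : s'.natReg 5 = ∑ l ∈ Finset.range M, listSize s l :=
        ((hF.natReg 5 rfl).trans (hF₁.natReg 5 rfl)).trans h5
      have g20 : s'.natMem 20 = idx := (hF.natMem 20 rfl).trans (hF₁.natMem 20 rfl)
      have g10 : s'.realMem 10 = key := (hF.realMem 10 rfl).trans (hF₁.realMem 10 rfl)
      have g3 : s'.natMem 3 = s.natMem 3 := (hF.natMem 3 rfl).trans (hF₁.natMem 3 rfl)
      have g4 : s'.natMem 4 = s.natMem 4 := (hF.natMem 4 rfl).trans (hF₁.natMem 4 rfl)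
      simp only [Test.Holds, NatExpr.eval, g5] at hb
      have hlt : s'.natReg 7 < M := by
        refine lt_of_le_of_ne hle fun he => ?_
        rw [he, hsort.sum_comp (listSize s)] at hcum
        omega
      refine Runs.of_wp ?_ rfl (by decide)
      simp only [medianStep, Program.wp, RealExpr.eval, NatExpr.eval, Function.update_apply, g20,
        g10, g3, g4]
      rintro l rfl y hy c hc k hk
      simp only [Nat.reduceEqDiff, if_false, if_true] at *
      subst hk
      refine ⟨⟨hlt, ?_, fun _ => ⟨hy, ?_⟩⟩, by omega⟩
      · rw [hc, hcum, Finset.sum_range_succ]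
        rfl
      · rw [Nat.add_sub_cancel]
        omega
    · simp [h₁, Test.cost, NatExpr.cost]
    · rintro s' hF ⟨⟨hle, hcum, hpos⟩, hb⟩
      have g5 : s'.natReg 5 = ∑ l ∈ Finset.range M, listSize s l :=
        ((hF.natReg 5 rfl).trans (hF₁.natReg 5 rfl)).trans h5
      simp only [Test.Holds, NatExpr.eval, g5, not_lt] at hb
      rcases Nat.eq_zero_or_pos (s'.natReg 7) with h0 | h0
      · rw [h0, Finset.sum_range_zero] at hcum
        rw [hcum] at hb
        exact ⟨by omega, by omega⟩
      · obtain ⟨he, hlt⟩ := hpos (by omega)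
        rw [he]
        refine hsort.isWeightedMedian (by omega) hlt ?_
        rw [Nat.sub_add_cancel h0, ← hcum]
        omega
  exact hmain.mono (by omega) fun _ _ => id

/-- What is known during the search: the lists have nondecreasing candidates, register 11 has the
weight loss at the best point found so far, which is in register 10, and all better candidates are
still in the lists. -/
structure SearchInv (n M : ℕ) (ξ h w : ℕ → ℝ) (r σ : ℝ) (s : State) : Prop where
  mono : ∀ l < M, ∀ a a', s.natMem 3 l ≤ a → a ≤ a' → a' < s.natMem 4 l →
    listValue r σ ξ h s l a ≤ listValue r σ ξ h s l a'
  best : s.realReg 11 = lineLoss n ξ h w r (s.realReg 10)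
  cover : ∀ i < n, ∀ j < n, lineLoss n ξ h w r (candidate r σ ξ h i j) < s.realReg 11 →
    ∃ l < M, ∃ a, s.natMem 3 l ≤ a ∧ a < s.natMem 4 l ∧
      listValue r σ ξ h s l a = candidate r σ ξ h i j

/-- Enters the evaluated point in register 9 as the best one if it is better. -/
def updateBest : Program :=
  .seq (.ite (.realLe (.reg 16) (.reg 17)) (.setReal 26 (.reg 17)) (.setReal 26 (.reg 16)))
    (.ite (.realLt (.reg 26) (.reg 11))
      (.seq (.setReal 10 (.reg 9)) (.setReal 11 (.reg 26)))
      .skip)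

theorem runs_updateBest {n : ℕ} {ξ h w : ℕ → ℝ} {r : ℝ} {s : State}
    (h17 : s.realReg 17 = depth n ξ h w r (s.realReg 9))
    (h16 : s.realReg 16 = depth n (-ξ) h w r (-(s.realReg 9)))
    (hbest : s.realReg 11 = lineLoss n ξ h w r (s.realReg 10)) :
    Runs updateBest s 20 (fun s' =>
      s'.realReg 11 = lineLoss n ξ h w r (s'.realReg 10) ∧ s'.realReg 11 ≤ s.realReg 11 ∧
      s'.realReg 11 ≤ lineLoss n ξ h w r (s.realReg 9)) := by
  refine Runs.of_wp ?_ rfl (by decide)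
  have key : ∀ x, x = lineLoss n ξ h w r (s.realReg 9) →
      Program.wp (.ite (.realLt (.reg 26) (.reg 11))
        (.seq (.setReal 10 (.reg 9)) (.setReal 11 (.reg 26))) .skip)
        (fun s' => s'.realReg 11 = lineLoss n ξ h w r (s'.realReg 10) ∧
          s'.realReg 11 ≤ s.realReg 11 ∧ s'.realReg 11 ≤ lineLoss n ξ h w r (s.realReg 9))
        { s with realReg := Function.update s.realReg 26 x } := by
    intro x hx
    simp only [Program.wp, RealExpr.eval, Function.update_apply, Test.Holds, Nat.reduceEqDiff,
      if_false, if_true]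
    refine ⟨fun hlt y hy z hz => ?_, fun hlt => ?_⟩
    · rw [hz, hy]
      exact ⟨hx, hlt.le, hx.le⟩
    · exact ⟨hbest, le_rfl, hx ▸ not_lt.1 hlt⟩
  refine ⟨fun hle x hx => key x ?_, fun hle x hx => key x ?_⟩
  · simp only [Test.Holds, RealExpr.eval] at hle hx
    rw [hx, lineLoss, ← h16, ← h17, max_eq_left hle]
  · simp only [Test.Holds, RealExpr.eval, not_le] at hle hx
    rw [hx, lineLoss, ← h16, ← h17, max_eq_right hle.le]

/-- Discards the candidates on the wrong side of the point in register 9, as far as the middle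
candidates show which these are. -/
def cutProgram : Program :=
  .ite (.realLe (.reg 16) (.reg 17))
    (forLoop 1 (.reg 4) (.ite (.realLe (.reg 9) (.read 11 (.reg 1)))
      (.writeNat 4 (.reg 1) (.read 5 (.reg 1))) .skip))
    (forLoop 1 (.reg 4) (.ite (.realLe (.read 11 (.reg 1)) (.reg 9))
      (.writeNat 3 (.reg 1) (.add (.read 5 (.reg 1)) (.const 1))) .skip))

open Classical in
theorem runs_cutProgram {M : ℕ} {s : State} (h4 : s.natReg 4 = M) :
    Runs cutProgram s (40 * (M + 1)) (fun s' =>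
      (s.realReg 16 ≤ s.realReg 17 ∧ s'.natMem 3 = s.natMem 3 ∧ ∀ l < M, s'.natMem 4 l =
        if s.realReg 9 ≤ s.realMem 11 l then s.natMem 5 l else s.natMem 4 l) ∨
      (s.realReg 17 ≤ s.realReg 16 ∧ s'.natMem 4 = s.natMem 4 ∧ ∀ l < M, s'.natMem 3 l =
        if s.realMem 11 l ≤ s.realReg 9 then s.natMem 5 l + 1 else s.natMem 3 l)) := by
  have hmain : Runs cutProgram s (3 + (M + 1) * (20 + 1 + 6)) (fun s' =>
      (s.realReg 16 ≤ s.realReg 17 ∧ s'.natMem 3 = s.natMem 3 ∧ ∀ l < M, s'.natMem 4 l =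
        if s.realReg 9 ≤ s.realMem 11 l then s.natMem 5 l else s.natMem 4 l) ∨
      (s.realReg 17 ≤ s.realReg 16 ∧ s'.natMem 4 = s.natMem 4 ∧ ∀ l < M, s'.natMem 3 l =
        if s.realMem 11 l ≤ s.realReg 9 then s.natMem 5 l + 1 else s.natMem 3 l)) := by
    refine Runs.ite (b := .realLe (.reg 16) (.reg 17)) (fun hb => ?_) (fun hb => ?_)
    · simp only [Test.Holds, RealExpr.eval] at hb
      refine (Runs.forLoop (N := .reg 4) M 20 (fun k s' => ∀ l < M, s'.natMem 4 l =
        if l < k ∧ s.realReg 9 ≤ s.realMem 11 l then s.natMem 5 l else s.natMem 4 l) rfl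
        (fun k s' x h => h) (fun s' hF => (hF.natReg 4 rfl).trans h4) (by simp) ?_).mono le_rfl ?_
      · intro k s' hk hF h1 hI
        have g9 : s'.realReg 9 = s.realReg 9 := hF.realReg 9 rfl
        have g11 : s'.realMem 11 = s.realMem 11 := hF.realMem 11 rfl
        have g5 : s'.natMem 5 = s.natMem 5 := hF.natMem 5 rfl
        refine Runs.of_wp ?_ rfl (by decide)
        simp only [Program.wp, Test.Holds, RealExpr.eval, NatExpr.eval, g9, g11, g5, h1]
        refine ⟨fun hc j _ hj e l hl => ?_, fun hc l hl => ?_⟩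
        · subst e
          simp only [Function.update_self, hj]
          by_cases hlk : l = k
          · subst hlk
            rw [Function.update_self, if_pos ⟨Nat.lt_succ_self l, hc⟩]
          · rw [Function.update_of_ne hlk, hI l hl]
            simp only [show l < k + 1 ↔ l < k by omega]
        · by_cases hlk : l = k
          · subst hlk
            rw [hI l hl, if_neg fun h => hc h.2, if_neg fun h => hc h.2]
          · rw [hI l hl]
            simp only [show l < k + 1 ↔ l < k by omega]
      · intro s' hF hI
        refine .inl ⟨hb, hF.natMem 3 rfl, fun l hl => ?_⟩
        simp only [hI l hl, hl, true_and]
    · simp only [Test.Holds, RealExpr.eval] at hb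
      refine (Runs.forLoop (N := .reg 4) M 20 (fun k s' => ∀ l < M, s'.natMem 3 l =
        if l < k ∧ s.realMem 11 l ≤ s.realReg 9 then s.natMem 5 l + 1 else s.natMem 3 l) rfl
        (fun k s' x h => h) (fun s' hF => (hF.natReg 4 rfl).trans h4) (by simp) ?_).mono le_rfl ?_
      · intro k s' hk hF h1 hI
        have g9 : s'.realReg 9 = s.realReg 9 := hF.realReg 9 rfl
        have g11 : s'.realMem 11 = s.realMem 11 := hF.realMem 11 rfl
        have g5 : s'.natMem 5 = s.natMem 5 := hF.natMem 5 rfl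
        refine Runs.of_wp ?_ rfl (by decide)
        simp only [Program.wp, Test.Holds, RealExpr.eval, NatExpr.eval, g9, g11, g5, h1]
        refine ⟨fun hc j _ hj e l hl => ?_, fun hc l hl => ?_⟩
        · subst e
          simp only [Function.update_self, hj]
          by_cases hlk : l = k
          · subst hlk
            rw [Function.update_self, if_pos ⟨Nat.lt_succ_self l, hc⟩]
          · rw [Function.update_of_ne hlk, hI l hl]
            simp only [show l < k + 1 ↔ l < k by omega]
        · by_cases hlk : l = k
          · subst hlk
            rw [hI l hl, if_neg fun h => hc h.2, if_neg fun h => hc h.2]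
          · rw [hI l hl]
            simp only [show l < k + 1 ↔ l < k by omega]
      · intro s' hF hI
        refine .inr ⟨(not_le.1 hb).le, hF.natMem 4 rfl, fun l hl => ?_⟩
        simp only [hI l hl, hl, true_and]
  exact hmain.mono (by omega) fun _ _ => id

/-- If the lists that contain half of the candidates are halved, the number of candidates drops to
three quarters. -/
theorem total_size_le {M : ℕ} {size size' : ℕ → ℕ} {P : ℕ → Prop} [DecidablePred P]
    (hhalf : ∑ l ∈ Finset.range M, size l ≤ 2 * ∑ l ∈ Finset.range M with P l, size l)
    (hcut : ∀ l < M, P l → 2 * size' l ≤ size l) (hkeep : ∀ l < M, ¬ P l → size' l = size l) :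
    4 * ∑ l ∈ Finset.range M, size' l ≤ 3 * ∑ l ∈ Finset.range M, size l := by
  rw [← Finset.sum_filter_add_sum_filter_not (Finset.range M) P size'] at *
  have h1 : 2 * ∑ l ∈ Finset.range M with P l, size' l ≤ ∑ l ∈ Finset.range M with P l, size l := by
    rw [Finset.mul_sum]
    refine Finset.sum_le_sum fun l hl => ?_
    obtain ⟨hl, hP⟩ := Finset.mem_filter.1 hl
    exact hcut l (Finset.mem_range.1 hl) hP
  have h2 : ∑ l ∈ Finset.range M with ¬ P l, size' l = ∑ l ∈ Finset.range M with ¬ P l, size l := by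
    refine Finset.sum_congr rfl fun l hl => ?_
    obtain ⟨hl, hP⟩ := Finset.mem_filter.1 hl
    exact hkeep l (Finset.mem_range.1 hl) hP
  have h3 := Finset.sum_filter_add_sum_filter_not (Finset.range M) P size
  omega

/-- One round of the search. -/
def searchRound : Program :=
  .seq (.setNat 5 (.const 0))
  (.seq (forLoop 1 (.reg 4) midStep)
  (.seq (.setNat 20 (.reg 4))
  (.seq sortProgram
  (.seq medianProgram
  (.seq lossProgram
  (.seq updateBest cutProgram))))))

theorem runs_searchRound {n M : ℕ} {ξ h w : ℕ → ℝ} {r σ : ℝ} {s : State}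
    (H : LineData n ξ h w r s) (hr : 0 ≤ r) (hw : ∀ i < n, 0 < w i)
    (h8 : s.realReg 8 = σ) (h4 : s.natReg 4 = M) (hM : M ≤ 4 * n)
    (hI : SearchInv n M ξ h w r σ s) :
    Runs searchRound s (4000 * ((n + 1) * (n.size + 3))) (fun s' =>
      SearchInv n M ξ h w r σ s' ∧ s'.realReg 11 ≤ s.realReg 11 ∧
      s'.natReg 5 = ∑ l ∈ Finset.range M, listSize s l ∧
      4 * ∑ l ∈ Finset.range M, listSize s' l ≤ 3 * ∑ l ∈ Finset.range M, listSize s l) := by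
  classical
  have hmain : Runs searchRound s (2 + ((M + 1) * (130 + 1 + 6) + (2 +
      (150 * ((M + 1) * (M.size + 1)) + (40 * (M + 1) + (2000 * ((n + 1) * (n.size + 2)) +
      (20 + 40 * (M + 1)))))))) (fun s' =>
      SearchInv n M ξ h w r σ s' ∧ s'.realReg 11 ≤ s.realReg 11 ∧
      s'.natReg 5 = ∑ l ∈ Finset.range M, listSize s l ∧
      4 * ∑ l ∈ Finset.range M, listSize s' l ≤ 3 * ∑ l ∈ Finset.range M, listSize s l) := by
    refine Runs.seq (R := fun s' => s'.natReg 5 = 0)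
      (Runs.of_wp (by simp [Program.wp, NatExpr.eval]) rfl (by decide)) fun s₁ hF₁ h₁ => ?_
    have H₁ := H.frame hF₁ rfl
    have hsz₁ : listSize s₁ = listSize s := by
      funext l; rw [listSize, listSize, hF₁.natMem 3 rfl, hF₁.natMem 4 rfl]
    refine Runs.seq (runs_midLoop H₁ ((hF₁.realReg 8 rfl).trans h8) ((hF₁.natReg 4 rfl).trans h4)
      h₁) ?_
    rintro s₂ hF₂ ⟨hmid, hT⟩
    have H₂ := H₁.frame hF₂ rfl
    have e₂ : s₂.natReg 4 = M := ((hF₂.natReg 4 rfl).trans (hF₁.natReg 4 rfl)).trans h4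
    refine Runs.seq (R := fun s' => s'.natReg 20 = M)
      (Runs.of_wp (by simp [Program.wp, NatExpr.eval, e₂]) rfl (by decide)) fun s₃ hF₃ h₃ => ?_
    have H₃ := H₂.frame hF₃ rfl
    refine Runs.seq (runs_sortProgram h₃) fun s₄ hF₄ h₄ => ?_
    have H₄ := H₃.frame hF₄ rfl
    have hsz₄ : listSize s₄ = listSize s := by
      funext l
      rw [listSize, listSize, hF₄.natMem 3 rfl, hF₄.natMem 4 rfl, hF₃.natMem 3 rfl,
        hF₃.natMem 4 rfl, hF₂.natMem 3 rfl, hF₂.natMem 4 rfl, hF₁.natMem 3 rfl, hF₁.natMem 4 rfl]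
    have k₄ : s₄.realMem 10 = s₂.realMem 10 := (hF₄.realMem 10 rfl).trans (hF₃.realMem 10 rfl)
    have h5₄ : s₄.natReg 5 = ∑ l ∈ Finset.range M, listSize s l := by
      rw [hF₄.natReg 5 rfl, hF₃.natReg 5 rfl, hT, hsz₁]
    refine Runs.seq (runs_medianProgram (s := s₄) (by rw [hF₄.realMem 10 rfl]; exact h₄)
      (by rw [h5₄, hsz₄])) fun s₅ hF₅ hmed => ?_
    have H₅ := H₄.frame hF₅ rfl
    refine Runs.seq (runs_lossProgram H₅ hr hw rfl) ?_
    rintro s₆ hF₆ ⟨h17, h16⟩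
    have H₆ := H₅.frame hF₆ rfl
    rw [← hF₆.realReg 9 rfl] at h17 h16
    have hb₆ : s₆.realReg 11 = s.realReg 11 ∧ s₆.realReg 10 = s.realReg 10 := by
      rw [hF₆.realReg 11 rfl, hF₆.realReg 10 rfl, hF₅.realReg 11 rfl, hF₅.realReg 10 rfl,
        hF₄.realReg 11 rfl, hF₄.realReg 10 rfl, hF₃.realReg 11 rfl, hF₃.realReg 10 rfl,
        hF₂.realReg 11 rfl, hF₂.realReg 10 rfl, hF₁.realReg 11 rfl, hF₁.realReg 10 rfl]
      exact ⟨rfl, rfl⟩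
    refine Runs.seq (runs_updateBest h17 h16 (by rw [hb₆.1, hb₆.2]; exact hI.best)) ?_
    rintro s₇ hF₇ ⟨hbest, hle₁, hle₂⟩
    rw [hb₆.1] at hle₁
    have r16 : s₇.realReg 16 = s₆.realReg 16 := hF₇.realReg 16 rfl
    have r17 : s₇.realReg 17 = s₆.realReg 17 := hF₇.realReg 17 rfl
    have r9 : s₇.realReg 9 = s₆.realReg 9 := hF₇.realReg 9 rfl
    have m3 : s₇.natMem 3 = s.natMem 3 := by
      rw [hF₇.natMem 3 rfl, hF₆.natMem 3 rfl, hF₅.natMem 3 rfl, hF₄.natMem 3 rfl,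
        hF₃.natMem 3 rfl, hF₂.natMem 3 rfl, hF₁.natMem 3 rfl]
    have m4 : s₇.natMem 4 = s.natMem 4 := by
      rw [hF₇.natMem 4 rfl, hF₆.natMem 4 rfl, hF₅.natMem 4 rfl, hF₄.natMem 4 rfl,
        hF₃.natMem 4 rfl, hF₂.natMem 4 rfl, hF₁.natMem 4 rfl]
    have m5 : ∀ l < M, s₇.natMem 5 l = (s.natMem 3 l + s.natMem 4 l) / 2 := by
      intro l hl
      rw [hF₇.natMem 5 rfl, hF₆.natMem 5 rfl, hF₅.natMem 5 rfl, hF₄.natMem 5 rfl,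
        hF₃.natMem 5 rfl, (hmid l hl).1, hF₁.natMem 3 rfl, hF₁.natMem 4 rfl]
    have hval₁ : ∀ l a, listValue r σ ξ h s₁ l a = listValue r σ ξ h s l a := by
      intro l a
      rw [listValue, listValue, hF₁.natMem 2 rfl, hF₁.natMem 0 rfl]
    have m11 : ∀ l < M, s₇.realMem 11 l =
        listValue r σ ξ h s l ((s.natMem 3 l + s.natMem 4 l) / 2) := by
      intro l hl
      rw [hF₇.realMem 11 rfl, hF₆.realMem 11 rfl, hF₅.realMem 11 rfl, hF₄.realMem 11 rfl,
        hF₃.realMem 11 rfl, (hmid l hl).2.2, (hmid l hl).2.1, (hmid l hl).1, hval₁,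
        hF₁.natMem 3 rfl, hF₁.natMem 4 rfl]
    have k10 : ∀ l < M, s₄.realMem 10 l = s₇.realMem 11 l := by
      intro l hl
      rw [k₄, ← (hmid l hl).2.2, hF₇.realMem 11 rfl, hF₆.realMem 11 rfl, hF₅.realMem 11 rfl,
        hF₄.realMem 11 rfl, hF₃.realMem 11 rfl]
    have hmed' : IsWeightedMedian M (listSize s) (s₇.realMem 11) (s₇.realReg 9) := by
      rw [hsz₄, ← hF₆.realReg 9 rfl, ← r9] at hmed
      obtain ⟨hm₁, hm₂⟩ := hmed
      refine ⟨?_, ?_⟩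
      · rwa [Finset.filter_congr fun l hl => by rw [k10 l (Finset.mem_range.1 hl)]] at hm₁
      · rwa [Finset.filter_congr fun l hl => by rw [k10 l (Finset.mem_range.1 hl)]] at hm₂
    have e₇ : s₇.natReg 4 = M := by
      rw [hF₇.natReg 4 rfl, hF₆.natReg 4 rfl, hF₅.natReg 4 rfl, hF₄.natReg 4 rfl,
        hF₃.natReg 4 rfl, e₂]
    refine (runs_cutProgram e₇).mono le_rfl fun s' hF hcut => ?_
    have hval : ∀ l a, listValue r σ ξ h s' l a = listValue r σ ξ h s l a := by
      intro l a
      rw [listValue, listValue, hF.natMem 2 rfl, hF₇.natMem 2 rfl, hF₆.natMem 2 rfl,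
        hF₅.natMem 2 rfl, hF₄.natMem 2 rfl, hF₃.natMem 2 rfl, hF₂.natMem 2 rfl, hF₁.natMem 2 rfl,
        hF.natMem 0 rfl, hF₇.natMem 0 rfl, hF₆.natMem 0 rfl,
        hF₅.natMem 0 rfl, hF₄.natMem 0 rfl, hF₃.natMem 0 rfl, hF₂.natMem 0 rfl, hF₁.natMem 0 rfl]
    have hb' : s'.realReg 11 = s₇.realReg 11 := hF.realReg 11 rfl
    have hT' : s'.natReg 5 = ∑ l ∈ Finset.range M, listSize s l := by
      rw [hF.natReg 5 rfl, hF₇.natReg 5 rfl, hF₆.natReg 5 rfl, hF₅.natReg 5 rfl, h5₄]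
    have hbest' : s'.realReg 11 = lineLoss n ξ h w r (s'.realReg 10) := by
      rw [hb', hF.realReg 10 rfl, hbest]
    rw [← r9] at hle₂ h17 h16
    rcases hcut with ⟨hdir, hLO, hHI⟩ | ⟨hdir, hHI, hLO⟩
    · rw [m3] at hLO
      have hloss : ∀ c, s₇.realReg 9 ≤ c → s'.realReg 11 ≤ lineLoss n ξ h w r c := fun c hc =>
        (hb' ▸ hle₂).trans (lineLoss_le_of_le hw (by rw [← h16, ← h17, ← r16, ← r17]; exact hdir)
          hc)
      refine ⟨⟨fun l hl a a' h1 h2 h3 => ?_, hbest', fun i hi j hj hlt => ?_⟩,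
        hb' ▸ hle₁, hT', ?_⟩
      · rw [hval, hval]
        rw [hLO] at h1
        rw [hHI l hl, m4, m5 l hl] at h3
        refine hI.mono l hl a a' h1 h2 ?_
        split_ifs at h3 <;> omega
      · obtain ⟨l, hl, a, h1, h2, h3⟩ := hI.cover i hi j hj (hlt.trans_le (hb' ▸ hle₁))
        refine ⟨l, hl, a, by rw [hLO]; exact h1, ?_, by rw [hval]; exact h3⟩
        rw [hHI l hl, m4, m5 l hl]
        split_ifs with hc
        · by_contra! hge
          have := hI.mono l hl _ a (by omega) hge h2
          rw [m11 l hl] at hc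
          exact absurd (hloss _ (hc.trans (this.trans h3.le))) (not_le.2 hlt)
        · exact h2
      · refine total_size_le hmed'.2 (fun l hl hP => ?_) fun l hl hP => ?_
        · rw [listSize, listSize, hLO, hHI l hl, if_pos hP, m5 l hl]
          omega
        · rw [listSize, listSize, hLO, hHI l hl, if_neg hP, m4]
    · rw [m4] at hHI
      have hloss : ∀ c, c ≤ s₇.realReg 9 → s'.realReg 11 ≤ lineLoss n ξ h w r c := fun c hc =>
        (hb' ▸ hle₂).trans (lineLoss_le_of_ge hw (by rw [← h16, ← h17, ← r16, ← r17]; exact hdir)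
          hc)
      refine ⟨⟨fun l hl a a' h1 h2 h3 => ?_, hbest', fun i hi j hj hlt => ?_⟩,
        hb' ▸ hle₁, hT', ?_⟩
      · rw [hval, hval]
        rw [hHI] at h3
        rw [hLO l hl, m3, m5 l hl] at h1
        refine hI.mono l hl a a' ?_ h2 h3
        split_ifs at h1 <;> omega
      · obtain ⟨l, hl, a, h1, h2, h3⟩ := hI.cover i hi j hj (hlt.trans_le (hb' ▸ hle₁))
        refine ⟨l, hl, a, ?_, by rw [hHI]; exact h2, by rw [hval]; exact h3⟩
        rw [hLO l hl, m3, m5 l hl]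
        split_ifs with hc
        · by_contra! hge
          have := hI.mono l hl a ((s.natMem 3 l + s.natMem 4 l) / 2) h1 (by omega) (by omega)
          rw [m11 l hl] at hc
          exact absurd (hloss _ (h3.ge.trans (this.trans hc))) (not_le.2 hlt)
        · exact h1
      · refine total_size_le hmed'.1 (fun l hl hP => ?_) fun l hl hP => ?_
        · rw [listSize, listSize, hHI, hLO l hl, if_pos hP, m5 l hl]
          omega
        · rw [listSize, listSize, hHI, hLO l hl, if_neg hP, m3]
  refine hmain.mono ?_ fun _ _ => id
  have hsize : M.size ≤ n.size + 2 := by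
    rw [Nat.size_le, pow_add]
    have := Nat.lt_size_self n
    omega
  have h1 : (M + 1) * (M.size + 1) ≤ (4 * (n + 1)) * (n.size + 3) :=
    Nat.mul_le_mul (by omega) (by omega)
  have h2 : (4 * (n + 1)) * (n.size + 3) = 4 * ((n + 1) * (n.size + 3)) := by ring
  have h3 : (n + 1) * (n.size + 3) = (n + 1) * (n.size + 2) + (n + 1) := by ring
  have h4 : (n + 1) * (n.size + 3) = (n + 1) * n.size + 3 * (n + 1) := by ring
  generalize (n + 1) * (n.size + 3) = x at *
  generalize (n + 1) * (n.size + 2) = y at *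
  generalize (M + 1) * (M.size + 1) = z at *
  generalize (n + 1) * n.size = u at *
  omega

/-- Searches the lists for the best candidate, with the sign in register 8. -/
def searchProgram : Program :=
  .seq (.setNat 5 (.const 1)) (.while (.natLt (.const 0) (.reg 5)) searchRound)

/-- The number of rounds is logarithmic, as the cube of the number of candidates is halved. -/
theorem size_cube_lt {x y : ℕ} (hy : 0 < y) (h : 4 * x ≤ 3 * y) : (x ^ 3).size < (y ^ 3).size := by
  rcases Nat.eq_zero_or_pos x with rfl | hx
  · exact Nat.size_pos.2 (by positivity) |>.trans_le' (by simp)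
  · have h1 : 2 * x ^ 3 ≤ y ^ 3 := by
      have := Nat.pow_le_pow_left h 3
      rw [mul_pow, mul_pow] at this
      omega
    have h2 : (2 * x ^ 3).size = (x ^ 3).size + 1 := by
      have := Nat.size_shiftLeft (m := x ^ 3) (by positivity) 1
      rwa [Nat.shiftLeft_eq, pow_one, mul_comm] at this
    have := Nat.size_le_size h1
    omega

theorem runs_searchProgram {n M : ℕ} {ξ h w : ℕ → ℝ} {r σ : ℝ} {s : State}
    (H : LineData n ξ h w r s) (hr : 0 ≤ r) (hw : ∀ i < n, 0 < w i)
    (h8 : s.realReg 8 = σ) (h4 : s.natReg 4 = M) (hM : M ≤ 4 * n)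
    (hI : SearchInv n M ξ h w r σ s) (hsz : ∑ l ∈ Finset.range M, listSize s l ≤ 4 * n ^ 2) :
    Runs searchProgram s (5000 * ((6 * n.size + 8) * ((n + 1) * (n.size + 3)))) (fun s' =>
      s'.realReg 11 = lineLoss n ξ h w r (s'.realReg 10) ∧ s'.realReg 11 ≤ s.realReg 11 ∧
      ∀ i < n, ∀ j < n, s'.realReg 11 ≤ lineLoss n ξ h w r (candidate r σ ξ h i j)) := by
  have hmain : Runs searchProgram s (2 + ((6 * n.size + 7) *
      (4000 * ((n + 1) * (n.size + 3)) + 3) + 3)) (fun s' =>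
      s'.realReg 11 = lineLoss n ξ h w r (s'.realReg 10) ∧ s'.realReg 11 ≤ s.realReg 11 ∧
      ∀ i < n, ∀ j < n, s'.realReg 11 ≤ lineLoss n ξ h w r (candidate r σ ξ h i j)) := by
    refine Runs.seq (R := fun s' => s'.natReg 5 = 1)
      (Runs.of_wp (by simp [Program.wp, NatExpr.eval]) rfl (by decide)) fun s₁ hF₁ h₁ => ?_
    have H₁ := H.frame hF₁ rfl
    have hsz₁ : listSize s₁ = listSize s := by
      funext l; rw [listSize, listSize, hF₁.natMem 3 rfl, hF₁.natMem 4 rfl]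
    have hI₁ : SearchInv n M ξ h w r σ s₁ := by
      obtain ⟨h1, h2, h3⟩ := hI
      have hv : ∀ l a, listValue r σ ξ h s₁ l a = listValue r σ ξ h s l a := by
        intro l a
        rw [listValue, listValue, hF₁.natMem 2 rfl, hF₁.natMem 0 rfl]
      refine ⟨?_, ?_, ?_⟩
      · simpa only [hv, hF₁.natMem 3 rfl, hF₁.natMem 4 rfl] using h1
      · simpa only [hF₁.realReg 11 rfl, hF₁.realReg 10 rfl] using h2
      · simpa only [hv, hF₁.natMem 3 rfl, hF₁.natMem 4 rfl, hF₁.realReg 11 rfl] using h3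
    refine (Runs.while (T := 4000 * ((n + 1) * (n.size + 3))) (fun s' =>
      SearchInv n M ξ h w r σ s' ∧ s'.realReg 11 ≤ s.realReg 11 ∧
        (s'.natReg 5 = 0 → ∑ l ∈ Finset.range M, listSize s' l = 0))
      (fun s' => if s'.natReg 5 = 0 then 0 else
        1 + ((∑ l ∈ Finset.range M, listSize s' l) ^ 3).size) ?_ ?_).mono ?_ ?_
    · exact ⟨hI₁, (hF₁.realReg 11 rfl).le, by simp [h₁]⟩
    · rintro s' hF ⟨hI', hle, -⟩ hb
      simp only [Test.Holds, NatExpr.eval] at hb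
      refine (runs_searchRound (H₁.frame hF rfl) hr hw
        ((hF.realReg 8 rfl).trans ((hF₁.realReg 8 rfl).trans h8))
        ((hF.natReg 4 rfl).trans ((hF₁.natReg 4 rfl).trans h4)) hM hI').mono le_rfl ?_
      rintro s'' - ⟨hI'', hle', hT, hdrop⟩
      refine ⟨⟨hI'', hle'.trans hle, fun h0 => by omega⟩, ?_⟩
      rw [if_neg hb.ne']
      split_ifs with h0
      · omega
      · have := size_cube_lt (by omega) hdrop
        omega
    · rw [h₁, if_neg one_ne_zero, hsz₁]
      have h1 : ((∑ l ∈ Finset.range M, listSize s l) ^ 3).size ≤ 6 * n.size + 6 := by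
        rw [Nat.size_le]
        refine (Nat.pow_le_pow_left hsz 3).trans_lt ?_
        have h2 : n < 2 ^ n.size := Nat.lt_size_self n
        calc (4 * n ^ 2) ^ 3 = 2 ^ 6 * n ^ 6 := by ring
          _ < 2 ^ 6 * (2 ^ n.size) ^ 6 := by gcongr
          _ = 2 ^ (6 * n.size + 6) := by rw [← pow_mul]; ring
      simp only [Test.cost, NatExpr.cost]
      exact Nat.add_le_add_right (Nat.mul_le_mul_right _ (by omega)) _
    · rintro s' hF ⟨⟨hI', hle, h0⟩, hb⟩
      simp only [Test.Holds, NatExpr.eval, not_lt, Nat.le_zero] at hb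
      refine ⟨hI'.best, hle, fun i hi j hj => ?_⟩
      by_contra! hlt
      obtain ⟨l, hl, a, h1, h2, -⟩ := hI'.cover i hi j hj hlt
      have := Finset.sum_eq_zero_iff.1 (h0 hb) l (Finset.mem_range.2 hl)
      rw [listSize] at this
      omega
  refine hmain.mono ?_ fun _ _ => id
  have hx : 1 ≤ (n + 1) * (n.size + 3) := Nat.succ_le_of_lt (by positivity)
  generalize (n + 1) * (n.size + 3) = x at *
  generalize n.size = z at *
  have h1 : 5000 * ((6 * z + 8) * x) = (6 * z + 7) * (4000 * x + 3) +
      (6000 * (z * x) + 12000 * x - (18 * z + 21)) := by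
    have h2 : 5000 * ((6 * z + 8) * x) + (18 * z + 21) = (6 * z + 7) * (4000 * x + 3) +
      (6000 * (z * x) + 12000 * x) := by ring
    have h3 : z ≤ z * x := Nat.le_mul_of_pos_right _ hx
    omega
  have h3 : z ≤ z * x := Nat.le_mul_of_pos_right _ hx
  omega

end RealRAM

/-! ### The customers in the order of the slopes -/

namespace RealRAM

/-- The slope of the line through the points `i` and `j`. -/
noncomputable def secantSlope (x y : ℕ → ℝ) (i j : ℕ) : ℝ := (y j - y i) / (x j - x i)

/-- The array `row` consists of `n` rows of length `n`; row `i` contains the other customers in the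
order of the slopes of their connections with `i`, and then `i` itself. -/
structure SlopeOrder (n : ℕ) (x y : ℕ → ℝ) (row : ℕ → ℕ) : Prop where
  self : ∀ i < n, row (i * n + (n - 1)) = i
  lt : ∀ i < n, ∀ k < n - 1, row (i * n + k) < n
  ne : ∀ i < n, ∀ k < n - 1, row (i * n + k) ≠ i
  slope_lt : ∀ i < n, ∀ k k', k < k' → k' < n - 1 →
    secantSlope x y i (row (i * n + k)) < secantSlope x y i (row (i * n + k'))
  exists_eq : ∀ i < n, ∀ j < n, j ≠ i → ∃ k < n - 1, row (i * n + k) = j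

/-- On either side of the slope of the query line, the candidates of a customer are sorted by the
slopes. -/
theorem candidate_le_candidate {n i j j' : ℕ} {x y ξ h : ℕ → ℝ} {a b c ℓ r σ : ℝ} (hr : 0 ≤ r)
    (hσ : σ = 1 ∨ σ = -1) (hℓ : 0 < ℓ) (hξ : ∀ i < n, ξ i = (b * x i - a * y i) / ℓ)
    (hh : ∀ i < n, h i = (a * x i + b * y i - c) / ℓ) (hi : i < n) (hj : j < n) (hj' : j' < n)
    (hx : x j ≠ x i) (hx' : x j' ≠ x i) (hm : secantSlope x y i j ≤ secantSlope x y i j')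
    (hpos : 0 < (a + b * secantSlope x y i j) * (a + b * secantSlope x y i j')) :
    candidate r σ ξ h i j ≤ candidate r σ ξ h i j' := by
  have hΔ : ∀ j < n, x j ≠ x i → h j - h i = (x j - x i) / ℓ * (a + b * secantSlope x y i j) ∧
      ξ j - ξ i = (x j - x i) / ℓ * (b - a * secantSlope x y i j) := by
    intro j hj hx
    have := sub_ne_zero.2 hx
    have := hℓ.ne'
    rw [hξ i hi, hξ j hj, hh i hi, hh j hj, secantSlope]
    constructor <;> field_simp <;> ring
  have hq : ∀ j < n, x j ≠ x i → a + b * secantSlope x y i j ≠ 0 → h j - h i ≠ 0 ∧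
      (ξ j - ξ i) / (h j - h i) =
        (b - a * secantSlope x y i j) / (a + b * secantSlope x y i j) := by
    intro j hj hx hne
    have h0 : (x j - x i) / ℓ ≠ 0 := div_ne_zero (sub_ne_zero.2 hx) hℓ.ne'
    rw [(hΔ j hj hx).1, (hΔ j hj hx).2, mul_div_mul_left _ _ h0]
    exact ⟨mul_ne_zero h0 hne, rfl⟩
  obtain ⟨h1, h2⟩ := hq j hj hx (left_ne_zero_of_mul hpos.ne')
  obtain ⟨h3, h4⟩ := hq j' hj' hx' (right_ne_zero_of_mul hpos.ne')
  rw [candidate, if_pos h1, candidate, if_pos h3, h2, h4]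
  exact envelope_mono hr hσ (halfTan_pos _) (halfTan_anti (cot_anti hm hpos))

/-! ### Building the lists of candidates -/

/-- Finds by bisection the first customer of a row whose slope is on the upper side of the query
line. The row of the customer in register 1 begins at register 3; the position in the row is returned
in register 8. -/
def splitProgram : Program :=
  .seq (.seq (.setNat 8 (.const 0)) (.setNat 9 (.sub (.reg 0) (.const 1))))
    (.while (.natLt (.reg 8) (.reg 9))
      (.seq (.setNat 10 (.half (.add (.reg 8) (.reg 9))))
      (.seq (.setNat 7 (.read 0 (.add (.reg 3) (.reg 10))))
      (.seq (.setReal 30 (.div (.sub (.read 1 (.reg 7)) (.read 1 (.reg 1)))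
          (.sub (.read 0 (.reg 7)) (.read 0 (.reg 1)))))
        (.ite (.realLe (.const 0) (.add (.reg 1) (.mul (.reg 2) (.reg 30))))
          (.setNat 9 (.reg 10)) (.setNat 8 (.add (.reg 10) (.const 1))))))))

theorem size_lt_size_of_le_half {x y : ℕ} (hy : 0 < y) (h : x ≤ y / 2) : x.size < y.size := by
  have h1 := Nat.size_pos.2 hy
  obtain ⟨t, ht⟩ := Nat.exists_eq_add_of_lt h1
  have h2 := Nat.lt_size_self y
  rw [ht, zero_add, Nat.lt_succ_iff, Nat.size_le]
  rw [ht, zero_add, pow_succ] at h2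
  omega

theorem runs_splitProgram {n i : ℕ} {P : ℕ → Prop} {s : State} (h0 : s.natReg 0 = n)
    (h1 : s.natReg 1 = i)
    (hP : ∀ k < n - 1, P k ↔ 0 ≤ s.realReg 1 + s.realReg 2 *
      secantSlope (s.realMem 0) (s.realMem 1) i (s.natMem 0 (s.natReg 3 + k)))
    (hmono : ∀ k k', k ≤ k' → k' < n - 1 → P k → P k') :
    Runs splitProgram s (60 * (n.size + 1)) (fun s' => s'.natReg 8 ≤ n - 1 ∧
      (∀ k < s'.natReg 8, ¬ P k) ∧ ∀ k, s'.natReg 8 ≤ k → k < n - 1 → P k) := by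
  have hmain : Runs splitProgram s (6 + (n.size * (50 + 3) + 3)) (fun s' => s'.natReg 8 ≤ n - 1 ∧
      (∀ k < s'.natReg 8, ¬ P k) ∧ ∀ k, s'.natReg 8 ≤ k → k < n - 1 → P k) := by
    refine Runs.seq (R := fun s' => s'.natReg 8 = 0 ∧ s'.natReg 9 = n - 1)
      (Runs.of_wp (by simp [Program.wp, NatExpr.eval, h0]) rfl (by decide)) fun s₁ hF₁ h₁ => ?_
    refine (Runs.while (T := 50) (fun s' => s'.natReg 8 ≤ s'.natReg 9 ∧ s'.natReg 9 ≤ n - 1 ∧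
        (∀ k < s'.natReg 8, ¬ P k) ∧ ∀ k, s'.natReg 9 ≤ k → k < n - 1 → P k)
        (fun s' => (s'.natReg 9 - s'.natReg 8).size) ?_ ?_).mono ?_ ?_
    · rw [h₁.1, h₁.2]
      exact ⟨by omega, le_rfl, by simp, fun k h h' => by omega⟩
    · rintro s' hF ⟨hle, hle', hlo, hhi⟩ hb
      simp only [Test.Holds, NatExpr.eval] at hb
      have g1 : s'.natReg 1 = i := ((hF.natReg 1 rfl).trans (hF₁.natReg 1 rfl)).trans h1
      have g3 : s'.natReg 3 = s.natReg 3 := (hF.natReg 3 rfl).trans (hF₁.natReg 3 rfl)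
      have m0 : s'.natMem 0 = s.natMem 0 := (hF.natMem 0 rfl).trans (hF₁.natMem 0 rfl)
      have r0 : s'.realMem 0 = s.realMem 0 := (hF.realMem 0 rfl).trans (hF₁.realMem 0 rfl)
      have r1 : s'.realMem 1 = s.realMem 1 := (hF.realMem 1 rfl).trans (hF₁.realMem 1 rfl)
      have e1 : s'.realReg 1 = s.realReg 1 := (hF.realReg 1 rfl).trans (hF₁.realReg 1 rfl)
      have e2 : s'.realReg 2 = s.realReg 2 := (hF.realReg 2 rfl).trans (hF₁.realReg 2 rfl)
      refine Runs.of_wp ?_ rfl (by decide)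
      simp only [Program.wp, RealExpr.eval, NatExpr.eval, Function.update_apply, Test.Holds, g1, g3,
        m0, r0, r1, e1, e2, Rat.cast_zero]
      simp only [Nat.reduceEqDiff, if_false, if_true]
      rintro m hm j hj z hz
      have hmP := hP m (by omega)
      rw [secantSlope, ← hj, ← hz] at hmP
      constructor
      · rintro hc m' hm'
        rw [hm']
        refine ⟨⟨by omega, by omega, hlo, fun k hk hk' => ?_⟩,
          size_lt_size_of_le_half (by omega) (by omega)⟩
        exact hmono m k hk hk' (hmP.2 hc)
      · rintro hc m' hm'
        rw [hm']
        refine ⟨⟨by omega, hle', fun k hk hPk => hc (hmP.1 ?_), hhi⟩,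
          size_lt_size_of_le_half (by omega) (by omega)⟩
        exact hmono k m (by omega) (by omega) hPk
    · rw [h₁.1, h₁.2]
      simp only [Test.cost, NatExpr.cost]
      exact Nat.add_le_add_right (Nat.mul_le_mul_right _ (Nat.size_le_size (by omega))) _
    · rintro s' hF ⟨⟨hle, hle', hlo, hhi⟩, hb⟩
      simp only [Test.Holds, NatExpr.eval, not_lt] at hb
      have he : s'.natReg 8 = s'.natReg 9 := by omega
      exact ⟨by omega, hlo, he ▸ hhi⟩
  exact hmain.mono (by omega) fun _ _ => id

/-- The beginning of the `q`-th list of a row of length `n` that is split at `c`. -/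
def partStart (n c : ℕ) : ℕ → ℕ
  | 0 => 0
  | 1 => c
  | 2 => c + 1
  | _ => n - 1

/-- The end of the `q`-th list of a row of length `n` that is split at `c`. -/
def partEnd (n c : ℕ) : ℕ → ℕ
  | 0 => c
  | 1 => c + 1
  | 2 => n - 1
  | _ => n

/-- The lists `4 i`, …, `4 i + 3` are the parts of row `i`, which is split at the first customer with
the property `P`. This customer and customer `i` form lists of their own. -/
def RowSplit (n : ℕ) (P : ℕ → ℕ → Prop) (s : State) (i : ℕ) : Prop :=
  ∃ c ≤ n - 1, (∀ k < c, ¬ P i k) ∧ (∀ k, c ≤ k → k < n - 1 → P i k) ∧ ∀ q < 4,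
    s.natMem 2 (4 * i + q) = i ∧ s.natMem 3 (4 * i + q) = i * n + partStart n c q ∧
      s.natMem 4 (4 * i + q) = i * n + partEnd n c q

/-- Enters the list number `q` of the customer in register 1, with bounds in the registers `e`
and `e'`. -/
def storeList (q e e' : ℕ) : Program :=
  .seq (.writeNat 2 (.add (.reg 6) (.const q)) (.reg 1))
  (.seq (.writeNat 3 (.add (.reg 6) (.const q)) (.reg e))
    (.writeNat 4 (.add (.reg 6) (.const q)) (.reg e')))

theorem runs_storeList (q e e' : ℕ) (s : State) :
    Runs (storeList q e e') s 15 (fun s' =>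
      s'.natMem 2 = Function.update (s.natMem 2) (s.natReg 6 + q) (s.natReg 1) ∧
      s'.natMem 3 = Function.update (s.natMem 3) (s.natReg 6 + q) (s.natReg e) ∧
      s'.natMem 4 = Function.update (s.natMem 4) (s.natReg 6 + q) (s.natReg e')) := by
  refine Runs.of_wp ?_ rfl le_rfl
  simp only [storeList, Program.wp, NatExpr.eval]
  rintro _ _ rfl rfl _ _ rfl rfl _ _ rfl rfl
  simp

/-- Builds the four lists of the customer in register 1. -/
def rowProgram : Program :=
  .seq splitProgram
  (.seq (.seq (.setNat 10 (.reg 3))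
    (.seq (.setNat 11 (.add (.reg 3) (.reg 8)))
    (.seq (.setNat 12 (.add (.add (.reg 3) (.reg 8)) (.const 1)))
    (.seq (.setNat 13 (.sub (.add (.reg 3) (.reg 0)) (.const 1)))
    (.setNat 14 (.add (.reg 3) (.reg 0)))))))
  (.seq (storeList 0 10 11)
  (.seq (storeList 1 11 12)
  (.seq (storeList 2 12 13)
  (.seq (storeList 3 13 14)
    (.seq (.setNat 3 (.reg 14)) (.setNat 6 (.add (.reg 6) (.const 4)))))))))

/-- Builds all lists. -/
def listProgram : Program :=
  .seq (.seq (.setNat 3 (.const 0)) (.setNat 6 (.const 0))) (forLoop 1 (.reg 0) rowProgram)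

theorem runs_listProgram {n : ℕ} {P : ℕ → ℕ → Prop} {s : State} (h0 : s.natReg 0 = n)
    (hn : 1 ≤ n)
    (hP : ∀ i < n, ∀ k < n - 1, P i k ↔ 0 ≤ s.realReg 1 + s.realReg 2 *
      secantSlope (s.realMem 0) (s.realMem 1) i (s.natMem 0 (i * n + k)))
    (hmono : ∀ i < n, ∀ k k', k ≤ k' → k' < n - 1 → P i k → P i k') :
    Runs listProgram s (200 * ((n + 1) * (n.size + 2))) (fun s' =>
      ∀ i < n, RowSplit n P s' i) := by
  have hmain : Runs listProgram s (4 + (n + 1) * ((60 * (n.size + 1) + (30 + (15 + (15 + (15 +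
      (15 + 6)))))) + 1 + 6)) (fun s' => ∀ i < n, RowSplit n P s' i) := by
    refine Runs.seq (R := fun s' => s'.natReg 3 = 0 ∧ s'.natReg 6 = 0)
      (Runs.of_wp (by simp [Program.wp, NatExpr.eval]) rfl (by decide)) fun s₁ hF₁ h₁ => ?_
    refine (Runs.forLoop (N := .reg 0) n _ (fun k s' => s'.natReg 3 = k * n ∧
      s'.natReg 6 = 4 * k ∧ ∀ i < k, RowSplit n P s' i) rfl
      (fun k s' x hI => by simpa [RowSplit] using hI)
      (fun s' hF => ((hF.natReg 0 rfl).trans (hF₁.natReg 0 rfl)).trans h0) (by simp [h₁])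
      ?_).mono le_rfl fun s' hF h => h.2.2
    rintro k s₂ hk hF₂ g1 ⟨g3, g6, hI⟩
    have g0 : s₂.natReg 0 = n := ((hF₂.natReg 0 rfl).trans (hF₁.natReg 0 rfl)).trans h0
    refine Runs.seq (runs_splitProgram (P := P k) g0 g1 (fun l hl => ?_) (hmono k hk)) ?_
    · rw [hP k hk l hl, g3, hF₂.natMem 0 rfl, hF₂.realMem 0 rfl, hF₂.realMem 1 rfl,
        hF₂.realReg 1 rfl, hF₂.realReg 2 rfl, hF₁.natMem 0 rfl, hF₁.realMem 0 rfl,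
        hF₁.realMem 1 rfl, hF₁.realReg 1 rfl, hF₁.realReg 2 rfl]
    rintro s₃ hF₃ ⟨hc, hlo, hhi⟩
    set c := s₃.natReg 8 with hc8
    have e3 : s₃.natReg 3 = k * n := (hF₃.natReg 3 rfl).trans g3
    have e0 : s₃.natReg 0 = n := (hF₃.natReg 0 rfl).trans g0
    refine Runs.seq (T₁ := 30) (T₂ := 15 + (15 + (15 + (15 + 6)))) (R := fun s' => s'.natReg 10 = k * n ∧ s'.natReg 11 = k * n + c ∧
        s'.natReg 12 = k * n + (c + 1) ∧ s'.natReg 13 = k * n + (n - 1) ∧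
        s'.natReg 14 = k * n + n) ?_ ?_
    · refine Runs.of_wp ?_ rfl (by decide)
      simp only [Program.wp, NatExpr.eval, Function.update_apply, e3, e0, ← hc8]
      simp only [Nat.reduceEqDiff, if_false, if_true]
      rintro _ rfl _ rfl _ rfl _ rfl _ rfl
      exact ⟨rfl, rfl, by omega, by omega, rfl⟩
    rintro s₄ hF₄ ⟨a10, a11, a12, a13, a14⟩
    refine Runs.seq (T₂ := 15 + (15 + (15 + 6))) (runs_storeList 0 10 11 s₄) ?_
    rintro s₅ hF₅ ⟨b2, b3, b4⟩
    refine Runs.seq (T₂ := 15 + (15 + 6)) (runs_storeList 1 11 12 s₅) ?_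
    rintro s₆ hF₆ ⟨c2, c3, c4⟩
    refine Runs.seq (T₂ := 15 + 6) (runs_storeList 2 12 13 s₆) ?_
    rintro s₇ hF₇ ⟨d2, d3, d4⟩
    refine Runs.seq (T₂ := 6) (runs_storeList 3 13 14 s₇) ?_
    rintro s₈ hF₈ ⟨f2, f3, f4⟩
    have k6 : s₄.natReg 6 = 4 * k := by rw [hF₄.natReg 6 rfl, hF₃.natReg 6 rfl, g6]
    have k1 : s₄.natReg 1 = k := by rw [hF₄.natReg 1 rfl, hF₃.natReg 1 rfl, g1]
    have n2 : s₄.natMem 2 = s₂.natMem 2 := by rw [hF₄.natMem 2 rfl, hF₃.natMem 2 rfl]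
    have n3 : s₄.natMem 3 = s₂.natMem 3 := by rw [hF₄.natMem 3 rfl, hF₃.natMem 3 rfl]
    have n4 : s₄.natMem 4 = s₂.natMem 4 := by rw [hF₄.natMem 4 rfl, hF₃.natMem 4 rfl]
    rw [k6, k1] at b2
    rw [k6, a10] at b3
    rw [k6, a11] at b4
    rw [hF₅.natReg 6 rfl, k6, hF₅.natReg 1 rfl, k1, b2] at c2
    rw [hF₅.natReg 6 rfl, k6, hF₅.natReg 11 rfl, a11, b3] at c3
    rw [hF₅.natReg 6 rfl, k6, hF₅.natReg 12 rfl, a12, b4] at c4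
    rw [hF₆.natReg 6 rfl, hF₅.natReg 6 rfl, k6, hF₆.natReg 1 rfl, hF₅.natReg 1 rfl, k1, c2] at d2
    rw [hF₆.natReg 6 rfl, hF₅.natReg 6 rfl, k6, hF₆.natReg 12 rfl, hF₅.natReg 12 rfl, a12, c3] at d3
    rw [hF₆.natReg 6 rfl, hF₅.natReg 6 rfl, k6, hF₆.natReg 13 rfl, hF₅.natReg 13 rfl, a13, c4] at d4
    rw [hF₇.natReg 6 rfl, hF₆.natReg 6 rfl, hF₅.natReg 6 rfl, k6, hF₇.natReg 1 rfl,
      hF₆.natReg 1 rfl, hF₅.natReg 1 rfl, k1, d2] at f2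
    rw [hF₇.natReg 6 rfl, hF₆.natReg 6 rfl, hF₅.natReg 6 rfl, k6, hF₇.natReg 13 rfl,
      hF₆.natReg 13 rfl, hF₅.natReg 13 rfl, a13, d3] at f3
    rw [hF₇.natReg 6 rfl, hF₆.natReg 6 rfl, hF₅.natReg 6 rfl, k6, hF₇.natReg 14 rfl,
      hF₆.natReg 14 rfl, hF₅.natReg 14 rfl, a14, d4] at f4
    have r6 : s₈.natReg 6 = 4 * k := by
      rw [hF₈.natReg 6 rfl, hF₇.natReg 6 rfl, hF₆.natReg 6 rfl, hF₅.natReg 6 rfl, k6]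
    have r14 : s₈.natReg 14 = k * n + n := by
      rw [hF₈.natReg 14 rfl, hF₇.natReg 14 rfl, hF₆.natReg 14 rfl, hF₅.natReg 14 rfl, a14]
    refine Runs.of_wp ?_ rfl (by decide)
    simp only [Program.wp, NatExpr.eval, Function.update_apply]
    simp only [Nat.reduceEqDiff, if_false, if_true, r6, r14]
    rintro _ rfl _ rfl
    refine ⟨by ring, by ring, fun i hi => ?_⟩
    rcases Nat.lt_succ_iff_lt_or_eq.1 hi with hik | rfl
    · obtain ⟨c', hc', hlo', hhi', hq⟩ := hI i hik
      refine ⟨c', hc', hlo', hhi', fun q hq4 => ?_⟩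
      simp only [f2, f3, f4, n2, n3, n4, Function.update_apply]
      rw [if_neg (by omega), if_neg (by omega), if_neg (by omega), if_neg (by omega),
        if_neg (by omega), if_neg (by omega), if_neg (by omega), if_neg (by omega),
        if_neg (by omega), if_neg (by omega), if_neg (by omega), if_neg (by omega)]
      exact hq q hq4
    · refine ⟨c, hc, hlo, hhi, fun q hq4 => ?_⟩
      simp only [f2, f3, f4, Function.update_apply]
      interval_cases q <;> simp [partStart, partEnd]
  refine hmain.mono ?_ fun _ _ => id
  generalize n.size = z
  have h1 : 200 * ((n + 1) * (z + 2)) = 200 * (n * z) + 400 * n + 200 * z + 400 := by ring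
  have h2 : 4 + (n + 1) * ((60 * (z + 1) + (30 + (15 + (15 + (15 + (15 + 6)))))) + 1 + 6) =
    60 * (n * z) + 163 * n + 60 * z + 167 := by ring
  omega

end RealRAM

/-! ### The query program -/

namespace RealRAM

theorem searchInv_of_rowSplit {n : ℕ} {x y ξ h w : ℕ → ℝ} {a b c ℓ r σ : ℝ} {s : State}
    (hn : 1 ≤ n) (hr : 0 ≤ r) (hσ : σ = 1 ∨ σ = -1) (hℓ : 0 < ℓ) (hb : 0 ≤ b)
    (hab : a ≠ 0 ∨ b ≠ 0) (hξ : ∀ i < n, ξ i = (b * x i - a * y i) / ℓ)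
    (hh : ∀ i < n, h i = (a * x i + b * y i - c) / ℓ)
    (hx : ∀ i < n, ∀ j < n, i ≠ j → x i ≠ x j) (hrow : SlopeOrder n x y (s.natMem 0))
    (hbest : s.realReg 11 = lineLoss n ξ h w r (s.realReg 10))
    (hsplit : ∀ i < n, RowSplit n
      (fun i k => 0 ≤ a + b * secantSlope x y i (s.natMem 0 (i * n + k))) s i) :
    SearchInv n (4 * n) ξ h w r σ s := by
  refine ⟨fun l hl e e' h1 h2 h3 => ?_, hbest, fun i hi j hj _ => ?_⟩
  · obtain ⟨i, q, hq, rfl⟩ : ∃ i q, q < 4 ∧ l = 4 * i + q := ⟨l / 4, l % 4, by omega, by omega⟩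
    have hi : i < n := by omega
    obtain ⟨cut, hcut, hlo, hhi, hspec⟩ := hsplit i hi
    obtain ⟨s2, s3, s4⟩ := hspec q hq
    rw [s3] at h1
    rw [s4] at h3
    obtain ⟨k, rfl⟩ := Nat.exists_eq_add_of_le ((Nat.le_add_right _ _).trans h1)
    obtain ⟨k', rfl⟩ := Nat.exists_eq_add_of_le (((Nat.le_add_right _ _).trans h1).trans h2)
    rw [Nat.add_le_add_iff_left] at h1 h2
    rw [Nat.add_lt_add_iff_left] at h3
    rcases h2.eq_or_lt with rfl | h2
    · exact le_rfl
    rw [listValue, listValue, s2]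
    have key : k' < n - 1 → 0 < (a + b * secantSlope x y i (s.natMem 0 (i * n + k))) *
        (a + b * secantSlope x y i (s.natMem 0 (i * n + k'))) →
        candidate r σ ξ h i (s.natMem 0 (i * n + k)) ≤
          candidate r σ ξ h i (s.natMem 0 (i * n + k')) := fun hk' hpos =>
      candidate_le_candidate hr hσ hℓ hξ hh hi (hrow.lt i hi k (by omega)) (hrow.lt i hi k' hk')
        (hx _ (hrow.lt i hi k (by omega)) _ hi (hrow.ne i hi k (by omega)))
        (hx _ (hrow.lt i hi k' hk') _ hi (hrow.ne i hi k' hk'))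
        (hrow.slope_lt i hi k k' h2 hk').le hpos
    interval_cases q <;> simp only [partStart, partEnd] at h1 h3
    · refine key (by omega) (mul_pos_of_neg_of_neg ?_ ?_)
      · exact not_le.1 (hlo k (by omega))
      · exact not_le.1 (hlo k' h3)
    · omega
    · -- beyond the split the sign is strict, as the slopes are
      have hpos : ∀ k, cut < k → k < n - 1 →
          0 < a + b * secantSlope x y i (s.natMem 0 (i * n + k)) := by
        intro k hk hk'
        have h0 := hhi cut le_rfl (by omega)
        rcases hb.eq_or_lt with hb | hb
        · rw [← hb, zero_mul, add_zero] at h0 ⊢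
          exact lt_of_le_of_ne h0 fun ha => hab.elim (fun h => h ha.symm) fun h => h hb.symm
        · have := mul_lt_mul_of_pos_left (hrow.slope_lt i hi cut k hk hk') hb
          linarith
      exact key h3 (mul_pos (hpos k (by omega) (by omega)) (hpos k' (by omega) h3))
    · omega
  · obtain ⟨cut, hcut, hlo, hhi, hspec⟩ := hsplit i hi
    obtain ⟨q, hq, k, h1, h2, h3⟩ : ∃ q < 4, ∃ k, partStart n cut q ≤ k ∧ k < partEnd n cut q ∧
        s.natMem 0 (i * n + k) = j := by
      by_cases hij : j = i
      · exact ⟨3, by omega, n - 1, le_rfl, by simp only [partEnd]; omega, by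
          rw [hrow.self i hi, hij]⟩
      · obtain ⟨k, hk, hkj⟩ := hrow.exists_eq i hi j hj hij
        rcases lt_trichotomy k cut with hc | hc | hc
        · exact ⟨0, by omega, k, by simp [partStart], by simpa [partEnd] using hc, hkj⟩
        · exact ⟨1, by omega, k, by simp [partStart, hc], by simp [partEnd, hc], hkj⟩
        · exact ⟨2, by omega, k, by simp only [partStart]; omega, by simpa [partEnd] using hk, hkj⟩
    obtain ⟨s2, s3, s4⟩ := hspec q hq
    refine ⟨4 * i + q, by omega, i * n + k, ?_, ?_, ?_⟩
    · rw [s3]; omega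
    · rw [s4]; omega
    · rw [listValue, s2, h3]

/-- Considers all candidates with the sign in register 8. -/
def sideProgram : Program :=
  .seq listProgram
    (.seq (.setNat 4 (.add (.add (.reg 0) (.reg 0)) (.add (.reg 0) (.reg 0)))) searchProgram)

theorem runs_sideProgram {n : ℕ} {x y ξ h w : ℕ → ℝ} {a b c ℓ r σ : ℝ} {s : State}
    (H : LineData n ξ h w r s) (hn : 1 ≤ n) (hr : 0 ≤ r) (hw : ∀ i < n, 0 < w i)
    (hσ : σ = 1 ∨ σ = -1) (hℓ : 0 < ℓ) (hb : 0 ≤ b)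
    (hab : a ≠ 0 ∨ b ≠ 0) (hξ : ∀ i < n, ξ i = (b * x i - a * y i) / ℓ)
    (hh : ∀ i < n, h i = (a * x i + b * y i - c) / ℓ)
    (hx : ∀ i < n, ∀ j < n, i ≠ j → x i ≠ x j) (hrow : SlopeOrder n x y (s.natMem 0))
    (hbest : s.realReg 11 = lineLoss n ξ h w r (s.realReg 10))
    (e0 : s.realMem 0 = x) (e1 : s.realMem 1 = y) (ha : s.realReg 1 = a) (hb' : s.realReg 2 = b)
    (h8 : s.realReg 8 = σ) :
    Runs sideProgram s (5300 * ((6 * n.size + 8) * ((n + 1) * (n.size + 3)))) (fun s' =>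
      s'.realReg 11 = lineLoss n ξ h w r (s'.realReg 10) ∧ s'.realReg 11 ≤ s.realReg 11 ∧
      ∀ i < n, ∀ j < n, s'.realReg 11 ≤ lineLoss n ξ h w r (candidate r σ ξ h i j)) := by
  have hmain : Runs sideProgram s (200 * ((n + 1) * (n.size + 2)) + (8 +
      5000 * ((6 * n.size + 8) * ((n + 1) * (n.size + 3))))) (fun s' =>
      s'.realReg 11 = lineLoss n ξ h w r (s'.realReg 10) ∧ s'.realReg 11 ≤ s.realReg 11 ∧
      ∀ i < n, ∀ j < n, s'.realReg 11 ≤ lineLoss n ξ h w r (candidate r σ ξ h i j)) := by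
    refine Runs.seq (runs_listProgram
      (P := fun i k => 0 ≤ a + b * secantSlope x y i (s.natMem 0 (i * n + k))) H.n_eq hn
      (fun i _ k _ => by rw [e0, e1, ha, hb'])
      fun i hi k k' hk hk' hp => hp.trans ?_) fun s₁ hF₁ hsplit => ?_
    · rcases hk.eq_or_lt with rfl | hk
      · exact le_rfl
      · have := mul_le_mul_of_nonneg_left (hrow.slope_lt i hi k k' hk hk').le hb
        linarith
    rw [← hF₁.natMem 0 rfl] at hsplit hrow
    refine Runs.seq (R := fun s' => s'.natReg 4 = 4 * n) (Runs.of_wp ?_ rfl (by decide))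
      fun s₂ hF₂ h4 => ?_
    · simp only [Program.wp, NatExpr.eval, hF₁.natReg 0 rfl, H.n_eq, Function.update_self]
      intro _ h
      omega
    rw [← hF₂.natMem 0 rfl] at hsplit hrow
    have hb₂ : s₂.realReg 11 = s.realReg 11 := (hF₂.realReg 11 rfl).trans (hF₁.realReg 11 rfl)
    have hb₂' : s₂.realReg 10 = s.realReg 10 := (hF₂.realReg 10 rfl).trans (hF₁.realReg 10 rfl)
    have hsplit₂ : ∀ i < n, RowSplit n
        (fun i k => 0 ≤ a + b * secantSlope x y i (s₂.natMem 0 (i * n + k))) s₂ i := by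
      intro i hi
      obtain ⟨cut, h1, h2, h3, h4⟩ := hsplit i hi
      refine ⟨cut, h1, h2, h3, fun q hq => ?_⟩
      rw [hF₂.natMem 2 rfl, hF₂.natMem 3 rfl, hF₂.natMem 4 rfl]
      exact h4 q hq
    refine (runs_searchProgram ((H.frame hF₁ rfl).frame hF₂ rfl) hr hw
      ((hF₂.realReg 8 rfl).trans ((hF₁.realReg 8 rfl).trans h8)) h4 le_rfl
      (searchInv_of_rowSplit hn hr hσ hℓ hb hab hξ hh hx hrow (by rw [hb₂, hb₂', hbest]) hsplit₂)
      ?_).mono le_rfl fun s' _ h => by rwa [← hb₂]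
    refine (Finset.sum_le_card_nsmul (Finset.range (4 * n)) _ n fun l hl => ?_).trans ?_
    · rw [Finset.mem_range] at hl
      obtain ⟨i, q, hq, rfl⟩ : ∃ i q, q < 4 ∧ l = 4 * i + q := ⟨l / 4, l % 4, by omega, by omega⟩
      obtain ⟨cut, hcut, -, -, hspec⟩ := hsplit₂ i (by omega)
      rw [listSize, (hspec q hq).2.1, (hspec q hq).2.2]
      interval_cases q <;> simp only [partStart, partEnd] <;> omega
    · rw [Finset.card_range, smul_eq_mul, pow_two, mul_assoc]
  refine hmain.mono ?_ fun _ _ => id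
  generalize n.size = z
  have h1 : (6 * z + 8) * ((n + 1) * (z + 3)) = (n + 1) * (z + 2) + ((n + 1) * (z + 2) *
    (6 * z + 7) + (6 * z + 8) * n + (6 * z + 8)) := by ring
  generalize (n + 1) * (z + 2) * (6 * z + 7) = p at *
  generalize (6 * z + 8) * n = p at *
  generalize (6 * z + 8) * ((n + 1) * (z + 3)) = u at *
  generalize (n + 1) * (z + 2) = v at *
  omega

/-- Brings the equation of the line into a form with nonnegative second coefficient, and computes
the length of its normal vector and half the minimal distance. -/
def normalizeProgram : Program :=
  .seq (.ite (.realLt (.reg 2) (.const 0))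
      (.seq (.setReal 1 (.sub (.const 0) (.reg 1)))
      (.seq (.setReal 2 (.sub (.const 0) (.reg 2))) (.setReal 3 (.sub (.const 0) (.reg 3)))))
      .skip)
  (.seq (.setReal 6 (.sqrt (.add (.mul (.reg 1) (.reg 1)) (.mul (.reg 2) (.reg 2)))))
    (.setReal 7 (.div (.reg 0) (.const 2))))

theorem runs_normalizeProgram (L : Line) {s : State} (h1 : s.realReg 1 = L.a)
    (h2 : s.realReg 2 = L.b) (h3 : s.realReg 3 = L.c) :
    Runs normalizeProgram s 40 (fun s' => 0 ≤ s'.realReg 2 ∧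
      (s'.realReg 1 ≠ 0 ∨ s'.realReg 2 ≠ 0) ∧
      L.points = {p | s'.realReg 1 * p 0 + s'.realReg 2 * p 1 = s'.realReg 3} ∧
      s'.realReg 6 = √(s'.realReg 1 ^ 2 + s'.realReg 2 ^ 2) ∧
      s'.realReg 7 = s.realReg 0 / 2) := by
  have hmain : Runs normalizeProgram s (20 + 20) (fun s' => 0 ≤ s'.realReg 2 ∧
      (s'.realReg 1 ≠ 0 ∨ s'.realReg 2 ≠ 0) ∧
      L.points = {p | s'.realReg 1 * p 0 + s'.realReg 2 * p 1 = s'.realReg 3} ∧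
      s'.realReg 6 = √(s'.realReg 1 ^ 2 + s'.realReg 2 ^ 2) ∧
      s'.realReg 7 = s.realReg 0 / 2) := by
    refine Runs.seq (R := fun s' => 0 ≤ s'.realReg 2 ∧ (s'.realReg 1 ≠ 0 ∨ s'.realReg 2 ≠ 0) ∧
      L.points = {p | s'.realReg 1 * p 0 + s'.realReg 2 * p 1 = s'.realReg 3})
      (Runs.of_wp ?_ rfl (by decide)) ?_
    · simp only [Program.wp, RealExpr.eval, Test.Holds, Function.update_apply, h1, h2, h3,
        Rat.cast_zero]
      simp only [Nat.reduceEqDiff, if_false, if_true]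
      refine ⟨?_, fun hb => ⟨not_lt.1 hb, L.nondegenerate, rfl⟩⟩
      rintro hb a rfl b rfl c rfl
      refine ⟨by linarith, by simpa using L.nondegenerate, ?_⟩
      ext p
      simp only [Line.points, Set.mem_ofPred_eq]
      constructor <;> intro h <;> linarith
    · rintro s₁ hF₁ hs₁
      refine Runs.of_wp ?_ rfl (by decide)
      simp only [Program.wp, RealExpr.eval, Function.update_apply]
      simp only [Nat.reduceEqDiff, if_false, if_true]
      rintro l rfl r rfl
      refine ⟨hs₁.1, hs₁.2.1, hs₁.2.2, by rw [pow_two, pow_two], ?_⟩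
      rw [hF₁.realReg 0 rfl]
      norm_num
  exact hmain

/-- Computes the coordinates of the customers with respect to the line. -/
def coordinateProgram : Program :=
  forLoop 1 (.reg 0)
    (.seq (.writeReal 3 (.reg 1) (.div (.sub (.mul (.reg 2) (.read 0 (.reg 1)))
        (.mul (.reg 1) (.read 1 (.reg 1)))) (.reg 6)))
      (.writeReal 4 (.reg 1) (.div (.sub (.add (.mul (.reg 1) (.read 0 (.reg 1)))
        (.mul (.reg 2) (.read 1 (.reg 1)))) (.reg 3)) (.reg 6))))

theorem runs_coordinateProgram {n : ℕ} {s : State} (h0 : s.natReg 0 = n) :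
    Runs coordinateProgram s ((n + 1) * (40 + 1 + 6)) (fun s' => ∀ i < n,
      s'.realMem 3 i = (s.realReg 2 * s.realMem 0 i - s.realReg 1 * s.realMem 1 i) /
        s.realReg 6 ∧
      s'.realMem 4 i = (s.realReg 1 * s.realMem 0 i + s.realReg 2 * s.realMem 1 i -
        s.realReg 3) / s.realReg 6) := by
  refine Runs.forLoop (N := .reg 0) n 40 (fun k s' => ∀ i < k,
      s'.realMem 3 i = (s.realReg 2 * s.realMem 0 i - s.realReg 1 * s.realMem 1 i) /
        s.realReg 6 ∧
      s'.realMem 4 i = (s.realReg 1 * s.realMem 0 i + s.realReg 2 * s.realMem 1 i -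
        s.realReg 3) / s.realReg 6) rfl
    (fun k s' x h => h) (fun s' hF => (hF.natReg 0 rfl).trans h0) (by simp) ?_
  intro k s' hk hF g1 hI
  have m0 : s'.realMem 0 = s.realMem 0 := hF.realMem 0 rfl
  have m1 : s'.realMem 1 = s.realMem 1 := hF.realMem 1 rfl
  have r1 : s'.realReg 1 = s.realReg 1 := hF.realReg 1 rfl
  have r2 : s'.realReg 2 = s.realReg 2 := hF.realReg 2 rfl
  have r3 : s'.realReg 3 = s.realReg 3 := hF.realReg 3 rfl
  have r6 : s'.realReg 6 = s.realReg 6 := hF.realReg 6 rfl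
  refine Runs.of_wp ?_ rfl (by decide)
  simp only [Program.wp, RealExpr.eval, NatExpr.eval, Function.update_apply, g1, m0, m1, r1, r2,
    r3, r6]
  simp only [Nat.reduceEqDiff, if_false, if_true]
  rintro j u hj hu j' u' hj' hu' i hi
  rw [hj, hj']
  by_cases hik : i = k
  · rw [hik, Function.update_self, Function.update_self]
    exact ⟨hu, hu'⟩
  · rw [Function.update_of_ne hik, Function.update_of_ne hik]
    exact hI i (by omega)

/-- Evaluates the weight loss at the origin of the line, as the first point of the search. -/
def startProgram : Program :=
  .seq (.setReal 9 (.const 0))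
  (.seq lossProgram
    (.seq (.setReal 10 (.reg 9))
      (.ite (.realLe (.reg 16) (.reg 17)) (.setReal 11 (.reg 17)) (.setReal 11 (.reg 16)))))

theorem runs_startProgram {n : ℕ} {ξ h w : ℕ → ℝ} {r : ℝ} {s : State}
    (H : LineData n ξ h w r s) (hr : 0 ≤ r) (hw : ∀ i < n, 0 < w i) :
    Runs startProgram s (2 + (2000 * ((n + 1) * (n.size + 2)) + 20)) (fun s' =>
      s'.realReg 11 = lineLoss n ξ h w r (s'.realReg 10)) := by
  refine Runs.seq (R := fun s' => s'.realReg 9 = 0)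
    (Runs.of_wp (by simp [Program.wp, RealExpr.eval]) rfl (by decide)) fun s₁ hF₁ h₁ => ?_
  refine Runs.seq (runs_lossProgram (H.frame hF₁ rfl) hr hw rfl) ?_
  rintro s₂ hF₂ ⟨h17, h16⟩
  rw [← hF₂.realReg 9 rfl] at h17 h16
  refine Runs.of_wp ?_ rfl (by decide)
  simp only [Program.wp, RealExpr.eval, Test.Holds, Function.update_apply]
  simp only [Nat.reduceEqDiff, if_false, if_true]
  rintro u rfl
  refine ⟨fun hle v hv => ?_, fun hle v hv => ?_⟩
  · rw [hv, lineLoss, ← h16, ← h17, max_eq_left hle]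
  · rw [hv, lineLoss, ← h16, ← h17, max_eq_right (not_le.1 hle).le]

/-- Computes the coordinates of the best point. -/
def outputProgram : Program :=
  .seq (.setReal 4 (.div (.add (.mul (.reg 2) (.reg 10)) (.mul (.reg 1) (.div (.reg 3) (.reg 6))))
      (.reg 6)))
    (.setReal 5 (.div (.sub (.mul (.reg 2) (.div (.reg 3) (.reg 6))) (.mul (.reg 1) (.reg 10)))
      (.reg 6)))

theorem runs_outputProgram (s : State) :
    Runs outputProgram s 30 (fun s' => outputPoint s' =
      linePoint (s.realReg 1) (s.realReg 2) (s.realReg 3) (s.realReg 6) (s.realReg 10)) := by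
  refine Runs.of_wp ?_ rfl (by decide)
  simp only [outputProgram, Program.wp, RealExpr.eval]
  rintro u rfl v rfl
  simp [outputPoint, linePoint]

/-- The query program. -/
def queryProgram : Program :=
  .seq normalizeProgram
  (.seq coordinateProgram
  (.seq startProgram
  (.seq (.setReal 8 (.const 1))
  (.seq sideProgram
  (.seq (.setReal 8 (.const (-1)))
  (.seq sideProgram
    outputProgram))))))

/-- What the preprocessing provides, and what every query preserves. -/
structure Ready {n : ℕ} (v : Fin n → Plane) (w : Fin n → ℝ) (R : ℝ) (s : State) : Prop where
  n_eq : s.natReg 0 = n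
  R_eq : s.realReg 0 = R
  x_eq : ∀ i : Fin n, s.realMem 0 i = v i 0
  y_eq : ∀ i : Fin n, s.realMem 1 i = v i 1
  w_eq : ∀ i : Fin n, s.realMem 2 i = w i
  slopeOrder : SlopeOrder n (s.realMem 0) (s.realMem 1) (s.natMem 0)

theorem Ready.frame {n : ℕ} {v : Fin n → Plane} {w : Fin n → ℝ} {R : ℝ} {s s' : State}
    {p : Program} (H : Ready v w R s) (hF : Frame p s s')
    (hp : (p.writesNatReg 0 || p.writesRealReg 0 || p.writesRealMem 0 || p.writesRealMem 1 ||
      p.writesRealMem 2 || p.writesNatMem 0) = false) : Ready v w R s' := by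
  simp only [Bool.or_eq_false_iff] at hp
  obtain ⟨⟨⟨⟨⟨h1, h2⟩, h3⟩, h4⟩, h5⟩, h6⟩ := hp
  obtain ⟨g1, g2, g3, g4, g5, g6⟩ := H
  rw [← hF.natReg _ h1] at g1
  rw [← hF.realReg _ h2] at g2
  rw [← hF.realMem _ h3] at g3
  rw [← hF.realMem _ h4] at g4
  rw [← hF.realMem _ h5] at g5
  rw [← hF.realMem _ h3, ← hF.realMem _ h4, ← hF.natMem _ h6] at g6
  exact ⟨g1, g2, g3, g4, g5, g6⟩

theorem Ready.loadLine {n : ℕ} {v : Fin n → Plane} {w : Fin n → ℝ} {R : ℝ} {s : State}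
    (H : Ready v w R s) (L : Line) : Ready v w R (loadLine L s) :=
  ⟨H.n_eq, H.R_eq, H.x_eq, H.y_eq, H.w_eq, H.slopeOrder⟩

theorem runs_queryProgram {n : ℕ} {v : Fin n → Plane} {w : Fin n → ℝ} {R : ℝ} {s : State}
    (hn : 1 ≤ n) (hv : GeneralPosition v) (hw : ∀ i, 0 < w i) (hR : 0 ≤ R) (H : Ready v w R s)
    (L : Line) :
    Runs queryProgram (loadLine L s) (20000 * ((6 * n.size + 8) * ((n + 1) * (n.size + 3))))
      (fun s' => IsLocalOptimal v w R L (outputPoint s')) := by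
  have hmain : Runs queryProgram (loadLine L s) (40 + ((n + 1) * (40 + 1 + 6) +
      ((2 + (2000 * ((n + 1) * (n.size + 2)) + 20)) + (2 +
      (5300 * ((6 * n.size + 8) * ((n + 1) * (n.size + 3))) + (2 +
      (5300 * ((6 * n.size + 8) * ((n + 1) * (n.size + 3))) + 30)))))))
      (fun s' => IsLocalOptimal v w R L (outputPoint s')) := by
    refine Runs.seq (runs_normalizeProgram L rfl rfl rfl) ?_
    rintro s₁ hF₁ ⟨hb, hab, hL, hℓ, hr⟩
    have H₁ := (H.loadLine L).frame hF₁ rfl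
    rw [(H.loadLine L).R_eq] at hr
    set a := s₁.realReg 1 with ha
    set b := s₁.realReg 2 with hb'
    set c := s₁.realReg 3 with hc
    set ℓ := s₁.realReg 6 with hℓ'
    have hpos : 0 < a ^ 2 + b ^ 2 := by
      rcases hab with h | h
      · have := sq_pos_of_ne_zero h; positivity
      · have := sq_pos_of_ne_zero h; positivity
    have hℓpos : 0 < ℓ := by rw [hℓ]; exact Real.sqrt_pos.2 hpos
    refine Runs.seq (runs_coordinateProgram H₁.n_eq) fun s₂ hF₂ hcoord => ?_
    have H₂ := H₁.frame hF₂ rfl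
    set x := s₂.realMem 0 with hx
    set y := s₂.realMem 1 with hy
    set ξ := s₂.realMem 3 with hξ
    set h := s₂.realMem 4 with hh
    set W := s₂.realMem 2 with hW
    rw [← ha, ← hb', ← hc, ← hℓ', ← hF₂.realMem 0 rfl, ← hF₂.realMem 1 rfl, ← hx, ← hy] at hcoord
    have HL : LineData n ξ h W (R / 2) s₂ :=
      ⟨H₂.n_eq, rfl, rfl, rfl, (hF₂.realReg 7 rfl).trans hr⟩
    have hWpos : ∀ i < n, 0 < W i := fun i hi => by
      rw [show W i = w ⟨i, hi⟩ from H₂.w_eq ⟨i, hi⟩]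
      exact hw _
    have hxne : ∀ i < n, ∀ j < n, i ≠ j → x i ≠ x j := fun i hi j hj hij => by
      rw [show x i = v ⟨i, hi⟩ 0 from H₂.x_eq ⟨i, hi⟩, show x j = v ⟨j, hj⟩ 0 from H₂.x_eq ⟨j, hj⟩]
      exact hv.x_ne _ _ fun h => hij (by simpa using h)
    have hr0 : 0 ≤ R / 2 := by positivity
    refine Runs.seq (runs_startProgram HL hr0 hWpos) fun s₃ hF₃ hbest₃ => ?_
    have H₃ := H₂.frame hF₃ rfl
    refine Runs.seq (R := fun s' => s'.realReg 8 = 1)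
      (Runs.of_wp (by simp [Program.wp, RealExpr.eval]) rfl (by decide)) fun s₄ hF₄ h8₄ => ?_
    have H₄ := H₃.frame hF₄ rfl
    have x₄ : s₄.realMem 0 = x := (hF₄.realMem 0 rfl).trans (hF₃.realMem 0 rfl)
    have y₄ : s₄.realMem 1 = y := (hF₄.realMem 1 rfl).trans (hF₃.realMem 1 rfl)
    have a₄ : s₄.realReg 1 = a := by rw [hF₄.realReg 1 rfl, hF₃.realReg 1 rfl, hF₂.realReg 1 rfl]
    have b₄ : s₄.realReg 2 = b := by rw [hF₄.realReg 2 rfl, hF₃.realReg 2 rfl, hF₂.realReg 2 rfl]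
    have HL₄ := (HL.frame hF₃ rfl).frame hF₄ rfl
    have ord₄ := H₄.slopeOrder
    rw [x₄, y₄] at ord₄
    refine Runs.seq (runs_sideProgram HL₄ hn hr0 hWpos (.inl rfl) hℓpos hb hab
      (fun i hi => (hcoord i hi).1) (fun i hi => (hcoord i hi).2) hxne ord₄
      (by rw [hF₄.realReg 11 rfl, hF₄.realReg 10 rfl, hbest₃]) x₄ y₄ a₄ b₄ h8₄) ?_
    rintro s₅ hF₅ ⟨hbest₅, -, hall₅⟩
    have H₅ := H₄.frame hF₅ rfl
    refine Runs.seq (R := fun s' => s'.realReg 8 = -1)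
      (Runs.of_wp (by simp [Program.wp, RealExpr.eval]) rfl (by decide)) fun s₆ hF₆ h8₆ => ?_
    have H₆ := H₅.frame hF₆ rfl
    have x₆ : s₆.realMem 0 = x := by rw [hF₆.realMem 0 rfl, hF₅.realMem 0 rfl, x₄]
    have y₆ : s₆.realMem 1 = y := by rw [hF₆.realMem 1 rfl, hF₅.realMem 1 rfl, y₄]
    have a₆ : s₆.realReg 1 = a := by rw [hF₆.realReg 1 rfl, hF₅.realReg 1 rfl, a₄]
    have b₆ : s₆.realReg 2 = b := by rw [hF₆.realReg 2 rfl, hF₅.realReg 2 rfl, b₄]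
    have HL₆ := (HL₄.frame hF₅ rfl).frame hF₆ rfl
    have ord₆ := H₆.slopeOrder
    rw [x₆, y₆] at ord₆
    refine Runs.seq (runs_sideProgram HL₆ hn hr0 hWpos (.inr rfl) hℓpos hb hab
      (fun i hi => (hcoord i hi).1) (fun i hi => (hcoord i hi).2) hxne ord₆
      (by rw [hF₆.realReg 11 rfl, hF₆.realReg 10 rfl, hbest₅]) x₆ y₆ a₆ b₆ h8₆) ?_
    rintro s₇ hF₇ ⟨hbest₇, hle₇, hall₇⟩
    rw [hF₆.realReg 11 rfl] at hle₇
    refine (runs_outputProgram s₇).mono le_rfl fun s' _ hout => ?_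
    rw [hout, hF₇.realReg 1 rfl, hF₇.realReg 2 rfl, a₆, b₆,
      show s₇.realReg 3 = c by
        rw [hF₇.realReg 3 rfl, hF₆.realReg 3 rfl, hF₅.realReg 3 rfl, hF₄.realReg 3 rfl,
          hF₃.realReg 3 rfl, hF₂.realReg 3 rfl],
      show s₇.realReg 6 = ℓ by
        rw [hF₇.realReg 6 rfl, hF₆.realReg 6 rfl, hF₅.realReg 6 rfl, hF₄.realReg 6 rfl,
          hF₃.realReg 6 rfl, hF₂.realReg 6 rfl]]
    have HC : LineCoordinates v a b c ℓ ξ h := by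
      refine ⟨hℓpos, by rw [hℓ, Real.sq_sqrt hpos.le], fun i => ?_, fun i => ?_⟩
      · rw [(hcoord i i.2).1, ← H₂.x_eq i, ← H₂.y_eq i]
      · rw [(hcoord i i.2).2, ← H₂.x_eq i, ← H₂.y_eq i]
    refine HC.isLocalOptimal (w' := W) H₂.w_eq hw hR hL fun s' => ?_
    by_contra! hlt
    obtain ⟨σ, hσ, i, hi, j, hj, hcand⟩ := exists_candidate_lineLoss_le hr0 hWpos hlt
    rw [← hbest₇] at hlt
    rcases hσ with rfl | rfl
    · exact absurd (hle₇.trans (hall₅ i hi j hj)) (not_le.2 (hcand.trans_lt hlt))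
    · exact absurd (hall₇ i hi j hj) (not_le.2 (hcand.trans_lt hlt))
  refine hmain.mono ?_ fun _ _ => id
  generalize n.size = z
  have h1 : (6 * z + 8) * ((n + 1) * (z + 3)) = (n + 1) * (z + 2) + ((n + 1) * (z + 2) *
    (6 * z + 7) + (6 * z + 8) * n + (6 * z + 8)) := by ring
  have h2 : (n + 1) * (z + 2) = (n + 1) + (n + 1) * (z + 1) := by ring
  generalize (n + 1) * (z + 2) * (6 * z + 7) = p at *
  generalize (6 * z + 8) * n = p at *
  generalize (6 * z + 8) * ((n + 1) * (z + 3)) = u at *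
  generalize (n + 1) * (z + 2) = v at *
  omega

end RealRAM

/-! ### The preprocessing program -/

namespace RealRAM

/-- The `k`-th customer other than `i`. -/
def other (i k : ℕ) : ℕ := k + (1 - (i - k))

theorem other_ne (i k : ℕ) : other i k ≠ i := by
  rw [other]
  omega

theorem other_lt {n i k : ℕ} (hk : k < n - 1) : other i k < n := by
  rw [other]
  omega

theorem other_injective (i : ℕ) : Function.Injective (other i) := by
  intro k k' h
  rw [other, other] at h
  omega

theorem exists_other_eq {n i j : ℕ} (hi : i < n) (hj : j < n) (hij : j ≠ i) :
    ∃ k < n - 1, other i k = j := by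
  rcases lt_or_gt_of_ne hij with h | h
  · exact ⟨j, by omega, by rw [other]; omega⟩
  · exact ⟨j - 1, by omega, by rw [other]; omega⟩

/-- Row `i` contains the customers other than `i`, by nondecreasing slope, and then `i`. -/
def RowFilled (n : ℕ) (x y : ℕ → ℝ) (row : ℕ → ℕ) (i : ℕ) : Prop :=
  row (i * n + (n - 1)) = i ∧
    ∃ idx, SortedPerm (fun k => secantSlope x y i (other i k)) idx (n - 1) ∧
      ∀ k < n - 1, row (i * n + k) = other i (idx k)

theorem slopeOrder_of_rowFilled {n : ℕ} {v : Fin n → Plane} (hv : GeneralPosition v) {x y : ℕ → ℝ}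
    (hx : ∀ i : Fin n, x i = v i 0) (hy : ∀ i : Fin n, y i = v i 1) {row : ℕ → ℕ}
    (H : ∀ i < n, RowFilled n x y row i) : SlopeOrder n x y row := by
  have hslope : ∀ i < n, ∀ j < n, ∀ j' < n, j ≠ i → j' ≠ i → j ≠ j' →
      secantSlope x y i j ≠ secantSlope x y i j' := by
    intro i hi j hj j' hj' h1 h2 h3 heq
    have hΔ : ∀ j (hj : j < n), j ≠ i →
        y j = (x j - x i) * secantSlope x y i j + y i := by
      intro j hj hji
      have : x j - x i ≠ 0 := by
        rw [sub_ne_zero, show x j = v ⟨j, hj⟩ 0 from hx ⟨j, hj⟩,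
          show x i = v ⟨i, hi⟩ 0 from hx ⟨i, hi⟩]
        exact hv.x_ne _ _ fun h => hji (by simpa using h)
      rw [secantSlope, mul_div_cancel₀ _ this]
      ring
    refine hv.not_collinear ⟨i, hi⟩ ⟨j, hj⟩ ⟨j', hj'⟩ (fun h => h1 (by simpa using h.symm))
      (fun h => h2 (by simpa using h.symm)) (fun h => h3 (by simpa using h)) ?_
    have hp : ∀ j (hj : j < n), secantSlope x y i j = secantSlope x y i j' → j ≠ i →
        v ⟨j, hj⟩ = (x j - x i) • (!₂[1, secantSlope x y i j'] : Plane) +ᵥ v ⟨i, hi⟩ := by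
      intro j hj hs hji
      ext k
      fin_cases k
      · simp [← hx]
      · have := hΔ j hj hji
        rw [hs] at this
        simpa [← hy, ← hx] using this
    rw [collinear_iff_of_mem (p₀ := v ⟨i, hi⟩) (by simp)]
    refine ⟨!₂[1, secantSlope x y i j'], ?_⟩
    rintro p (rfl | rfl | rfl)
    · exact ⟨0, by simp⟩
    · exact ⟨_, hp j hj heq h1⟩
    · exact ⟨_, hp j' hj' rfl h2⟩
  refine ⟨fun i hi => (H i hi).1, fun i hi k hk => ?_, fun i hi k hk => ?_,
    fun i hi k k' hk hk' => ?_, fun i hi j hj hij => ?_⟩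
  all_goals obtain ⟨-, idx, hidx, hrow⟩ := H i hi
  · rw [hrow k hk]
    exact other_lt (hidx.lt hk)
  · rw [hrow k hk]
    exact other_ne _ _
  · rw [hrow k (by omega), hrow k' hk']
    refine lt_of_le_of_ne (hidx.mono k k' hk.le hk') ?_
    refine hslope i hi _ (other_lt (hidx.lt (by omega))) _ (other_lt (hidx.lt hk')) (other_ne _ _)
      (other_ne _ _) fun h => ?_
    have := hidx.injOn (by omega) hk' (other_injective i h)
    omega
  · obtain ⟨e, he, rfl⟩ := exists_other_eq hi hj hij
    obtain ⟨k, hk, rfl⟩ := hidx.exists_eq he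
    exact ⟨k, hk, hrow k hk⟩

/-- Lists the customers other than the one in register 1, and their slopes. -/
def keyProgram : Program :=
  forLoop 2 (.sub (.reg 0) (.const 1))
    (.seq (.setNat 7 (.add (.reg 2) (.sub (.const 1) (.sub (.reg 1) (.reg 2)))))
    (.seq (.writeNat 1 (.reg 2) (.reg 7))
      (.writeReal 10 (.reg 2) (.div (.sub (.read 1 (.reg 7)) (.read 1 (.reg 1)))
        (.sub (.read 0 (.reg 7)) (.read 0 (.reg 1)))))))

theorem runs_keyProgram {n i : ℕ} {s : State} (h0 : s.natReg 0 = n) (h1 : s.natReg 1 = i) :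
    Runs keyProgram s ((n - 1 + 1) * (40 + 3 + 6)) (fun s' => ∀ k < n - 1,
      s'.natMem 1 k = other i k ∧
      s'.realMem 10 k = secantSlope (s.realMem 0) (s.realMem 1) i (other i k)) := by
  refine Runs.forLoop (N := .sub (.reg 0) (.const 1)) (n - 1) 40 (fun l s' => ∀ k < l,
      s'.natMem 1 k = other i k ∧
      s'.realMem 10 k = secantSlope (s.realMem 0) (s.realMem 1) i (other i k)) rfl
    (fun k s' x h => h) (fun s' hF => ?_) (by simp) ?_
  · rw [NatExpr.eval, NatExpr.eval, NatExpr.eval, hF.natReg 0 rfl, h0]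
  intro l s' hl hF g2 hI
  have m0 : s'.realMem 0 = s.realMem 0 := hF.realMem 0 rfl
  have m1 : s'.realMem 1 = s.realMem 1 := hF.realMem 1 rfl
  have g1 : s'.natReg 1 = i := (hF.natReg 1 rfl).trans h1
  refine Runs.of_wp ?_ rfl (by decide)
  simp only [Program.wp, RealExpr.eval, NatExpr.eval, Function.update_apply, g1, g2, m0, m1]
  simp only [Nat.reduceEqDiff, if_false, if_true]
  rintro o ho j u hj hu j' u' hj' hu' k hk
  rw [hj, hj']
  by_cases hkl : k = l
  · rw [hkl, Function.update_self, Function.update_self, hu, hu', secantSlope, other, ho]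
    exact ⟨rfl, rfl⟩
  · rw [Function.update_of_ne hkl, Function.update_of_ne hkl]
    exact hI k (by omega)

/-- Enters the sorted customers into the row that begins at register 3. -/
def copyProgram : Program :=
  forLoop 2 (.sub (.reg 0) (.const 1))
    (.writeNat 0 (.add (.reg 3) (.reg 2)) (.read 1 (.read 20 (.reg 2))))

theorem runs_copyProgram {n : ℕ} {s : State} (h0 : s.natReg 0 = n) :
    Runs copyProgram s ((n - 1 + 1) * (10 + 3 + 6)) (fun s' =>
      (∀ k < n - 1, s'.natMem 0 (s.natReg 3 + k) = s.natMem 1 (s.natMem 20 k)) ∧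
      ∀ a < s.natReg 3, s'.natMem 0 a = s.natMem 0 a) := by
  refine Runs.forLoop (N := .sub (.reg 0) (.const 1)) (n - 1) 10 (fun l s' =>
      (∀ k < l, s'.natMem 0 (s.natReg 3 + k) = s.natMem 1 (s.natMem 20 k)) ∧
      ∀ a < s.natReg 3, s'.natMem 0 a = s.natMem 0 a) rfl
    (fun k s' x h => h) (fun s' hF => ?_) (by simp) ?_
  · rw [NatExpr.eval, NatExpr.eval, NatExpr.eval, hF.natReg 0 rfl, h0]
  rintro l s' hl hF g2 ⟨hI, hI'⟩
  have m1 : s'.natMem 1 = s.natMem 1 := hF.natMem 1 rfl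
  have m20 : s'.natMem 20 = s.natMem 20 := hF.natMem 20 rfl
  have g3 : s'.natReg 3 = s.natReg 3 := hF.natReg 3 rfl
  refine Runs.of_wp ?_ rfl (by decide)
  simp only [Program.wp, NatExpr.eval, g2, g3, m1, m20]
  rintro j u hj hu
  rw [Function.update_self, hj]
  refine ⟨fun k hk => ?_, fun a ha => ?_⟩
  · by_cases hkl : k = l
    · rw [hkl, Function.update_self, hu]
    · rw [Function.update_of_ne (by omega)]
      exact hI k (by omega)
  · rw [Function.update_of_ne (by omega)]
    exact hI' a ha

/-- Fills the row of the customer in register 1. -/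
def fillProgram : Program :=
  .seq keyProgram
  (.seq (.setNat 20 (.sub (.reg 0) (.const 1)))
  (.seq sortProgram
  (.seq copyProgram
    (.seq (.writeNat 0 (.sub (.add (.reg 3) (.reg 0)) (.const 1)) (.reg 1))
      (.setNat 3 (.add (.reg 3) (.reg 0)))))))

/-- The preprocessing program. -/
def preprocessProgram : Program :=
  .seq (.setNat 3 (.const 0)) (forLoop 1 (.reg 0) fillProgram)

theorem runs_preprocessProgram {n : ℕ} {s : State} (h0 : s.natReg 0 = n) (hn : 1 ≤ n) :
    Runs preprocessProgram s (500 * ((n + 1) * ((n + 1) * (n.size + 1)))) (fun s' =>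
      ∀ i < n, RowFilled n (s.realMem 0) (s.realMem 1) (s'.natMem 0) i) := by
  have hmain : Runs preprocessProgram s (2 + (n + 1) * (((n - 1 + 1) * (40 + 3 + 6) + (5 +
      (150 * ((n - 1 + 1) * ((n - 1).size + 1)) + ((n - 1 + 1) * (10 + 3 + 6) + 15)))) + 1 + 6))
      (fun s' => ∀ i < n, RowFilled n (s.realMem 0) (s.realMem 1) (s'.natMem 0) i) := by
    refine Runs.seq (R := fun s' => s'.natReg 3 = 0)
      (Runs.of_wp (by simp [Program.wp, NatExpr.eval]) rfl (by decide)) fun s₁ hF₁ h₁ => ?_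
    refine (Runs.forLoop (N := .reg 0) n ((n - 1 + 1) * (40 + 3 + 6) + (5 +
      (150 * ((n - 1 + 1) * ((n - 1).size + 1)) + ((n - 1 + 1) * (10 + 3 + 6) + 15))))
      (fun k s' => s'.natReg 3 = k * n ∧
        ∀ i < k, RowFilled n (s.realMem 0) (s.realMem 1) (s'.natMem 0) i) rfl
      (fun k s' x hI => by simpa using hI)
      (fun s' hF => ((hF.natReg 0 rfl).trans (hF₁.natReg 0 rfl)).trans h0) (by simp [h₁])
      ?_).mono le_rfl fun s' hF h => h.2
    rintro i s₂ hi hF₂ g1 ⟨g3, hI⟩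
    have g0 : s₂.natReg 0 = n := ((hF₂.natReg 0 rfl).trans (hF₁.natReg 0 rfl)).trans h0
    refine Runs.seq (runs_keyProgram g0 g1) fun s₃ hF₃ h₃ => ?_
    rw [hF₂.realMem 0 rfl, hF₂.realMem 1 rfl, hF₁.realMem 0 rfl, hF₁.realMem 1 rfl] at h₃
    refine Runs.seq (R := fun s' => s'.natReg 20 = n - 1)
      (Runs.of_wp (by simp [Program.wp, NatExpr.eval, hF₃.natReg 0 rfl, g0]) rfl (by decide))
      fun s₄ hF₄ h₄ => ?_
    refine Runs.seq (runs_sortProgram h₄) fun s₅ hF₅ h₅ => ?_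
    rw [hF₄.realMem 10 rfl] at h₅
    have k0 : s₅.natReg 0 = n := by
      rw [hF₅.natReg 0 rfl, hF₄.natReg 0 rfl, hF₃.natReg 0 rfl, g0]
    have k1 : s₅.natReg 1 = i := by
      rw [hF₅.natReg 1 rfl, hF₄.natReg 1 rfl, hF₃.natReg 1 rfl, g1]
    have k3 : s₅.natReg 3 = i * n := by
      rw [hF₅.natReg 3 rfl, hF₄.natReg 3 rfl, hF₃.natReg 3 rfl, g3]
    have m1 : s₅.natMem 1 = s₃.natMem 1 := by rw [hF₅.natMem 1 rfl, hF₄.natMem 1 rfl]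
    have m0 : s₅.natMem 0 = s₂.natMem 0 := by
      rw [hF₅.natMem 0 rfl, hF₄.natMem 0 rfl, hF₃.natMem 0 rfl]
    refine Runs.seq (runs_copyProgram k0) ?_
    rintro s₆ hF₆ ⟨hnew, hold⟩
    rw [k3] at hnew hold
    rw [m0] at hold
    have l0 : s₆.natReg 0 = n := (hF₆.natReg 0 rfl).trans k0
    have l1 : s₆.natReg 1 = i := (hF₆.natReg 1 rfl).trans k1
    have l3 : s₆.natReg 3 = i * n := (hF₆.natReg 3 rfl).trans k3
    refine Runs.of_wp ?_ rfl (by decide)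
    simp only [Program.wp, NatExpr.eval, l0, l1, l3, Function.update_self]
    rintro j u hj rfl b rfl
    have hj' : j = u * n + (n - 1) := by omega
    refine ⟨by ring, fun i' hi' => ?_⟩
    rcases Nat.lt_succ_iff_lt_or_eq.1 hi' with hlt | rfl
    · obtain ⟨h1, idx, h2, h3⟩ := hI i' hlt
      have hle : i' * n + n ≤ u * n := by
        have := Nat.mul_le_mul_right n hlt
        rwa [Nat.succ_mul] at this
      refine ⟨?_, idx, h2, fun k hk => ?_⟩
      · rw [Function.update_of_ne (by omega), hold _ (by omega), h1]
      · rw [Function.update_of_ne (by omega), hold _ (by omega), h3 k hk]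
    · refine ⟨by rw [hj', Function.update_self], s₅.natMem 20, ⟨h₅.perm, fun k k' hk hk' => ?_⟩,
        fun k hk => ?_⟩
      · have := h₅.mono k k' hk hk'
        rwa [(h₃ _ (h₅.lt (hk.trans_lt hk'))).2, (h₃ _ (h₅.lt hk')).2] at this
      · rw [Function.update_of_ne (by omega), hnew k hk, m1, (h₃ _ (h₅.lt hk)).1]
  refine hmain.mono ?_ fun _ _ => id
  rw [Nat.sub_add_cancel hn]
  have h1 : (n - 1).size ≤ n.size := Nat.size_le_size (by omega)
  have h2 : n * ((n - 1).size + 1) ≤ (n + 1) * (n.size + 1) := Nat.mul_le_mul (by omega) (by omega)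
  have h3 : n + 1 ≤ (n + 1) * (n.size + 1) := Nat.le_mul_of_pos_right _ (by omega)
  have h4 : n * (40 + 3 + 6) + (5 + (150 * (n * ((n - 1).size + 1)) + (n * (10 + 3 + 6) + 15))) +
      1 + 6 ≤ 250 * ((n + 1) * (n.size + 1)) := by omega
  have h5 := Nat.mul_le_mul_left (n + 1) h4
  have h6 : (n + 1) * (250 * ((n + 1) * (n.size + 1))) =
      250 * ((n + 1) * ((n + 1) * (n.size + 1))) := by ring
  have h7 : 1 ≤ (n + 1) * ((n + 1) * (n.size + 1)) := Nat.succ_le_of_lt (by positivity)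
  omega

end RealRAM

/-! ### The running times -/

theorem size_le_log {n : ℕ} (hn : 1 ≤ n) : (n.size : ℝ) ≤ 3 * Real.log (n + 1) := by
  have h1 := Nat.size_pos.2 hn
  obtain ⟨t, ht⟩ := Nat.exists_eq_add_of_lt h1
  rw [zero_add] at ht
  have h2 : 2 ^ t ≤ n := Nat.lt_size.1 (by omega)
  have h3 : (t : ℝ) * Real.log 2 ≤ Real.log (n + 1) := by
    rw [← Real.log_pow]
    refine Real.log_le_log (by positivity) ?_
    have : ((2 ^ t : ℕ) : ℝ) ≤ n := by exact_mod_cast h2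
    push_cast at this
    linarith
  have h4 : Real.log 2 ≤ Real.log (n + 1) := by
    refine Real.log_le_log (by norm_num) ?_
    have : (1 : ℝ) ≤ n := by exact_mod_cast hn
    linarith
  have h5 := Real.log_two_gt_d9
  rw [ht]
  push_cast
  nlinarith [t.cast_nonneg (α := ℝ)]

theorem one_le_log {n : ℕ} (hn : 1 ≤ n) : 1 ≤ 2 * Real.log ((n : ℝ) + 1) := by
  have h4 : Real.log 2 ≤ Real.log (n + 1) := by
    refine Real.log_le_log (by norm_num) ?_
    have : (1 : ℝ) ≤ n := by exact_mod_cast hn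
    linarith
  have h5 := Real.log_two_gt_d9
  linarith

theorem preprocess_bound {n t : ℕ} (hn : 1 ≤ n)
    (ht : t ≤ 500 * ((n + 1) * ((n + 1) * (n.size + 1)))) :
    (t : ℝ) ≤ 20000000 * ((n : ℝ) ^ 2 * Real.log ((n : ℝ) + 1)) := by
  have h1 := size_le_log hn
  have h2 := one_le_log hn
  have h3 : (1 : ℝ) ≤ n := by exact_mod_cast hn
  have ht' : (t : ℝ) ≤ 500 * (((n : ℝ) + 1) * ((n + 1) * (n.size + 1))) := by exact_mod_cast ht
  set l := Real.log ((n : ℝ) + 1)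
  have hl : 0 ≤ l := by linarith
  calc (t : ℝ) ≤ 500 * (((n : ℝ) + 1) * ((n + 1) * (n.size + 1))) := ht'
    _ ≤ 500 * ((2 * (n : ℝ)) * ((2 * n) * (5 * l))) := by gcongr <;> linarith
    _ = 10000 * ((n : ℝ) ^ 2 * l) := by ring
    _ ≤ 20000000 * ((n : ℝ) ^ 2 * l) := by gcongr; norm_num

theorem query_bound {n t : ℕ} (hn : 1 ≤ n)
    (ht : t ≤ 20000 * ((6 * n.size + 8) * ((n + 1) * (n.size + 3)))) :
    (t : ℝ) ≤ 20000000 * ((n : ℝ) * Real.log ((n : ℝ) + 1) ^ 2) := by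
  have h1 := size_le_log hn
  have h2 := one_le_log hn
  have h3 : (1 : ℝ) ≤ n := by exact_mod_cast hn
  have ht' : (t : ℝ) ≤ 20000 * ((6 * n.size + 8) * (((n : ℝ) + 1) * (n.size + 3))) := by
    exact_mod_cast ht
  set l := Real.log ((n : ℝ) + 1)
  have hl : 0 ≤ l := by linarith
  calc (t : ℝ) ≤ 20000 * ((6 * n.size + 8) * (((n : ℝ) + 1) * (n.size + 3))) := ht'
    _ ≤ 20000 * ((34 * l) * ((2 * (n : ℝ)) * (9 * l))) := by gcongr <;> linarith
    _ = 12240000 * ((n : ℝ) * l ^ 2) := by ring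
    _ ≤ 20000000 * ((n : ℝ) * l ^ 2) := by gcongr; norm_num

theorem mainTheorem4 :
    ∃ (preprocess query : RealRAM.Program) (C : ℝ),
      ∀ (n : ℕ) (v : Fin n → Plane) (w : Fin n → ℝ) (R : ℝ),
        1 ≤ n → GeneralPosition v → (∀ i, 0 < w i) → 0 ≤ R →
        ∃ (t₁ : ℕ) (s₁ : RealRAM.State),
          RealRAM.Exec preprocess (inputState v w R) t₁ s₁ ∧
          (t₁ : ℝ) ≤ C * ((n : ℝ) ^ 2 * Real.log ((n : ℝ) + 1)) ∧
          ∀ s : RealRAM.State, AfterQueries query s₁ s →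
            ∀ L : Line, ∃ (t : ℕ) (s' : RealRAM.State),
              RealRAM.Exec query (loadLine L s) t s' ∧
              (t : ℝ) ≤ C * ((n : ℝ) * Real.log ((n : ℝ) + 1) ^ 2) ∧
              IsLocalOptimal v w R L (outputPoint s') := by
  refine ⟨RealRAM.preprocessProgram, RealRAM.queryProgram, 20000000, ?_⟩
  intro n v w R hn hv hw hR
  have hx : ∀ i : Fin n, (inputState v w R).realMem 0 i = v i 0 := fun i => by simp [inputState]
  have hy : ∀ i : Fin n, (inputState v w R).realMem 1 i = v i 1 := fun i => by simp [inputState]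
  obtain ⟨t₁, s₁, hexec, ht₁, hrows⟩ :=
    RealRAM.runs_preprocessProgram (s := inputState v w R) (by simp [inputState]) hn
  have hF := hexec.frame
  have hready : RealRAM.Ready v w R s₁ := by
    refine ⟨?_, ?_, fun i => ?_, fun i => ?_, fun i => ?_, ?_⟩
    · rw [hF.natReg 0 rfl]; simp [inputState]
    · rw [hF.realReg 0 rfl]; simp [inputState]
    · rw [hF.realMem 0 rfl, hx]
    · rw [hF.realMem 1 rfl, hy]
    · rw [hF.realMem 2 rfl]; simp [inputState]
    · rw [hF.realMem 0 rfl, hF.realMem 1 rfl]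
      exact RealRAM.slopeOrder_of_rowFilled hv hx hy hrows
  refine ⟨t₁, s₁, hexec, preprocess_bound hn ht₁, fun s hs L => ?_⟩
  have hs' : RealRAM.Ready v w R s := by
    induction hs with
    | none => exact hready
    | step L _ he ih => exact (ih.loadLine L).frame he.frame rfl
  obtain ⟨t, s', he, ht, hopt⟩ := RealRAM.runs_queryProgram hn hv hw hR hs' L
  exact ⟨t, s', he, query_bound hn ht, hopt⟩
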